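/- **Graphs.** A (vacuum) Feynman graph of the quartic $O(N)^3$-invariant tensor model with tetrahedral interaction is a finite graph whose edges are colored by $\{0,1,2,3\}$, in which every vertex is incident to exactly one edge of each color, and such that every connected component of the subgraph of colors $1,2,3$ (a *bubble*) is a tetrahedron $K_4$ with its proper edge-coloring. In a bubble, label the vertices ("corners") by $0,1,2,3$ so that the corner $0$ is joined to the corner $c$ by the edge of color $c$, $c=1,2,3$; hence for $\{i,j,k\}=\{1,2,3\}$ the corners $j$ and $k$ are also joined by an edge of color $i$. Graphs are considered up to color-preserving isomorphism. A bicolored cycle of colors $\{0,i\}$ is a *face* of color $i$; its length is its number of edges of color $0$. The *jacket* $J_i$, $i\in\{1,2,3\}$, is obtained by deleting the edges of color $i$; with $V$, $E(J_i)$, $F(J_i)$ the numbers of its vertices, edges and bicolored cycles, its genus $g_i\in\frac12\mathbb Z$ is defined by $2-2g_i=V-E(J_i)+F(J_i)$. The *degree* of a connected graph is $\omega=g_1+g_2+g_3$. A connected graph is *2PI* if there is no pair of distinct edges of color $0$ whose removal disconnects it. A *dipole of color* $i$ consists of two distinct bubbles joined by two edges of color $0$ that belong to a common face of color $i$ of length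 two. A *melonic insertion* on an edge of color $0$ with ends $x,y$ deletes this edge and adds two bubbles $a,b$ together with edges of color $0$ joining $x$ to the corner $0$ of $a$, $y$ to the corner $0$ of $b$, and the corner $c$ of $a$ to the corner $c$ of $b$ for $c=1,2,3$. *Decorating* a graph by melonic 2-point functions means performing any finite number (possibly zero) of successive melonic insertions on edges of color $0$, including those created by earlier insertions. **Three families.** Let $\{i,j,k\}=\{1,2,3\}$. 1. $O_i$ is the graph with six bubbles placed at the vertices of an octahedron and twelve edges of color $0$ along the edges of the octahedron, whose faces of color $i$ are the three equators (of length 4), and whose faces of colors $j$ and $k$ are the two classes of triangles of the octahedron in a checkerboard coloring. 2. A tadpole of color $i$ is a bubble whose corners $j,k$ are joined by an edge of color $0$; its two legs are the corners $0$ and $i$. Write a dipole of color $i$ as two bubbles $a$ (top) and $b$ (bottom) whose corners $j$ are joined to each other, and whose corners $k$ are joined to each other, by edges of color $0$; its left legs are the corners $0$ of $a$ and $b$, its right legs are the corners $i$ of $a$ and $b$. For $m\ge0$, $i,i'\in\{1,2,3\}$ and $j_1,\dots,j_m\in\{1,2,3\}$, the graph $T_{i,i'}(j_1,\dots,j_m)$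 is obtained from a tadpole of color $i$, dipoles of colors $j_1,\dots,j_m$, and a tadpole of color $i'$ by joining by edges of color $0$ the two legs of the first tadpole to the two left legs of the first dipole, the right legs of each dipole to the left legs of the next one (top to top, bottom to bottom), and the right legs of the last dipole to the legs of the last tadpole (for $m=0$ the two tadpoles are joined directly). 3. For $m\ge2$, $C_i^{(m)}$ is the closed cyclic chain of $m$ dipoles of color $i$: the right legs of each dipole are joined by edges of color $0$ to the left legs of the next one in cyclic order, top to top and bottom to bottom. **Theorem.** A connected graph of the model has degree $1$ (next-to-next-to-leading order) if and only if it is obtained by decorating with melonic 2-point functions on the edges of color $0$ one of the following graphs: $O_i$ with $i\in\{1,2,3\}$; $T_{i,i'}(j_1,\dots,j_m)$ with $m\ge0$ and $i,i',j_1,\dots,j_m\in\{1,2,3\}$; $C_i^{(m)}$ with $m\ge2$ and $i\in\{1,2,3\}$. Moreover $O_1,O_2,O_3$ (a single graph up to permutation of the colors) are exactly the connected graphs of degree $1$ that are 2PI and contain no dipole. -/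

import Mathlib

universe u v

/-- A (vacuum) Feynman graph of the quartic `O(N)³`-invariant model with tetrahedral interaction,
on the vertex set `V`: every vertex has exactly one half-edge of each colour `0, 1, 2, 3`, and
`nbr c x` is the other end of the edge of colour `c` at `x`. The relation `nbr 1 ∘ nbr 2 = nbr 3`
says that the components of the subgraph with colours `1, 2, 3` (the bubbles) are tetrahedra:
`K₄` with its proper edge colouring. Edges of colour `0` are the propagators. Connectedness is
a separate predicate. -/
structure FeynmanGraph (V : Type u) where
  nbr : Fin 4 → V → V
  nbr_nbr : ∀ c x, nbr c (nbr c x) = x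
  nbr_ne : ∀ c x, nbr c x ≠ x
  tetrahedral : ∀ x, nbr 1 (nbr 2 x) = nbr 3 x

namespace FeynmanGraph

/-! ### Connectedness, jackets, degree -/

/-- The graph is nonempty and any two vertices are joined by a path of edges. -/
def Connected {V : Type u} (G : FeynmanGraph V) : Prop :=
  Nonempty V ∧ ∀ x y : V, Relation.ReflTransGen (fun a b => ∃ c, G.nbr c a = b) x y

/-- Number of edges of colour `c`. -/
noncomputable def numEdges {V : Type u} (G : FeynmanGraph V) (c : Fin 4) : ℕ :=
  Nat.card (Quot fun x y : V => G.nbr c x = y)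

/-- Number of bicoloured cycles with colours `{c, d}`, that is, of connected components of the
subgraph formed by the edges of colours `c` and `d`. -/
noncomputable def numCycles {V : Type u} (G : FeynmanGraph V) (c d : Fin 4) : ℕ :=
  Nat.card (Quot fun x y : V => G.nbr c x = y ∨ G.nbr d x = y)

/-- Euler characteristic `V - E + F` of the jacket obtained by deleting the edges of colour `i`;
its faces are the bicoloured cycles of the three remaining pairs of colours. -/
noncomputable def jacketEuler {V : Type u} (G : FeynmanGraph V) (i : Fin 4) : ℤ :=
  (Nat.card V : ℤ) - ∑ c : Fin 4 with c ≠ i, (G.numEdges c : ℤ)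
    + ∑ p : Fin 4 × Fin 4 with p.1 < p.2 ∧ p.1 ≠ i ∧ p.2 ≠ i, (G.numCycles p.1 p.2 : ℤ)

/-- The (half-integer) genus `g` of a jacket, from `χ = 2 - 2 g`. -/
noncomputable def jacketGenus {V : Type u} (G : FeynmanGraph V) (i : Fin 4) : ℚ :=
  (2 - (G.jacketEuler i : ℚ)) / 2

/-- The degree: the sum of the genera of the three jackets. -/
noncomputable def degree {V : Type u} (G : FeynmanGraph V) : ℚ :=
  G.jacketGenus 1 + G.jacketGenus 2 + G.jacketGenus 3

/-! ### 2PI and dipole-free graphs -/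

/-- The edges of colour `0` at `x` and at `y` form a 2-edge-cut: they are two different edges and
deleting them disconnects the graph. -/
def IsTwoEdgeCut {V : Type u} (G : FeynmanGraph V) (x y : V) : Prop :=
  y ≠ x ∧ y ≠ G.nbr 0 x ∧
    ¬ ∀ a b : V, Relation.ReflTransGen
      (fun s t => ∃ c, G.nbr c s = t ∧
        ¬ (c = 0 ∧ (s = x ∨ s = G.nbr 0 x ∨ s = y ∨ s = G.nbr 0 y))) a b

/-- 2-particle-irreducible: there is no 2-edge-cut. -/
def IsTwoPI {V : Type u} (G : FeynmanGraph V) : Prop := ∀ x y, ¬ G.IsTwoEdgeCut x y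

/-- The edges of colour `0` at `x` and at `nbr i x` join two different bubbles and belong to a face
of colour `i` of length two, namely `x, nbr i x, nbr i y, y` with `y = nbr 0 x`. -/
def IsDipoleAt {V : Type u} (G : FeynmanGraph V) (i : Fin 4) (x : V) : Prop :=
  i ≠ 0 ∧ (∀ c, c ≠ 0 → G.nbr 0 x ≠ G.nbr c x) ∧ G.nbr 0 (G.nbr i x) = G.nbr i (G.nbr 0 x)

/-- The graph contains no dipole. -/
def IsDipoleFree {V : Type u} (G : FeynmanGraph V) : Prop := ∀ i x, ¬ G.IsDipoleAt i x

/-! ### Isomorphisms and melonic insertions -/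

/-- Isomorphism of edge-coloured graphs (the colours are preserved). -/
def Isomorphic {V : Type u} {W : Type v} (G : FeynmanGraph V) (H : FeynmanGraph W) : Prop :=
  ∃ e : V ≃ W, ∀ c x, e (G.nbr c x) = H.nbr c (e x)

open Classical in
/-- The melonic insertion on the edge of colour `0` between `x` and `y = nbr 0 x`: this edge is cut
and two bubbles `false`, `true` are inserted. Corner `0` of `false` is joined to `x`, corner `0`
of `true` is joined to `y`, and the corners `1, 2, 3` of `false` are joined to the corresponding
corners of `true`. In a bubble, the edge of colour `c` at the corner `k` leads to `k ^^^ c`. -/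
noncomputable def melonNbr {V : Type u} (G : FeynmanGraph V) (x : V) (c : Fin 4) :
    V ⊕ (Bool × Fin 4) → V ⊕ (Bool × Fin 4)
  | Sum.inl z =>
      if c = 0 ∧ z = x then Sum.inr (false, 0)
      else if c = 0 ∧ z = G.nbr 0 x then Sum.inr (true, 0)
      else Sum.inl (G.nbr c z)
  | Sum.inr (b, k) =>
      if c = 0 then
        if k = 0 then Sum.inl (if b = true then G.nbr 0 x else x) else Sum.inr (!b, k)
      else Sum.inr (b, k ^^^ c)

/-- The graph obtained by a melonic insertion on the edge of colour `0` at `x`. -/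
noncomputable def melonInsert {V : Type u} (G : FeynmanGraph V) (x : V) :
    FeynmanGraph (V ⊕ (Bool × Fin 4)) where
  nbr := G.melonNbr x
  nbr_nbr := by
    have hx := G.nbr_ne 0 x
    rintro c (z | ⟨b, k⟩)
    · by_cases hc : c = 0
      · subst hc
        by_cases h1 : z = x
        · simp [melonNbr, h1]
        · by_cases h2 : z = G.nbr 0 x
          · simp [melonNbr, h2, hx]
          · have h3 : G.nbr 0 z ≠ x := fun h => h2 (by rw [← h, G.nbr_nbr])
            have h4 : G.nbr 0 z ≠ G.nbr 0 x := fun h => h1 (by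
              rw [← G.nbr_nbr 0 z, h, G.nbr_nbr])
            simp [melonNbr, h1, h2, h3, h4, G.nbr_nbr]
      · simp [melonNbr, hc, G.nbr_nbr]
    · by_cases hc : c = 0
      · subst hc
        by_cases hk : k = 0
        · subst hk
          cases b <;> simp [melonNbr, hx]
        · simp [melonNbr, hk]
      · have : k ^^^ c ^^^ c = k := by revert k c; decide
        simp [melonNbr, hc, this]
  nbr_ne := by
    rintro c (z | ⟨b, k⟩)
    · simp only [melonNbr]
      split_ifs
      · simp
      · simp
      · simpa using G.nbr_ne c z
    · simp only [melonNbr]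
      have : c ≠ 0 → k ^^^ c ≠ k := by revert k c; decide
      by_cases hc : c = 0
      · by_cases hk : k = 0 <;> simp [hc, hk]
      · simpa [hc] using this hc
  tetrahedral := by
    rintro (z | ⟨b, k⟩)
    · simp [melonNbr, G.tetrahedral]
    · have : k ^^^ 2 ^^^ 1 = k ^^^ 3 := by revert k; decide
      simp [melonNbr, this]

/-- `IsMelonicDecoration C G`: up to isomorphism, `G` is obtained from `C` by recursive melonic
insertions on edges of colour `0` (possibly none), that is, by replacing every edge of colour `0`
of `C` by a melonic 2-point function. -/
inductive IsMelonicDecoration {W : Type v} (C : FeynmanGraph W) :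
    ∀ {V : Type u}, FeynmanGraph V → Prop
  | core {V : Type u} (G : FeynmanGraph V) : G.Isomorphic C → IsMelonicDecoration C G
  | insert {V V' : Type u} (G : FeynmanGraph V) (x : V) (G' : FeynmanGraph V') :
      IsMelonicDecoration C G → G'.Isomorphic (G.melonInsert x) → IsMelonicDecoration C G'

/-! ### The three families -/

/-- The graph with set of bubbles `B` and propagators `p`: the vertices are the corners
`0, 1, 2, 3` of the bubbles, the edge of colour `i ∈ {1, 2, 3}` at the corner `k` of a bubble leads
to the corner `k ^^^ i` of the same bubble, and the edges of colour `0` are given by the fixed-point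
free involution `p`. -/
def ofPropagator {B : Type u} (p : B × Fin 4 → B × Fin 4) (hp : ∀ x, p (p x) = x)
    (hne : ∀ x, p x ≠ x) : FeynmanGraph (B × Fin 4) where
  nbr c x := if c = 0 then p x else (x.1, x.2 ^^^ c)
  nbr_nbr := by
    rintro c ⟨b, k⟩
    have : k ^^^ c ^^^ c = k := by revert k c; decide
    by_cases hc : c = 0 <;> simp [hc, hp, this]
  nbr_ne := by
    rintro c ⟨b, k⟩
    by_cases hc : c = 0
    · simpa [hc] using hne (b, k)
    · have : k ^^^ c ≠ k := by revert k c; decide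
      simpa [hc] using this
  tetrahedral := by
    rintro ⟨b, k⟩
    have : k ^^^ 2 ^^^ 1 = k ^^^ 3 := by revert k; decide
    simp [this]

/-- Propagators of the graph with six bubbles placed at the vertices `(a, s)` of an octahedron
(`a` is the axis, and `s = true` is the negative direction of it) and twelve propagators along its
edges. With `{i, j, k} = {1, 2, 3}`, the faces of colour `i` are the three equators, and those of
colours `j` and `k` are the triangles of the two classes of a checkerboard colouring.
At the bubble `(a, s)`, the corners `0` and `i` point to the positive and the negative vertex of the
axis `a + 1`, and the corners `j` and `k` to the vertices `s` and `!s` of the axis `a + 2`. -/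
def octahedronProp (i : Fin 3) (x : (Fin 3 × Bool) × Fin 4) : (Fin 3 × Bool) × Fin 4 :=
  match x with
  | ((a, s), c) =>
    if c = 0 then ((a + 1, false), if s then (i + 2).succ else (i + 1).succ)
    else if c = i.succ then ((a + 1, true), if s then (i + 1).succ else (i + 2).succ)
    else if c = (i + 1).succ then ((a + 2, s), if s then i.succ else 0)
    else ((a + 2, !s), if s then i.succ else 0)

/-- The octahedral graph whose equators are its faces of colour `i.succ`. -/
def octahedron (i : Fin 3) : FeynmanGraph ((Fin 3 × Bool) × Fin 4) :=
  ofPropagator (octahedronProp i) (by revert i; decide) (by revert i; decide)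

/-- Bubbles of a chain of `m` dipoles which has a tadpole at each end. Each dipole consists of
a top bubble (`false`) and a bottom bubble (`true`). -/
inductive ChainBubble (m : ℕ) : Type
  | left : ChainBubble m
  | dipole (l : Fin m) (s : Bool) : ChainBubble m
  | right : ChainBubble m

/-- Left end of the link in position `r ≤ m` (top line or bottom line `s`) of the chain: it is at
the left tadpole if `r = 0`, and otherwise on the right side of the dipole preceding the link. -/
def chainLeftEnd {m : ℕ} (i : Fin 3) (j : Fin m → Fin 3) (r : Fin (m + 1)) (s : Bool) :
    ChainBubble m × Fin 4 :=
  Fin.cases (motive := fun _ => ChainBubble m × Fin 4)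
    (.left, if s then i.succ else 0) (fun l => (.dipole l s, (j l).succ)) r

/-- Right end of the link in position `r ≤ m` (top line or bottom line `s`) of the chain: it is at
the right tadpole if `r = m`, and otherwise on the left side of the dipole following the link. -/
def chainRightEnd {m : ℕ} (i' : Fin 3) (r : Fin (m + 1)) (s : Bool) :
    ChainBubble m × Fin 4 :=
  Fin.lastCases (motive := fun _ => ChainBubble m × Fin 4)
    (.right, if s then i'.succ else 0) (fun l => (.dipole l s, 0)) r

/-- Propagators of the chain with dipoles of colours `j 0, …, j (m - 1)`, closed at its ends by
tadpoles of colours `i` and `i'`. The corners `0` of a dipole of colour `j` are its left legs, the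
corners `j` its right legs, and at each of the two other corners its bubbles are joined together;
in a tadpole of colour `i`, the corners `0` and `i` are the legs and the two others are joined. -/
def tadpoleChainProp {m : ℕ} (i i' : Fin 3) (j : Fin m → Fin 3) :
    ChainBubble m × Fin 4 → ChainBubble m × Fin 4
  | (.left, c) =>
      if c = 0 then chainRightEnd i' 0 false
      else if c = i.succ then chainRightEnd i' 0 true
      else (.left, c ^^^ i.succ)
  | (.dipole l s, c) =>
      if c = 0 then chainLeftEnd i j l.castSucc s
      else if c = (j l).succ then chainRightEnd i' l.succ s
      else (.dipole l (!s), c)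
  | (.right, c) =>
      if c = 0 then chainLeftEnd i j (Fin.last m) false
      else if c = i'.succ then chainLeftEnd i j (Fin.last m) true
      else (.right, c ^^^ i'.succ)

theorem tadpoleChainProp_leftEnd {m : ℕ} (i i' : Fin 3) (j : Fin m → Fin 3) (r : Fin (m + 1))
    (s : Bool) :
    tadpoleChainProp i i' j (chainLeftEnd i j r s) = chainRightEnd i' r s := by
  refine Fin.cases ?_ (fun l => ?_) r
  · cases s <;> simp [chainLeftEnd, tadpoleChainProp]
  · simp [chainLeftEnd, tadpoleChainProp]

theorem tadpoleChainProp_rightEnd {m : ℕ} (i i' : Fin 3) (j : Fin m → Fin 3) (r : Fin (m + 1))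
    (s : Bool) :
    tadpoleChainProp i i' j (chainRightEnd i' r s) = chainLeftEnd i j r s := by
  refine Fin.lastCases ?_ (fun l => ?_) r
  · cases s <;> simp [chainRightEnd, tadpoleChainProp]
  · simp [chainRightEnd, tadpoleChainProp]

theorem chainLeftEnd_ne {m : ℕ} (i i' : Fin 3) (j : Fin m → Fin 3) (r : Fin (m + 1))
    (s : Bool) : chainLeftEnd i j r s ≠ chainRightEnd i' r s := by
  have hR : ∀ t : Fin (m + 1), chainRightEnd i' t s = (.right, if s then i'.succ else 0) ∨
      ∃ l, chainRightEnd i' t s = (.dipole l s, 0) := by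
    refine Fin.lastCases ?_ (fun l => ?_)
    · left; simp [chainRightEnd]
    · right; exact ⟨l, by simp [chainRightEnd]⟩
  have hL : (∃ c, chainLeftEnd i j r s = (.left, c)) ∨
      ∃ l, chainLeftEnd i j r s = (.dipole l s, (j l).succ) := by
    refine Fin.cases ?_ (fun l => ?_) r
    · left; exact ⟨_, rfl⟩
    · right; exact ⟨l, rfl⟩
  rcases hL with ⟨c, h⟩ | ⟨l, h⟩ <;> rcases hR r with h' | ⟨l', h'⟩ <;> simp [h, h']

theorem tadpoleChainProp_involutive {m : ℕ} (i i' : Fin 3) (j : Fin m → Fin 3)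
    (x : ChainBubble m × Fin 4) :
    tadpoleChainProp i i' j (tadpoleChainProp i i' j x) = x := by
  have key : ∀ (c : Fin 4) (a : Fin 3), c ≠ 0 → c ≠ a.succ →
      c ^^^ a.succ ≠ 0 ∧ c ^^^ a.succ ≠ a.succ ∧ c ^^^ a.succ ^^^ a.succ = c := by decide
  obtain ⟨b, c⟩ := x
  have hL : ∀ r s, (b, c) = chainLeftEnd i j r s →
      tadpoleChainProp i i' j (tadpoleChainProp i i' j (b, c)) = (b, c) := by
    intro r s h
    rw [h, tadpoleChainProp_leftEnd, tadpoleChainProp_rightEnd]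
  have hR : ∀ r s, (b, c) = chainRightEnd i' r s →
      tadpoleChainProp i i' j (tadpoleChainProp i i' j (b, c)) = (b, c) := by
    intro r s h
    rw [h, tadpoleChainProp_rightEnd, tadpoleChainProp_leftEnd]
  cases b with
  | left =>
    by_cases h0 : c = 0
    · exact hL 0 false (by simp [chainLeftEnd, h0])
    by_cases h1 : c = i.succ
    · exact hL 0 true (by simp [chainLeftEnd, h1])
    obtain ⟨k1, k2, k3⟩ := key c i h0 h1
    simp only [tadpoleChainProp, h0, h1, if_false, k1, k2, k3]
  | dipole l s =>
    by_cases h0 : c = 0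
    · exact hR l.castSucc s (by simp [chainRightEnd, h0])
    by_cases h1 : c = (j l).succ
    · exact hL l.succ s (by simp [chainLeftEnd, h1])
    simp [tadpoleChainProp, h0, h1]
  | right =>
    by_cases h0 : c = 0
    · exact hR (Fin.last m) false (by simp [chainRightEnd, h0])
    by_cases h1 : c = i'.succ
    · exact hR (Fin.last m) true (by simp [chainRightEnd, h1])
    obtain ⟨k1, k2, k3⟩ := key c i' h0 h1
    simp only [tadpoleChainProp, h0, h1, if_false, k1, k2, k3]

theorem tadpoleChainProp_ne {m : ℕ} (i i' : Fin 3) (j : Fin m → Fin 3)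
    (x : ChainBubble m × Fin 4) : tadpoleChainProp i i' j x ≠ x := by
  have key : ∀ (c : Fin 4) (a : Fin 3), c ^^^ a.succ ≠ c := by decide
  obtain ⟨b, c⟩ := x
  have hL : ∀ r s, (b, c) = chainLeftEnd i j r s → tadpoleChainProp i i' j (b, c) ≠ (b, c) := by
    intro r s h
    rw [h, tadpoleChainProp_leftEnd]
    exact (chainLeftEnd_ne i i' j r s).symm
  have hR : ∀ r s, (b, c) = chainRightEnd i' r s →
      tadpoleChainProp i i' j (b, c) ≠ (b, c) := by
    intro r s h
    rw [h, tadpoleChainProp_rightEnd]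
    exact chainLeftEnd_ne i i' j r s
  cases b with
  | left =>
    by_cases h0 : c = 0
    · exact hL 0 false (by simp [chainLeftEnd, h0])
    by_cases h1 : c = i.succ
    · exact hL 0 true (by simp [chainLeftEnd, h1])
    simp [tadpoleChainProp, h0, h1, key]
  | dipole l s =>
    by_cases h0 : c = 0
    · exact hR l.castSucc s (by simp [chainRightEnd, h0])
    by_cases h1 : c = (j l).succ
    · exact hL l.succ s (by simp [chainLeftEnd, h1])
    simp [tadpoleChainProp, h0, h1]
  | right =>
    by_cases h0 : c = 0
    · exact hR (Fin.last m) false (by simp [chainRightEnd, h0])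
    by_cases h1 : c = i'.succ
    · exact hR (Fin.last m) true (by simp [chainRightEnd, h1])
    simp [tadpoleChainProp, h0, h1, key]

/-- Two tadpoles, of colours `i.succ` and `i'.succ`, linked by a (possibly empty) chain of dipoles
of arbitrary colours. -/
def tadpoleChain {m : ℕ} (i i' : Fin 3) (j : Fin m → Fin 3) :
    FeynmanGraph (ChainBubble m × Fin 4) :=
  ofPropagator (tadpoleChainProp i i' j) (tadpoleChainProp_involutive i i' j)
    (tadpoleChainProp_ne i i' j)

/-- Propagators of the closed chain of `m` dipoles of colour `i`: the right legs of each dipole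
(corners `i` of its bubbles `false` and `true`) are joined to the left legs (corners `0`) of the next
one, in cyclic order and preserving the top and bottom lines. -/
def dipoleRingProp (m : ℕ) (i : Fin 3) (x : (ZMod m × Bool) × Fin 4) : (ZMod m × Bool) × Fin 4 :=
  match x with
  | ((l, s), c) =>
    if c = 0 then ((l - 1, s), i.succ)
    else if c = i.succ then ((l + 1, s), 0)
    else ((l, !s), c)

/-- The closed chain of `m` dipoles of colour `i.succ`. -/
def dipoleRing (m : ℕ) (i : Fin 3) : FeynmanGraph ((ZMod m × Bool) × Fin 4) :=
  ofPropagator (dipoleRingProp m i)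
    (by
      rintro ⟨⟨l, s⟩, c⟩
      by_cases h0 : c = 0
      · simp [dipoleRingProp, h0]
      by_cases h1 : c = i.succ
      · simp [dipoleRingProp, h1]
      simp [dipoleRingProp, h0, h1])
    (by
      rintro ⟨⟨l, s⟩, c⟩
      by_cases h0 : c = 0
      · simp [dipoleRingProp, h0]
      by_cases h1 : c = i.succ
      · simp [dipoleRingProp, h1, (Fin.succ_ne_zero i).symm]
      simp [dipoleRingProp, h0, h1])

end FeynmanGraph

universe w

/-! ### Counting equivalence classes -/

/-! Let `B` be the number of bubbles, `C` the number of components and `F₁, F₂, F₃` the numbers of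
faces of each colour. For a connected graph twice the degree is `excess = 6C + 3B - 2(F₁ + F₂ +
F₃)`, so everything reduces to counting faces. A face of colour `c` consists of two cycles of the
permutation `nbr c ∘ nbr 0`, one for each direction of travel. The basic surgery is `switch`, which
exchanges the ends of two propagators. It multiplies this permutation by two transpositions, so it
changes each `F_c` by at most one, with a sign read off from the positions of the ends. Repeated
switches give `F_j + F_k ≤ B + 2C` (`numCycles_add_le`), i.e. jackets have nonnegative genus.

If a connected graph is not 2PI, cutting the two propagators presents it as a connected sum, and the
excess is additive. If it is 2PI with more than one bubble and excess at most 2, it has no tadpole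
and no face crosses itself at a bubble (`Connected.not_sameFace_of_isTwoPI`), since detaching such a
bubble would leave too small an excess.

Dipole-free case. The three genera are nonnegative half-integers with sum at most 1, so some jacket
`J_i` is planar. Its bubbles are the vertices of a 4-valent map on the sphere, the faces of colour
`i` are the curves going straight through the vertices, and those of colours `j, k` are the regions.
Double covers (`exists_potential`) replace the topology of the sphere: a `ZMod 2` cocycle trivial on
the regions is trivial, because otherwise the connected double cover would violate the genus bound.
Hence the curves have even length, so length at least 4, and a count shows that all lengths are
exactly 4. Two different curves cross evenly, so the three curves around a triangular region use up
each other's crossings and `B ≤ 6`. Without triangles there would be too few regions, and lengths at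
least 3 force `B ≥ 6`. Thus `B = 6` and all regions are triangles, which determines the octahedron.

Case with a dipole. If the graph is not the melon, joining the two right legs to each other, and
their two outer ends to each other, lowers the excess by at least two. So it was 2 and becomes 0,
and the graph is a melonic graph `A` to which a dipole of colour `i` is attached at two propagators
of one face of colour `i` (`Connected.exists_switch_of_dipole`). Induction on the melonic structure
of `A` shows that a chain of dipoles closed in this way is a decorated ring
(`IsMelonicDecoration.closesRing`). The ring with a single dipole is the graph of two tadpoles
joined directly.

Non-2PI case. By induction on the number of vertices, excess 0 means a decorated melon and excess 1
a decorated one-bubble graph. Excess 2 splits as `0 + 2`, which only adds decorations, or as `1 +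
1`. In the latter case two decorated tadpoles are joined: each melon opened along the way becomes a
dipole of the chain, and every other melon remains a decoration
(`IsMelonicDecoration.isDecoratedTadpoleChain_conn`).

Conversely, melonic insertions preserve the excess because the melon has excess 0, and the excess of
each core is computed from its faces or from its construction by connected sums and switches. -/

/-- Gluing two different classes of an equivalence relation decreases the number of classes
by one. -/
theorem card_quotient_of_merge {V : Type u} [Finite V] (r s : Setoid V) (p q : V)
    (hpq : ¬ r p q) (h : ∀ x y, s x y ↔ r x y ∨ ((r x p ∨ r x q) ∧ (r y p ∨ r y q))) :
    Nat.card (Quotient s) + 1 = Nat.card (Quotient r) := by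
  classical
  have := Fintype.ofFinite V
  have := Fintype.ofFinite (Quotient r)
  have e : {a : Quotient r // a ≠ Quotient.mk r q} ≃ Quotient s := by
    refine Equiv.ofBijective (fun a => Quotient.map' (s₂ := s) id
      (fun x y hxy => (h x y).2 (Or.inl hxy)) a.1) ⟨?_, ?_⟩
    · rintro ⟨a, ha⟩ ⟨b, hb⟩ hab
      induction a using Quotient.inductionOn with | _ x
      induction b using Quotient.inductionOn with | _ y
      have hx : ¬ r x q := fun hh => ha (Quotient.sound hh)
      have hy : ¬ r y q := fun hh => hb (Quotient.sound hh)
      have hs : s x y := Quotient.exact hab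
      rcases (h x y).1 hs with h1 | ⟨h1, h2⟩
      · exact Subtype.ext (Quotient.sound h1)
      · exact Subtype.ext (Quotient.sound
          (r.trans (h1.resolve_right hx) (r.symm (h2.resolve_right hy))))
    · intro b
      induction b using Quotient.inductionOn with | _ y
      by_cases hy : r y q
      · refine ⟨⟨Quotient.mk r p, fun hh => hpq (Quotient.exact hh)⟩, ?_⟩
        exact Quotient.sound ((h p y).2 (Or.inr ⟨Or.inl (r.refl p), Or.inr hy⟩))
      · exact ⟨⟨Quotient.mk r y, fun hh => hy (Quotient.exact hh)⟩, rfl⟩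
  rw [← Nat.card_congr e, Nat.card_eq_fintype_card, Nat.card_eq_fintype_card,
    Fintype.card_subtype_compl, Fintype.card_subtype_eq]
  have : 0 < Fintype.card (Quotient r) := Fintype.card_pos_iff.2 ⟨Quotient.mk r q⟩
  omega

/-- A finite type is the disjoint union of the classes of an equivalence relation. -/
theorem sum_ncard_class {V : Type u} [Finite V] (r : Setoid V) [Fintype (Quotient r)] :
    ∑ a : Quotient r, Set.ncard {x | Quotient.mk r x = a} = Nat.card V := by
  classical
  have := Fintype.ofFinite V
  have h := Finset.card_eq_sum_card_fiberwise (s := (Finset.univ : Finset V))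
    (t := (Finset.univ : Finset (Quotient r))) (f := Quotient.mk r) (fun _ _ => by simp)
  rw [Nat.card_eq_fintype_card, ← Finset.card_univ, h]
  refine Finset.sum_congr rfl fun a _ => ?_
  rw [← Set.ncard_coe_finset]
  congr 1
  ext x
  simp

theorem setOf_mk_eq_mk {V : Type u} (r : Setoid V) (x : V) :
    {y | Quotient.mk r y = Quotient.mk r x} = {y | r y x} := by
  ext y
  exact Quotient.eq

theorem mul_card_quotient_le {V : Type u} [Finite V] (r : Setoid V) (L : ℕ)
    (h : ∀ x, L ≤ Set.ncard {y | r y x}) : L * Nat.card (Quotient r) ≤ Nat.card V := by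
  classical
  have := Fintype.ofFinite (Quotient r)
  rw [← sum_ncard_class r, Nat.card_eq_fintype_card, ← Finset.card_univ, mul_comm, ← smul_eq_mul]
  refine Finset.card_nsmul_le_sum _ _ _ fun a _ => ?_
  induction a using Quotient.inductionOn with | _ x
  rw [setOf_mk_eq_mk]
  exact h x

theorem card_le_mul_card_quotient {V : Type u} [Finite V] (r : Setoid V) (L : ℕ)
    (h : ∀ x, Set.ncard {y | r y x} ≤ L) : Nat.card V ≤ L * Nat.card (Quotient r) := by
  classical
  have := Fintype.ofFinite (Quotient r)
  rw [← sum_ncard_class r, Nat.card_eq_fintype_card, ← Finset.card_univ, mul_comm, ← smul_eq_mul]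
  refine Finset.sum_le_card_nsmul _ _ _ fun a _ => ?_
  induction a using Quotient.inductionOn with | _ x
  rw [setOf_mk_eq_mk]
  exact h x

/-- If all the classes have at least `L` elements and there are at most `L` times as many
elements as classes, then all the classes have exactly `L` elements. -/
theorem ncard_class_eq {V : Type u} [Finite V] (r : Setoid V) (L : ℕ)
    (h : ∀ x, L ≤ Set.ncard {y | r y x}) (hL : Nat.card V ≤ L * Nat.card (Quotient r)) (x : V) :
    Set.ncard {y | r y x} = L := by
  classical
  have := Fintype.ofFinite (Quotient r)
  have key : ∀ a : Quotient r, L ≤ Set.ncard {y | Quotient.mk r y = a} := by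
    intro a
    induction a using Quotient.inductionOn with | _ x
    rw [setOf_mk_eq_mk]
    exact h x
  have hs : ∑ a : Quotient r, L = ∑ a : Quotient r, Set.ncard {y | Quotient.mk r y = a} := by
    apply le_antisymm (Finset.sum_le_sum fun a _ => key a)
    rw [sum_ncard_class r]
    simpa [Nat.card_eq_fintype_card, mul_comm] using hL
  have := (Finset.sum_eq_sum_iff_of_le (fun a _ => key a)).1 hs (Quotient.mk r x) (by simp)
  rw [this, setOf_mk_eq_mk]

/-! ### Cycles of a permutation times a transposition -/

namespace Equiv.Perm

/-- On a finite type nonnegative powers exhaust a cycle, so stability under `f` alone suffices. This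
is the induction principle behind all later statements about faces. -/
theorem SameCycle.mem_of_closed {V : Type u} [Finite V] {f : Perm V} {x y : V}
    (h : f.SameCycle x y) {S : Set V} (hS : ∀ z ∈ S, f z ∈ S) (hx : x ∈ S) : y ∈ S := by
  obtain ⟨n, rfl⟩ := h.exists_nat_pow_eq
  clear h
  induction n with
  | zero => simpa
  | succ n ih => rw [pow_succ', mul_apply]; exact hS _ ih

/-- Number of cycles of a permutation, including the fixed points. -/
noncomputable def numOrbits {V : Type u} (f : Perm V) : ℕ :=
  Nat.card (Quotient (SameCycle.setoid f))

-- From `p` the product jumps to `f q` and then follows the `f`-cycle of `q`, which avoids `p`,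
-- until it reaches `q`.
open Classical in
theorem sameCycle_mul_swap_of_not {V : Type u} [Finite V] (f : Perm V) {p q : V}
    (h : ¬ f.SameCycle p q) : (f * swap p q).SameCycle p q := by
  obtain ⟨m, hm, hm'⟩ : ∃ n, 0 < n ∧ (f ^ n) q = q :=
    ⟨orderOf f, orderOf_pos f, by simp [pow_orderOf_eq_one]⟩
  let n := Nat.find (⟨m, hm, hm'⟩ : ∃ n, 0 < n ∧ (f ^ n) q = q)
  obtain ⟨hn, hnq⟩ : 0 < n ∧ (f ^ n) q = q :=
    Nat.find_spec (⟨m, hm, hm'⟩ : ∃ n, 0 < n ∧ (f ^ n) q = q)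
  have hmin : ∀ k, 0 < k → k < n → (f ^ k) q ≠ q := fun k hk hkn hkq =>
    Nat.find_min (⟨m, hm, hm'⟩ : ∃ n, 0 < n ∧ (f ^ n) q = q) hkn ⟨hk, hkq⟩
  have key : ∀ k, k + 1 ≤ n → ((f * swap p q) ^ (k + 1)) p = (f ^ (k + 1)) q := by
    intro k
    induction k with
    | zero => intro _; simp
    | succ k ih =>
      intro hk
      rw [pow_succ', mul_apply, ih (by omega), pow_succ' f (k + 1), mul_apply, mul_apply,
        swap_apply_of_ne_of_ne]
      · intro he
        exact h (SameCycle.symm ⟨(k + 1 : ℕ), by rw [zpow_natCast]; exact he⟩)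
      · exact hmin _ (by omega) (by omega)
  refine ⟨(n : ℕ), ?_⟩
  have := key (n - 1) (by omega)
  rw [Nat.sub_add_cancel hn] at this
  rw [zpow_natCast, this, hnq]

-- If `n` is the first positive time at which the `f`-orbit of `p` meets `p` or `q`, it meets `q`.
-- The product sends `q` to `f p`, hence its cycle through `q` is `f p, …, f^n p = q`, without `p`.
open Classical in
theorem not_sameCycle_mul_swap {V : Type u} [Finite V] (f : Perm V) {p q : V} (hpq : p ≠ q)
    (h : f.SameCycle p q) : ¬ (f * swap p q).SameCycle p q := by
  have hex : ∃ n, 0 < n ∧ ((f ^ n) p = q ∨ (f ^ n) p = p) := by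
    exact ⟨orderOf f, orderOf_pos f, by simp [pow_orderOf_eq_one]⟩
  obtain ⟨hn, hnq⟩ := Nat.find_spec hex
  have hmin := fun k => Nat.find_min hex (m := k)
  set n := Nat.find hex with hndef
  -- A first return to `p` itself would make the whole cycle equal to the `f ^ k p` with `k < n`,
  -- none of which is `q`.
  have hq : (f ^ n) p = q := by
    rcases hnq with hq | hq
    · exact hq
    · exfalso
      have : ∀ y, f.SameCycle p y → ∃ k, k < n ∧ (f ^ k) p = y := by
        intro y hy
        refine hy.mem_of_closed (S := {y | ∃ k, k < n ∧ (f ^ k) p = y}) ?_ ⟨0, hn, by simp⟩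
        rintro z ⟨k, hk, rfl⟩
        rcases Nat.lt_or_ge (k + 1) n with hk' | hk'
        · exact ⟨k + 1, hk', by rw [pow_succ', mul_apply]⟩
        · have : n = k + 1 := by omega
          refine ⟨0, hn, ?_⟩
          rw [this, pow_succ', mul_apply] at hq
          simp [hq]
      obtain ⟨k, hk, hkq⟩ := this q h
      rcases Nat.eq_zero_or_pos k with rfl | hk0
      · exact hpq (by simpa using hkq)
      · exact hmin k hk ⟨hk0, Or.inl hkq⟩
  intro hs
  have : p ∈ {y | ∃ k, 0 < k ∧ k ≤ n ∧ (f ^ k) p = y} := by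
    refine hs.symm.mem_of_closed ?_ ⟨n, hn, le_rfl, hq⟩
    rintro z ⟨k, hk, hkn, rfl⟩
    rcases Nat.lt_or_ge k n with hk' | hk'
    · have h1 : (f ^ k) p ≠ p := fun he => hmin k hk' ⟨hk, Or.inr he⟩
      have h2 : (f ^ k) p ≠ q := fun he => hmin k hk' ⟨hk, Or.inl he⟩
      refine ⟨k + 1, by omega, by omega, ?_⟩
      rw [mul_apply, swap_apply_of_ne_of_ne h1 h2, pow_succ', mul_apply]
    · obtain rfl : k = n := by omega
      exact ⟨1, one_pos, hn, by rw [hq, mul_apply, swap_apply_right, pow_one]⟩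
  obtain ⟨k, hk, hkn, hkp⟩ := this
  rcases Nat.lt_or_ge k n with hk' | hk'
  · exact hmin k hk' ⟨hk, Or.inr hkp⟩
  · obtain rfl : k = n := by omega
    exact hpq (hkp.symm.trans hq)

open Classical in
/-- The cycle of `x` is not affected by a transposition of points outside it. -/
theorem SameCycle.mul_swap {V : Type u} [Finite V] {f : Perm V} {p q x y : V}
    (h : f.SameCycle x y) (hp : ¬ f.SameCycle x p) (hq : ¬ f.SameCycle x q) :
    (f * swap p q).SameCycle x y := by
  refine (h.mem_of_closed (S := {z | f.SameCycle x z ∧ (f * swap p q).SameCycle x z}) ?_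
    ⟨.refl _ _, .refl _ _⟩).2
  rintro z ⟨h1, h2⟩
  refine ⟨sameCycle_apply_right.2 h1, ?_⟩
  have h3 : z ≠ p := by rintro rfl; exact hp h1
  have h4 : z ≠ q := by rintro rfl; exact hq h1
  have : f z = (f * swap p q) z := by rw [mul_apply, swap_apply_of_ne_of_ne h3 h4]
  rw [this]
  exact sameCycle_apply_right.2 h2

-- Since `p` and `q` become equivalent, every step of `f` stays inside a cycle of the product, so
-- cycles can only merge; conversely the merged set is stable under the product.
open Classical in
theorem sameCycle_mul_swap_iff {V : Type u} [Finite V] (f : Perm V) {p q : V}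
    (h : ¬ f.SameCycle p q) (x y : V) : (f * swap p q).SameCycle x y ↔
      f.SameCycle x y ∨ ((f.SameCycle x p ∨ f.SameCycle x q) ∧
        (f.SameCycle y p ∨ f.SameCycle y q)) := by
  have hpq := sameCycle_mul_swap_of_not f h
  have step : ∀ z, (f * swap p q).SameCycle z (f z) := by
    intro z
    by_cases hzp : z = p
    · subst hzp
      refine hpq.trans ?_
      have : f z = (f * swap z q) q := by simp
      rw [this]
      exact sameCycle_apply_right.2 (.refl _ _)
    by_cases hzq : z = q
    · subst hzq
      refine hpq.symm.trans ?_
      have : f z = (f * swap p z) p := by simp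
      rw [this]
      exact sameCycle_apply_right.2 (.refl _ _)
    have : f z = (f * swap p q) z := by rw [mul_apply, swap_apply_of_ne_of_ne hzp hzq]
    rw [this]
    exact sameCycle_apply_right.2 (.refl _ _)
  have mono : ∀ x y, f.SameCycle x y → (f * swap p q).SameCycle x y := fun x y hxy =>
    hxy.mem_of_closed (S := {z | (f * swap p q).SameCycle x z})
      (fun z hz => hz.trans (step z)) (.refl _ _)
  constructor
  · intro hxy
    refine hxy.mem_of_closed (S := {z | f.SameCycle x z ∨
      ((f.SameCycle x p ∨ f.SameCycle x q) ∧ (f.SameCycle z p ∨ f.SameCycle z q))}) ?_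
      (Or.inl (.refl _ _))
    intro z hz
    by_cases hzp : z = p
    · subst hzp
      rw [mul_apply, swap_apply_left]
      simp only [Set.mem_ofPred_eq, sameCycle_apply_left] at hz ⊢
      rcases hz with hz | hz
      · exact Or.inr ⟨Or.inl hz, Or.inr (.refl _ _)⟩
      · exact Or.inr ⟨hz.1, Or.inr (.refl _ _)⟩
    by_cases hzq : z = q
    · subst hzq
      rw [mul_apply, swap_apply_right]
      simp only [Set.mem_ofPred_eq, sameCycle_apply_left] at hz ⊢
      rcases hz with hz | hz
      · exact Or.inr ⟨Or.inr hz, Or.inl (.refl _ _)⟩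
      · exact Or.inr ⟨hz.1, Or.inl (.refl _ _)⟩
    rw [mul_apply, swap_apply_of_ne_of_ne hzp hzq]
    simpa only [Set.mem_ofPred_eq, sameCycle_apply_left, sameCycle_apply_right] using hz
  · rintro (hxy | ⟨h1, h2⟩)
    · exact mono _ _ hxy
    · have h3 : (f * swap p q).SameCycle x p :=
        h1.elim (mono _ _) fun h1 => (mono _ _ h1).trans hpq.symm
      have h4 : (f * swap p q).SameCycle y p :=
        h2.elim (mono _ _) fun h2 => (mono _ _ h2).trans hpq.symm
      exact h3.trans h4.symm

open Classical in
theorem numOrbits_mul_swap_of_not {V : Type u} [Finite V] (f : Perm V) {p q : V}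
    (h : ¬ f.SameCycle p q) : (f * swap p q).numOrbits + 1 = f.numOrbits :=
  card_quotient_of_merge (SameCycle.setoid f) (SameCycle.setoid (f * swap p q)) p q h
    (sameCycle_mul_swap_iff f h)

-- Splitting is the merging case read backwards, because the transposition is an involution.
open Classical in
theorem numOrbits_mul_swap {V : Type u} [Finite V] (f : Perm V) {p q : V} (hpq : p ≠ q)
    (h : f.SameCycle p q) : (f * swap p q).numOrbits = f.numOrbits + 1 := by
  have := numOrbits_mul_swap_of_not (f * swap p q) (not_sameCycle_mul_swap f hpq h)
  rw [mul_assoc, swap_mul_self, mul_one] at this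
  exact this.symm

/-- The number of cycles is invariant under conjugation. -/
theorem numOrbits_congr {V : Type u} {W : Type v} (f : Perm V) (g : Perm W) (e : V ≃ W)
    (h : ∀ x, e (f x) = g (e x)) : f.numOrbits = g.numOrbits := by
  have hz : ∀ (n : ℤ) x, e ((f ^ n) x) = (g ^ n) (e x) := by
    have : g = (e.symm.trans f).trans e := by
      ext x; simp [h]
    have : g = e.permCongr f := this
    subst this
    intro n x
    have : (e.permCongr f) ^ n = e.permCongr (f ^ n) := (map_zpow e.permCongrHom f n).symm
    rw [this]; simp
  refine Nat.card_congr (Quotient.congr e fun x y => ?_)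
  show f.SameCycle x y ↔ g.SameCycle (e x) (e y)
  simp only [SameCycle, ← hz, e.apply_eq_iff_eq]

end Equiv.Perm

namespace FeynmanGraph

open Equiv Equiv.Perm

/-! ### Colours -/

theorem ext_nbr {V : Type u} {G H : FeynmanGraph V} (h : ∀ c x, G.nbr c x = H.nbr c x) :
    G = H := by
  cases G; cases H
  congr
  funext c x
  exact h c x

theorem nbr_inj {V : Type u} (G : FeynmanGraph V) (c : Fin 4) {x y : V} :
    G.nbr c x = G.nbr c y ↔ x = y :=
  ⟨fun h => by rw [← G.nbr_nbr c x, h, G.nbr_nbr], fun h => by rw [h]⟩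

/-- The colours `1, 2, 3` compose as the nonzero elements of the Klein four-group. -/
theorem nbr_xor {V : Type u} (G : FeynmanGraph V) {c d : Fin 4} (hc : c ≠ 0) (hd : d ≠ 0)
    (hcd : c ≠ d) (x : V) : G.nbr c (G.nbr d x) = G.nbr (c ^^^ d) x := by
  have h12 := G.tetrahedral
  have h13 : ∀ x, G.nbr 1 (G.nbr 3 x) = G.nbr 2 x := fun x => by
    rw [← h12, G.nbr_nbr]
  have h32 : ∀ x, G.nbr 3 (G.nbr 2 x) = G.nbr 1 x := fun x => by
    rw [← h12, G.nbr_nbr]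
  have h21 : ∀ x, G.nbr 2 (G.nbr 1 x) = G.nbr 3 x := fun x => by
    rw [← G.nbr_inj 3, G.nbr_nbr, h32, G.nbr_nbr]
  have h31 : ∀ x, G.nbr 3 (G.nbr 1 x) = G.nbr 2 x := fun x => by
    rw [← G.nbr_inj 2, G.nbr_nbr, ← h21 (G.nbr 1 x), G.nbr_nbr, G.nbr_nbr]
  have h23 : ∀ x, G.nbr 2 (G.nbr 3 x) = G.nbr 1 x := fun x => by
    rw [← h21, G.nbr_nbr]
  fin_cases c <;> fin_cases d <;> first
    | exact absurd rfl hc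
    | exact absurd rfl hd
    | exact absurd rfl hcd
    | exact h12 x
    | exact h13 x
    | exact h23 x
    | exact h21 x
    | exact h31 x
    | exact h32 x

/-- `{i, j, k} = {1, 2, 3}`. -/
def Triple (i j k : Fin 4) : Prop :=
  i ≠ 0 ∧ j ≠ 0 ∧ k ≠ 0 ∧ i ≠ j ∧ i ≠ k ∧ j ≠ k

instance (i j k : Fin 4) : Decidable (Triple i j k) := by unfold Triple; infer_instance

theorem Triple.rotate {i j k : Fin 4} (h : Triple i j k) : Triple j k i :=
  ⟨h.2.1, h.2.2.1, h.1, h.2.2.2.2.2, h.2.2.2.1.symm, h.2.2.2.2.1.symm⟩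

theorem Triple.swap {i j k : Fin 4} (h : Triple i j k) : Triple i k j :=
  ⟨h.1, h.2.2.1, h.2.1, h.2.2.2.2.1, h.2.2.2.1, h.2.2.2.2.2.symm⟩

theorem Triple.mul {V : Type u} (G : FeynmanGraph V) {i j k : Fin 4} (h : Triple i j k) (x : V) :
    G.nbr i (G.nbr j x) = G.nbr k x := by
  rw [G.nbr_xor h.1 h.2.1 h.2.2.2.1]
  have : ∀ i j k : Fin 4, Triple i j k → i ^^^ j = k := by decide
  rw [this i j k h]

theorem exists_triple {c d : Fin 4} (hc : c ≠ 0) (hd : d ≠ 0) (hcd : c ≠ d) :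
    ∃ e, Triple c d e := by
  revert c d; decide

theorem exists_triple_left {c : Fin 4} (hc : c ≠ 0) : ∃ d e, Triple c d e := by
  revert c; decide

theorem Triple.cases {i j k : Fin 4} (h : Triple i j k) (c : Fin 4) :
    c = 0 ∨ c = i ∨ c = j ∨ c = k := by
  revert i j k c; decide

/-! ### Isomorphisms -/

/-- The bijection `e` is an isomorphism of edge-coloured graphs. -/
def IsIso {V : Type u} {W : Type v} (G : FeynmanGraph V) (H : FeynmanGraph W) (e : V ≃ W) : Prop :=
  ∀ c x, e (G.nbr c x) = H.nbr c (e x)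

theorem IsIso.symm {V : Type u} {W : Type v} {G : FeynmanGraph V} {H : FeynmanGraph W} {e : V ≃ W}
    (h : G.IsIso H e) : H.IsIso G e.symm := fun c x => by
  rw [Equiv.symm_apply_eq, h, e.apply_symm_apply]

theorem IsIso.trans {V : Type u} {W : Type v} {U : Type w} {G : FeynmanGraph V}
    {H : FeynmanGraph W} {K : FeynmanGraph U} {e : V ≃ W} {f : W ≃ U}
    (h : G.IsIso H e) (h' : H.IsIso K f) : G.IsIso K (e.trans f) := fun c x => by
  simp only [Equiv.trans_apply]
  rw [h, h']

theorem Isomorphic.symm {V : Type u} {W : Type v} {G : FeynmanGraph V} {H : FeynmanGraph W}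
    (h : G.Isomorphic H) : H.Isomorphic G :=
  let ⟨e, he⟩ := h; ⟨e.symm, IsIso.symm he⟩

theorem Isomorphic.trans {V : Type u} {W : Type v} {U : Type w} {G : FeynmanGraph V}
    {H : FeynmanGraph W} {K : FeynmanGraph U} (h : G.Isomorphic H) (h' : H.Isomorphic K) :
    G.Isomorphic K :=
  let ⟨e, he⟩ := h; let ⟨f, hf⟩ := h'; ⟨e.trans f, IsIso.trans he hf⟩

/-! ### Closed sets and connectedness -/

/-- A union of connected components. -/
def IsClosed {V : Type u} (G : FeynmanGraph V) (S : Set V) : Prop := ∀ c, ∀ x ∈ S, G.nbr c x ∈ S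

theorem IsClosed.mem_iff {V : Type u} {G : FeynmanGraph V} {S : Set V} (hS : G.IsClosed S)
    (c : Fin 4) (x : V) : G.nbr c x ∈ S ↔ x ∈ S :=
  ⟨fun h => by simpa [G.nbr_nbr] using hS c _ h, hS c x⟩

theorem IsClosed.compl {V : Type u} {G : FeynmanGraph V} {S : Set V} (hS : G.IsClosed S) :
    G.IsClosed Sᶜ := fun c x hx => by
  simpa [hS.mem_iff] using hx

theorem connected_iff {V : Type u} (G : FeynmanGraph V) :
    G.Connected ↔ Nonempty V ∧ ∀ S : Set V, G.IsClosed S → S.Nonempty → S = Set.univ := by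
  refine and_congr_right fun _ => ⟨fun h S hS ⟨x, hx⟩ => ?_, fun h x y => ?_⟩
  · ext y
    simp only [Set.mem_univ, iff_true]
    have := h x y
    induction this with
    | refl => exact hx
    | tail _ hbc ih =>
      obtain ⟨c, rfl⟩ := hbc
      exact hS c _ ih
  · have := h {y | Relation.ReflTransGen (fun a b => ∃ c, G.nbr c a = b) x y}
      (fun c z hz => hz.tail ⟨c, rfl⟩) ⟨x, .refl⟩
    exact (Set.ext_iff.1 this y).2 (Set.mem_univ y)

theorem Connected.eq_univ {V : Type u} {G : FeynmanGraph V} (h : G.Connected) {S : Set V}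
    (hS : G.IsClosed S) {x : V} (hx : x ∈ S) : S = Set.univ :=
  (G.connected_iff.1 h).2 S hS ⟨x, hx⟩

theorem Isomorphic.connected {V : Type u} {W : Type v} {G : FeynmanGraph V} {H : FeynmanGraph W}
    (h : G.Isomorphic H) (hG : G.Connected) : H.Connected := by
  obtain ⟨e, he⟩ := h
  rw [connected_iff] at hG ⊢
  refine ⟨hG.1.map e, fun S hS ⟨y, hy⟩ => ?_⟩
  have := hG.2 (e ⁻¹' S) (fun c x hx => by
    rw [Set.mem_preimage, he]; exact hS c _ hx) ⟨e.symm y, by simpa⟩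
  ext z
  simpa using Set.ext_iff.1 this (e.symm z)

/-- The component of `x`. -/
def component {V : Type u} (G : FeynmanGraph V) (x : V) : Set V :=
  {y | Relation.ReflTransGen (fun a b => ∃ c, G.nbr c a = b) x y}

theorem mem_component {V : Type u} (G : FeynmanGraph V) (x : V) : x ∈ G.component x :=
  Relation.ReflTransGen.refl

theorem isClosed_component {V : Type u} (G : FeynmanGraph V) (x : V) :
    G.IsClosed (G.component x) := fun c _ hz => Relation.ReflTransGen.tail hz ⟨c, rfl⟩

theorem component_subset {V : Type u} (G : FeynmanGraph V) {x : V} {S : Set V}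
    (hS : G.IsClosed S) (hx : x ∈ S) : G.component x ⊆ S := by
  intro y hy
  induction hy with
  | refl => exact hx
  | tail _ hbc ih => obtain ⟨c, rfl⟩ := hbc; exact hS c _ ih

/-- The equivalence relation of being in the same component. -/
def componentSetoid {V : Type u} (G : FeynmanGraph V) : Setoid V where
  r x y := y ∈ G.component x
  iseqv := by
    refine ⟨G.mem_component, fun {x y} h => ?_, fun {x y z} h h' => Relation.ReflTransGen.trans h h'⟩
    by_contra hx
    exact G.component_subset (G.isClosed_component y).compl hx h (G.mem_component y)

/-- Number of connected components. -/
noncomputable def numComp {V : Type u} (G : FeynmanGraph V) : ℕ :=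
  Nat.card (Quotient G.componentSetoid)

theorem Connected.numComp_eq {V : Type u} {G : FeynmanGraph V} (h : G.Connected) :
    G.numComp = 1 := by
  rw [numComp, Nat.card_eq_one_iff_unique]
  obtain ⟨⟨x⟩, h⟩ := h
  refine ⟨⟨fun a b => ?_⟩, ⟨Quotient.mk _ x⟩⟩
  induction a using Quotient.inductionOn
  induction b using Quotient.inductionOn
  exact Quotient.sound (h _ _)

theorem mem_component_of_isIso {V : Type u} {W : Type v} {G : FeynmanGraph V} {H : FeynmanGraph W}
    {e : V ≃ W} (he : G.IsIso H e) {x y : V} (h : y ∈ G.component x) :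
    e y ∈ H.component (e x) := by
  refine G.component_subset (S := e ⁻¹' H.component (e x)) (fun c z hz => ?_)
    (H.mem_component _) h
  rw [Set.mem_preimage, he]
  exact H.isClosed_component _ c _ hz

theorem Isomorphic.numComp_eq {V : Type u} {W : Type v} {G : FeynmanGraph V} {H : FeynmanGraph W}
    (h : G.Isomorphic H) : G.numComp = H.numComp := by
  obtain ⟨e, he⟩ := h
  refine Nat.card_congr (Quotient.congr e fun x y => ⟨mem_component_of_isIso he, fun h => ?_⟩)
  have := mem_component_of_isIso (IsIso.symm he) h
  rwa [e.symm_apply_apply, e.symm_apply_apply] at this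

/-! ### Faces as cycles of permutations -/

/-- The step along a face of colour `c`: a propagator followed by an edge of colour `c`. -/
def facePerm {V : Type u} (G : FeynmanGraph V) (c : Fin 4) : Perm V where
  toFun x := G.nbr c (G.nbr 0 x)
  invFun x := G.nbr 0 (G.nbr c x)
  left_inv x := by simp [G.nbr_nbr]
  right_inv x := by simp [G.nbr_nbr]

@[simp]
theorem facePerm_apply {V : Type u} (G : FeynmanGraph V) (c : Fin 4) (x : V) :
    G.facePerm c x = G.nbr c (G.nbr 0 x) := rfl

@[simp]
theorem facePerm_symm_apply {V : Type u} (G : FeynmanGraph V) (c : Fin 4) (x : V) :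
    (G.facePerm c).symm x = G.nbr 0 (G.nbr c x) := rfl

theorem sameCycle_step {V : Type u} (G : FeynmanGraph V) (c : Fin 4) (x : V) :
    (G.facePerm c).SameCycle x (G.nbr 0 (G.nbr c x)) := by
  rw [← facePerm_symm_apply, sameCycle_symm_apply_right]

/-- Reflection of a face. -/
theorem sameCycle_nbr_zero {V : Type u} (G : FeynmanGraph V) {c : Fin 4} {x y : V}
    (h : (G.facePerm c).SameCycle x y) : (G.facePerm c).SameCycle (G.nbr 0 x) (G.nbr 0 y) := by
  let a : Perm V := ⟨G.nbr 0, G.nbr 0, G.nbr_nbr 0, G.nbr_nbr 0⟩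
  have h1 : (G.facePerm c)⁻¹ = a * G.facePerm c * a⁻¹ := by
    ext z
    show G.nbr 0 (G.nbr c z) = G.nbr 0 (G.nbr c (G.nbr 0 (G.nbr 0 z)))
    rw [G.nbr_nbr 0 z]
  rw [← sameCycle_inv, h1]
  exact h.conj (g := a)

theorem sameCycle_nbr_zero_iff {V : Type u} (G : FeynmanGraph V) {c : Fin 4} {x y : V} :
    (G.facePerm c).SameCycle (G.nbr 0 x) (G.nbr 0 y) ↔ (G.facePerm c).SameCycle x y :=
  ⟨fun h => by simpa [G.nbr_nbr] using G.sameCycle_nbr_zero h, G.sameCycle_nbr_zero⟩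

theorem sameCycle_nbr_zero_comm {V : Type u} (G : FeynmanGraph V) {c : Fin 4} {x y : V} :
    (G.facePerm c).SameCycle x (G.nbr 0 y) ↔ (G.facePerm c).SameCycle y (G.nbr 0 x) := by
  rw [← sameCycle_nbr_zero_iff, G.nbr_nbr, sameCycle_comm]

/-- An alternating word of odd length in two involutions is conjugate to one of the two letters, and
neither letter has a fixed point. Removing the outer letters exchanges the two kinds of words, hence
the simultaneous induction. -/
theorem facePerm_pow_ne_nbr_zero {V : Type u} (G : FeynmanGraph V) (c : Fin 4) (n : ℕ) :
    (∀ x, (G.facePerm c ^ n) x ≠ G.nbr 0 x) ∧ ∀ x, (G.facePerm c ^ n) x ≠ G.nbr c x := by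
  induction n with
  | zero => exact ⟨fun x h => G.nbr_ne 0 x h.symm, fun x h => G.nbr_ne c x h.symm⟩
  | succ n ih =>
    constructor
    · intro x h
      rw [pow_succ, mul_apply, facePerm_apply] at h
      apply ih.2 (G.nbr c (G.nbr 0 x))
      rw [h, G.nbr_nbr]
    · intro x h
      rw [pow_succ', mul_apply, facePerm_apply, G.nbr_inj] at h
      exact ih.1 x ((G.nbr_inj 0).1 (by rw [h, G.nbr_nbr]))

theorem not_sameCycle_nbr_zero {V : Type u} [Finite V] (G : FeynmanGraph V) (c : Fin 4) (x : V) :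
    ¬ (G.facePerm c).SameCycle x (G.nbr 0 x) := fun h => by
  obtain ⟨n, hn⟩ := h.exists_nat_pow_eq
  exact (G.facePerm_pow_ne_nbr_zero c n).1 x hn

/-- `x` and `y` are on the same face of colour `c`. -/
def SameFace {V : Type u} (G : FeynmanGraph V) (c : Fin 4) (x y : V) : Prop :=
  (G.facePerm c).SameCycle x y ∨ (G.facePerm c).SameCycle x (G.nbr 0 y)

theorem SameFace.symm {V : Type u} {G : FeynmanGraph V} {c : Fin 4} {x y : V}
    (h : G.SameFace c x y) : G.SameFace c y x :=
  h.imp (·.symm) G.sameCycle_nbr_zero_comm.1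

theorem SameFace.refl {V : Type u} (G : FeynmanGraph V) (c : Fin 4) (x : V) :
    G.SameFace c x x := Or.inl (.refl _ _)

theorem SameFace.trans {V : Type u} {G : FeynmanGraph V} {c : Fin 4} {x y z : V}
    (h : G.SameFace c x y) (h' : G.SameFace c y z) : G.SameFace c x z := by
  rcases h with h | h <;> rcases h' with h' | h'
  · exact Or.inl (h.trans h')
  · exact Or.inr (h.trans h')
  · exact Or.inr (h.trans (G.sameCycle_nbr_zero h'))
  · refine Or.inl (h.trans ?_)
    have := G.sameCycle_nbr_zero h'
    rwa [G.nbr_nbr] at this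

theorem sameFace_nbr_zero {V : Type u} (G : FeynmanGraph V) (c : Fin 4) (x : V) :
    G.SameFace c x (G.nbr 0 x) := Or.inr (by rw [G.nbr_nbr])

theorem sameFace_nbr {V : Type u} (G : FeynmanGraph V) (c : Fin 4) (x : V) :
    G.SameFace c x (G.nbr c x) := Or.inr (G.sameCycle_step c x)

/-- The equivalence relation of being on the same face of colour `c`. -/
def faceSetoid {V : Type u} (G : FeynmanGraph V) (c : Fin 4) : Setoid V where
  r := G.SameFace c
  iseqv := ⟨SameFace.refl G c, SameFace.symm, SameFace.trans⟩

theorem numCycles_eq {V : Type u} [Finite V] (G : FeynmanGraph V) (c : Fin 4) :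
    G.numCycles 0 c = Nat.card (Quotient (G.faceSetoid c)) := by
  refine Nat.card_congr ⟨Quot.lift (Quotient.mk _) ?_, Quotient.lift (Quot.mk _) ?_, ?_, ?_⟩
  · rintro x y (rfl | rfl)
    · exact Quotient.sound (G.sameFace_nbr_zero c x)
    · exact Quotient.sound (G.sameFace_nbr c x)
  · have h0 : ∀ x, Quot.mk (fun x y => G.nbr 0 x = y ∨ G.nbr c x = y) (G.nbr 0 x) =
        Quot.mk (fun x y => G.nbr 0 x = y ∨ G.nbr c x = y) x := fun x =>
      (Quot.sound (r := fun x y => G.nbr 0 x = y ∨ G.nbr c x = y) (Or.inl rfl)).symm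
    have hc : ∀ x, Quot.mk (fun x y => G.nbr 0 x = y ∨ G.nbr c x = y) (G.nbr c x) =
        Quot.mk (fun x y => G.nbr 0 x = y ∨ G.nbr c x = y) x := fun x =>
      (Quot.sound (r := fun x y => G.nbr 0 x = y ∨ G.nbr c x = y) (Or.inr rfl)).symm
    have key : ∀ x y, (G.facePerm c).SameCycle x y →
        Quot.mk (fun x y => G.nbr 0 x = y ∨ G.nbr c x = y) x = Quot.mk _ y := fun x y h =>
      h.mem_of_closed (S := {z | Quot.mk _ x = Quot.mk _ z})
        (fun z hz => by
          show _ = _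
          rw [facePerm_apply, hc, h0]; exact hz) rfl
    rintro x y (h | h)
    · exact key x y h
    · rw [key x _ h, h0]
  · rintro ⟨x⟩; rfl
  · rintro ⟨x⟩; rfl

/-- A face is a cycle together with its mirror image under `nbr 0`, and the two are always different
cycles. -/
theorem two_mul_numCycles {V : Type u} [Finite V] (G : FeynmanGraph V) (c : Fin 4) :
    2 * G.numCycles 0 c = (G.facePerm c).numOrbits := by
  rw [numCycles_eq, numOrbits]
  let f : Quotient (SameCycle.setoid (G.facePerm c)) → Quotient (G.faceSetoid c) :=
    Quotient.map' id fun x y h => Or.inl h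
  have hf : ∀ x : V, {a | f a = Quotient.mk _ x} = {Quotient.mk _ x, Quotient.mk _ (G.nbr 0 x)} := by
    intro x
    ext a
    induction a using Quotient.inductionOn with | _ y
    simp only [Set.mem_ofPred_eq, Set.mem_insert_iff, Set.mem_singleton_iff]
    refine ⟨fun h => ?_, fun h => ?_⟩
    · exact (Quotient.exact h : G.SameFace c y x).imp (fun h => Quotient.sound h)
        (fun h => Quotient.sound h)
    · refine Quotient.sound (h.imp (fun h => Quotient.exact h) fun h => Quotient.exact h)
  have hs : Function.Surjective f := fun b => by
    induction b using Quotient.inductionOn with | _ y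
    exact ⟨Quotient.mk _ y, rfl⟩
  let s := Setoid.ker f
  have h1 : Nat.card (Quotient s) = Nat.card (Quotient (G.faceSetoid c)) :=
    Nat.card_congr (Setoid.quotientKerEquivOfSurjective f hs)
  have h2 : ∀ a, Set.ncard {b | s b a} = 2 := by
    intro a
    induction a using Quotient.inductionOn with | _ x
    have : {b | s b (Quotient.mk _ x)} = {a | f a = Quotient.mk _ x} := rfl
    rw [this, hf, Set.ncard_pair]
    intro h
    exact G.not_sameCycle_nbr_zero c x (Quotient.exact h)
  rw [← h1]
  exact le_antisymm (mul_card_quotient_le s 2 fun a => (h2 a).ge)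
    (card_le_mul_card_quotient s 2 fun a => (h2 a).le)

theorem Isomorphic.numCycles_eq {V : Type u} {W : Type v} [Finite V] {G : FeynmanGraph V}
    {H : FeynmanGraph W} (h : G.Isomorphic H) (c : Fin 4) :
    G.numCycles 0 c = H.numCycles 0 c := by
  obtain ⟨e, he⟩ := h
  have := Finite.of_equiv V e
  have := numOrbits_congr (G.facePerm c) (H.facePerm c) e (fun x => by simp [he])
  rw [← two_mul_numCycles, ← two_mul_numCycles] at this
  omega

end FeynmanGraph

/-- Counting the classes of a relation all of whose classes have `L` elements. -/
theorem mul_card_quot {V : Type u} [Finite V] (r : V → V → Prop) (S : V → Set V) (L : ℕ)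
    (hL : ∀ x, (S x).ncard = L) (hS : ∀ x y, y ∈ S x ↔ Relation.EqvGen r y x) :
    L * Nat.card (Quot r) = Nat.card V := by
  have e : Quot r ≃ Quotient (Relation.EqvGen.setoid r) :=
    ⟨Quot.lift (Quotient.mk _) fun x y h => Quotient.sound (.rel _ _ h),
      Quotient.lift (Quot.mk _) fun x y h => Quot.eqvGen_sound h,
      by rintro ⟨x⟩; rfl, by rintro ⟨x⟩; rfl⟩
  have h : ∀ x, {y | (Relation.EqvGen.setoid r) y x} = S x := fun x => by
    ext y; exact (hS x y).symm
  rw [Nat.card_congr e]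
  exact le_antisymm (mul_card_quotient_le _ L fun x => by rw [h, hL])
    (card_le_mul_card_quotient _ L fun x => by rw [h, hL])

namespace FeynmanGraph

open Equiv Equiv.Perm

/-! ### Switching two propagators -/

open Classical in
/-- Replace the edges of colour `0` from `x` to `x'` and from `y` to `y'` by edges from `x` to `y`
and from `x'` to `y'`. (Nothing happens if `x` and `y` are on the same edge.) -/
noncomputable def switch {V : Type u} (G : FeynmanGraph V) (x y : V) : FeynmanGraph V where
  -- The new propagator is conjugate to the old one by a transposition, so it is again a fixed-point
  -- free involution.
  nbr c z := if c = 0 then swap (G.nbr 0 x) y (G.nbr 0 (swap (G.nbr 0 x) y z)) else G.nbr c z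
  nbr_nbr c z := by
    by_cases hc : c = 0 <;> simp [hc, G.nbr_nbr]
  nbr_ne c z := by
    by_cases hc : c = 0
    · simp only [hc, if_true]
      rw [Ne, ← Equiv.eq_symm_apply, symm_swap]
      exact G.nbr_ne 0 _
    · simpa [hc] using G.nbr_ne c z
  tetrahedral z := by simp [G.tetrahedral]

theorem switch_nbr {V : Type u} (G : FeynmanGraph V) (x y : V) {c : Fin 4} (hc : c ≠ 0) (z : V) :
    (G.switch x y).nbr c z = G.nbr c z := by simp [switch, hc]

open Classical in
theorem switch_nbr_zero {V : Type u} (G : FeynmanGraph V) {x y : V} (hxy : y ≠ x) (z : V) :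
    (G.switch x y).nbr 0 z = if z = x then y else if z = y then x else
      if z = G.nbr 0 x then G.nbr 0 y else if z = G.nbr 0 y then G.nbr 0 x else G.nbr 0 z := by
  have h1 := G.nbr_nbr 0
  have h2 := G.nbr_ne 0
  simp only [switch, if_true, swap_apply_def]
  grind

open Classical in
theorem switch_self {V : Type u} (G : FeynmanGraph V) (x : V) : G.switch x x = G := by
  apply ext_nbr
  intro c z
  have h1 := G.nbr_nbr 0
  by_cases hc : c = 0
  · subst hc
    simp only [switch, if_true, swap_apply_def]
    grind
  · rw [switch_nbr _ _ _ hc]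

theorem switch_nbr_left {V : Type u} (G : FeynmanGraph V) {x y : V} (hxy : y ≠ x) :
    (G.switch x y).nbr 0 x = y := by simp [switch_nbr_zero, hxy]

theorem switch_nbr_right {V : Type u} (G : FeynmanGraph V) {x y : V} (hxy : y ≠ x) :
    (G.switch x y).nbr 0 y = x := by simp [switch_nbr_zero, hxy]

theorem switch_nbr_left' {V : Type u} (G : FeynmanGraph V) {x y : V} (hxy : y ≠ x) :
    (G.switch x y).nbr 0 (G.nbr 0 x) = G.nbr 0 y := by
  have h1 := G.nbr_nbr 0
  have h2 := G.nbr_ne 0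
  rw [switch_nbr_zero _ hxy]
  grind

theorem switch_nbr_right' {V : Type u} (G : FeynmanGraph V) {x y : V} (hxy : y ≠ x) :
    (G.switch x y).nbr 0 (G.nbr 0 y) = G.nbr 0 x := by
  have h1 := G.nbr_nbr 0
  have h2 := G.nbr_ne 0
  rw [switch_nbr_zero _ hxy]
  grind

theorem switch_nbr_of_ne {V : Type u} (G : FeynmanGraph V) {x y z : V}
    (h1 : z ≠ x) (h2 : z ≠ G.nbr 0 x) (h3 : z ≠ y) (h4 : z ≠ G.nbr 0 y) :
    (G.switch x y).nbr 0 z = G.nbr 0 z := by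
  by_cases hxy : y = x
  · rw [hxy, switch_self]
  · simp [switch_nbr_zero _ hxy, h1, h2, h3, h4]

theorem switch_symm {V : Type u} (G : FeynmanGraph V) (x y : V) : G.switch x y = G.switch y x := by
  by_cases hxy : y = x
  · rw [hxy]
  have hxy' : x ≠ y := fun h => hxy h.symm
  apply ext_nbr
  intro c z
  have h1 := G.nbr_nbr 0
  have h2 := G.nbr_ne 0
  by_cases hc : c = 0
  · subst hc
    rw [switch_nbr_zero _ hxy, switch_nbr_zero _ hxy']
    grind
  · rw [switch_nbr _ _ _ hc, switch_nbr _ _ _ hc]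

theorem switch_nbr_nbr {V : Type u} (G : FeynmanGraph V) (x y : V) :
    G.switch (G.nbr 0 x) (G.nbr 0 y) = G.switch x y := by
  by_cases hxy : y = x
  · rw [hxy, switch_self, switch_self]
  have hxy' : G.nbr 0 y ≠ G.nbr 0 x := fun h => hxy ((G.nbr_inj 0).1 h)
  apply ext_nbr
  intro c z
  have h1 := G.nbr_nbr 0
  have h2 := G.nbr_ne 0
  by_cases hc : c = 0
  · subst hc
    rw [switch_nbr_zero _ hxy, switch_nbr_zero _ hxy']
    grind
  · rw [switch_nbr _ _ _ hc, switch_nbr _ _ _ hc]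

/-- Switching `x` with its old partner undoes a switch. In this way a graph is recovered from the
simpler one obtained by cutting it. -/
theorem switch_switch {V : Type u} (G : FeynmanGraph V) {x y : V} (hxy : y ≠ x) :
    (G.switch x y).switch x (G.nbr 0 x) = G := by
  apply ext_nbr
  intro c z
  have h1 := G.nbr_nbr 0
  have h2 := G.nbr_ne 0
  by_cases hc : c = 0
  · subst hc
    rw [switch_nbr_zero _ (G.nbr_ne 0 x), switch_nbr_left _ hxy, switch_nbr_left' _ hxy,
      switch_nbr_zero _ hxy]
    grind
  · rw [switch_nbr _ _ _ hc, switch_nbr _ _ _ hc]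

theorem IsIso.switch {V : Type u} {W : Type v} {G : FeynmanGraph V} {H : FeynmanGraph W} {e : V ≃ W}
    (h : G.IsIso H e) (x y : V) : (G.switch x y).IsIso (H.switch (e x) (e y)) e := by
  intro c z
  by_cases hxy : y = x
  · rw [hxy, switch_self, switch_self, h]
  have hxy' : e y ≠ e x := fun h => hxy (e.injective h)
  by_cases hc : c = 0
  · subst hc
    rw [switch_nbr_zero _ hxy, switch_nbr_zero _ hxy', ← h, ← h, ← h]
    have hi := e.injective
    grind
  · rw [switch_nbr _ _ _ hc, switch_nbr _ _ _ hc, h]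

-- The two transpositions are mirror images under `nbr 0`: each modifies one of the two directions
-- of travel.
open Classical in
theorem facePerm_switch {V : Type u} (G : FeynmanGraph V) (x y : V) {c : Fin 4} (hc : c ≠ 0) :
    (G.switch x y).facePerm c =
      G.facePerm c * swap x (G.nbr 0 y) * swap (G.nbr 0 x) y := by
  have key : ∀ z, swap (G.nbr 0 x) y (G.nbr 0 z) = G.nbr 0 (swap x (G.nbr 0 y) z) := by
    intro z
    have h1 := G.nbr_nbr 0
    simp only [swap_apply_def]
    grind
  ext z
  simp only [facePerm_apply, Perm.mul_apply, switch_nbr _ _ _ hc]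
  rw [← key]
  simp [switch]

/-- Switching splits a face into two if `x` and `y` are traversed in opposite directions. -/
theorem numCycles_switch_of_sameCycle {V : Type u} [Finite V] (G : FeynmanGraph V) {x y : V}
    {c : Fin 4} (hc : c ≠ 0) (h2 : y ≠ G.nbr 0 x)
    (h : (G.facePerm c).SameCycle x (G.nbr 0 y)) :
    (G.switch x y).numCycles 0 c = G.numCycles 0 c + 1 := by
  classical
  have hne : x ≠ G.nbr 0 y := fun h => h2 (by rw [h, G.nbr_nbr])
  have e1 := numOrbits_mul_swap (G.facePerm c) hne h
  have h3 : (G.facePerm c).SameCycle (G.nbr 0 x) y := by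
    have := G.sameCycle_nbr_zero h
    rwa [G.nbr_nbr] at this
  have h4 : ¬ (G.facePerm c).SameCycle (G.nbr 0 x) x := fun hh =>
    G.not_sameCycle_nbr_zero c x hh.symm
  -- The first transposition splits the cycle of `x` and leaves its mirror image intact, to be split
  -- by the second one.
  have h5 := h3.mul_swap (p := x) (q := G.nbr 0 y) h4 (fun hh => h4 (hh.trans h.symm))
  have e2 := numOrbits_mul_swap _ (Ne.symm h2) h5
  rw [← facePerm_switch _ _ _ hc, ← two_mul_numCycles, e1, ← two_mul_numCycles] at e2
  omega

/-- Switching preserves the number of faces of a colour if `x` and `y` are on the same face and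
traversed in the same direction. -/
theorem numCycles_switch_of_sameCycle' {V : Type u} [Finite V] (G : FeynmanGraph V) {x y : V}
    {c : Fin 4} (hc : c ≠ 0) (h2 : y ≠ G.nbr 0 x)
    (h : (G.facePerm c).SameCycle x y) :
    (G.switch x y).numCycles 0 c = G.numCycles 0 c := by
  classical
  have h0 : ¬ (G.facePerm c).SameCycle x (G.nbr 0 y) := fun hh =>
    G.not_sameCycle_nbr_zero c y (h.symm.trans hh)
  have e1 := numOrbits_mul_swap_of_not (G.facePerm c) h0
  -- Here the first transposition merges the cycle with its own mirror image, and the second one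
  -- splits the result again.
  have h5 : (G.facePerm c * swap x (G.nbr 0 y)).SameCycle (G.nbr 0 x) y := by
    rw [sameCycle_mul_swap_iff _ h0]
    exact Or.inr ⟨Or.inr (G.sameCycle_nbr_zero h), Or.inl h.symm⟩
  have e2 := numOrbits_mul_swap _ (Ne.symm h2) h5
  rw [← facePerm_switch _ _ _ hc, ← two_mul_numCycles] at e2
  rw [← two_mul_numCycles] at e1
  omega

/-- Switching merges two different faces. -/
theorem numCycles_switch_of_not {V : Type u} [Finite V] (G : FeynmanGraph V) {x y : V}
    {c : Fin 4} (hc : c ≠ 0) (h : ¬ G.SameFace c x y) :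
    (G.switch x y).numCycles 0 c + 1 = G.numCycles 0 c := by
  classical
  have h0 : ¬ (G.facePerm c).SameCycle x (G.nbr 0 y) := fun hh => h (Or.inr hh)
  have e1 := numOrbits_mul_swap_of_not (G.facePerm c) h0
  have h5 : ¬ (G.facePerm c * swap x (G.nbr 0 y)).SameCycle (G.nbr 0 x) y := by
    rw [sameCycle_mul_swap_iff _ h0]
    rintro (h' | ⟨h' | h', -⟩)
    · exact h0 (by simpa [G.nbr_nbr] using G.sameCycle_nbr_zero h')
    · exact G.not_sameCycle_nbr_zero c x h'.symm
    · exact h (Or.inl (G.sameCycle_nbr_zero_iff.1 h'))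
  have e2 := numOrbits_mul_swap_of_not _ h5
  rw [← facePerm_switch _ _ _ hc, ← two_mul_numCycles] at e2
  rw [← two_mul_numCycles] at e1
  omega

theorem numCycles_le_switch {V : Type u} [Finite V] (G : FeynmanGraph V) (x y : V)
    {c : Fin 4} (hc : c ≠ 0) : G.numCycles 0 c ≤ (G.switch x y).numCycles 0 c + 1 := by
  by_cases h2 : y = G.nbr 0 x
  · rw [h2]
    have := G.switch_nbr_nbr x (G.nbr 0 x)
    have h3 : G.switch x (G.nbr 0 x) = G := by
      apply ext_nbr
      intro c z
      by_cases hc : c = 0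
      · subst hc; simp [switch]
      · rw [switch_nbr _ _ _ hc]
    rw [h3]; omega
  by_cases h : G.SameFace c x y
  · rcases h with h | h
    · rw [G.numCycles_switch_of_sameCycle' hc h2 h]; omega
    · rw [G.numCycles_switch_of_sameCycle hc h2 h]; omega
  · rw [← G.numCycles_switch_of_not hc h]

/-! ### Numbers of edges and bubbles, degree -/

theorem two_mul_numEdges {V : Type u} [Finite V] (G : FeynmanGraph V) (c : Fin 4) :
    2 * G.numEdges c = Nat.card V := by
  refine mul_card_quot _ (fun x => {x, G.nbr c x}) 2
    (fun x => Set.ncard_pair (G.nbr_ne c x).symm) fun x y => ⟨?_, fun h => ?_⟩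
  · rintro (rfl | rfl)
    · exact .refl _
    · exact .symm _ _ (.rel _ _ rfl)
  · have : ∀ a b, Relation.EqvGen (fun x y => G.nbr c x = y) a b → a = b ∨ a = G.nbr c b := by
      intro a b h
      induction h with
      | rel a b h => right; rw [← h, G.nbr_nbr]
      | refl a => exact Or.inl rfl
      | symm a b _ ih => rcases ih with rfl | rfl <;> simp [G.nbr_nbr]
      | trans a b d _ _ ih ih' =>
        rcases ih with rfl | rfl <;> rcases ih' with rfl | rfl <;> simp [G.nbr_nbr]
    exact this y x h

/-- Two of the colours `1, 2, 3` already connect the four corners of a bubble, so these cycles are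
in bijection with the bubbles. -/
theorem four_mul_numCycles {V : Type u} [Finite V] (G : FeynmanGraph V) {i j k : Fin 4}
    (h : Triple i j k) : 4 * G.numCycles i j = Nat.card V := by
  classical
  have hij := h.mul G
  have hji := (h.rotate.rotate.swap.rotate.rotate.rotate).mul G
  have hik := h.swap.mul G
  have hjk := h.rotate.mul G
  have hki := h.rotate.rotate.mul G
  have hji : ∀ x, G.nbr j (G.nbr i x) = G.nbr k x := h.rotate.swap.mul G
  have hkj : ∀ x, G.nbr k (G.nbr j x) = G.nbr i x := h.rotate.rotate.swap.mul G
  have hi := G.nbr_nbr i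
  have hj := G.nbr_nbr j
  have hk := G.nbr_nbr k
  have ni := G.nbr_ne i
  have nj := G.nbr_ne j
  have nk := G.nbr_ne k
  refine mul_card_quot _ (fun x => {x, G.nbr i x, G.nbr j x, G.nbr k x}) 4
    (fun x => ?_) fun x y => ⟨?_, fun h => ?_⟩
  · have : ({x, G.nbr i x, G.nbr j x, G.nbr k x} : Set V) =
      (({x, G.nbr i x, G.nbr j x, G.nbr k x} : Finset V) : Set V) := by simp
    rw [this, Set.ncard_coe_finset]
    have h1 : G.nbr i x ≠ G.nbr j x := fun h => nk x (by rw [← hij, ← h, hi])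
    have h2 : G.nbr i x ≠ G.nbr k x := fun h => nj x (by rw [← hik, ← h, hi])
    have h3 : G.nbr j x ≠ G.nbr k x := fun h => ni x (by rw [← hjk, ← h, hj])
    rw [Finset.card_insert_of_notMem, Finset.card_insert_of_notMem, Finset.card_pair h3]
    · simp [h1, h2]
    · simp [(ni x).symm, (nj x).symm, (nk x).symm]
  · have gi : ∀ z, Relation.EqvGen (fun x y => G.nbr i x = y ∨ G.nbr j x = y) (G.nbr i z) z :=
      fun z => .symm _ _ (.rel _ _ (Or.inl rfl))
    have gj : ∀ z, Relation.EqvGen (fun x y => G.nbr i x = y ∨ G.nbr j x = y) (G.nbr j z) z :=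
      fun z => .symm _ _ (.rel _ _ (Or.inr rfl))
    rintro (rfl | rfl | rfl | rfl)
    · exact .refl _
    · exact gi _
    · exact gj _
    · rw [← hij]; exact .trans _ _ _ (gi _) (gj _)
  · have : ∀ a b, Relation.EqvGen (fun x y => G.nbr i x = y ∨ G.nbr j x = y) a b →
        a = b ∨ a = G.nbr i b ∨ a = G.nbr j b ∨ a = G.nbr k b := by
      intro a b h
      induction h with
      | rel a b h => rcases h with h | h <;> subst h <;> simp [hi, hj]
      | refl a => exact Or.inl rfl
      | symm a b _ ih => rcases ih with rfl | rfl | rfl | rfl <;> simp [hi, hj, hk]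
      | trans a b d _ _ ih ih' =>
        rcases ih with rfl | rfl | rfl | rfl <;> rcases ih' with rfl | rfl | rfl | rfl <;>
          simp [hi, hj, hk, hij, hji, hik, hki, hjk, hkj]
    exact this y x h

/-- Number of bubbles. -/
noncomputable def numBubbles {V : Type u} (_G : FeynmanGraph V) : ℕ := Nat.card V / 4

theorem four_mul_numBubbles {V : Type u} [Finite V] (G : FeynmanGraph V) :
    4 * G.numBubbles = Nat.card V := by
  have := G.four_mul_numCycles (i := 1) (j := 2) (k := 3) (by decide)
  unfold numBubbles
  omega

theorem numBubbles_pos {V : Type u} [Finite V] [Nonempty V] (G : FeynmanGraph V) :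
    0 < G.numBubbles := by
  have := G.four_mul_numBubbles
  have : 0 < Nat.card V := Nat.card_pos
  omega

/-- Twice the sum of the degrees of the components. -/
noncomputable def excess {V : Type u} (G : FeynmanGraph V) : ℤ :=
  6 * G.numComp + 3 * G.numBubbles -
    2 * (G.numCycles 0 1 + G.numCycles 0 2 + G.numCycles 0 3)

theorem excess_eq {V : Type u} (G : FeynmanGraph V) {i j k : Fin 4} (h : Triple i j k) :
    G.excess = 6 * G.numComp + 3 * G.numBubbles -
      2 * (G.numCycles 0 i + G.numCycles 0 j + G.numCycles 0 k) := by
  rw [excess]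
  have : (G.numCycles 0 1 : ℤ) + G.numCycles 0 2 + G.numCycles 0 3 =
      G.numCycles 0 i + G.numCycles 0 j + G.numCycles 0 k := by
    have H : ∀ i j k : Fin 4, Triple i j k → (i = 1 ∧ j = 2 ∧ k = 3) ∨ (i = 1 ∧ j = 3 ∧ k = 2) ∨
      (i = 2 ∧ j = 1 ∧ k = 3) ∨ (i = 2 ∧ j = 3 ∧ k = 1) ∨ (i = 3 ∧ j = 1 ∧ k = 2) ∨
      (i = 3 ∧ j = 2 ∧ k = 1) := by decide
    rcases H i j k h with ⟨rfl, rfl, rfl⟩ | ⟨rfl, rfl, rfl⟩ | ⟨rfl, rfl, rfl⟩ | ⟨rfl, rfl, rfl⟩ |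
      ⟨rfl, rfl, rfl⟩ | ⟨rfl, rfl, rfl⟩ <;> ring
  rw [this]

/-- With `B` bubbles there are `4B` vertices, `2B` edges of each colour and `B` cycles for each pair
of colours avoiding `0`. Hence the jacket `J_i` has Euler characteristic `F_j + F_k - B`, and the
three are added up. -/
theorem Connected.two_mul_degree {V : Type u} [Finite V] {G : FeynmanGraph V} (h : G.Connected) :
    2 * G.degree = G.excess := by
  have h1 : ∀ c, (G.numEdges c : ℚ) = 2 * G.numBubbles := fun c => by
    have h1 := G.two_mul_numEdges c
    have h2 := G.four_mul_numBubbles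
    have : G.numEdges c = 2 * G.numBubbles := by omega
    rw [this]; push_cast; ring
  have h2 : ∀ i j k : Fin 4, Triple i j k → (G.numCycles i j : ℚ) = G.numBubbles := by
    intro i j k hh
    have h1 := G.four_mul_numCycles hh
    have h2 := G.four_mul_numBubbles
    have : G.numCycles i j = G.numBubbles := by omega
    rw [this]
  have h3 : (Nat.card V : ℚ) = 4 * G.numBubbles := by
    rw [← G.four_mul_numBubbles]; push_cast; ring
  have e1 : ∀ i : Fin 4, (Finset.univ.filter fun c : Fin 4 => c ≠ i).card = 3 := by decide
  have f1 : (Finset.univ.filter fun p : Fin 4 × Fin 4 => p.1 < p.2 ∧ p.1 ≠ 1 ∧ p.2 ≠ 1) =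
    {(0, 2), (0, 3), (2, 3)} := by decide
  have f2 : (Finset.univ.filter fun p : Fin 4 × Fin 4 => p.1 < p.2 ∧ p.1 ≠ 2 ∧ p.2 ≠ 2) =
    {(0, 1), (0, 3), (1, 3)} := by decide
  have f3 : (Finset.univ.filter fun p : Fin 4 × Fin 4 => p.1 < p.2 ∧ p.1 ≠ 3 ∧ p.2 ≠ 3) =
    {(0, 1), (0, 2), (1, 2)} := by decide
  simp only [degree, jacketGenus, jacketEuler, excess, h.numComp_eq, f1, f2, f3]
  push_cast
  simp only [h1, h3, Finset.sum_const, e1]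
  rw [Finset.sum_insert (by decide), Finset.sum_insert (by decide), Finset.sum_singleton,
    Finset.sum_insert (by decide), Finset.sum_insert (by decide), Finset.sum_singleton,
    Finset.sum_insert (by decide), Finset.sum_insert (by decide), Finset.sum_singleton]
  simp only [h2 2 3 1 (by decide), h2 1 3 2 (by decide), h2 1 2 3 (by decide)]
  simp only [nsmul_eq_mul]
  push_cast
  ring

theorem Isomorphic.numBubbles_eq {V : Type u} {W : Type v} {G : FeynmanGraph V}
    {H : FeynmanGraph W} (h : G.Isomorphic H) : G.numBubbles = H.numBubbles := by
  obtain ⟨e, -⟩ := h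
  rw [numBubbles, numBubbles, Nat.card_congr e]

theorem Isomorphic.excess_eq {V : Type u} {W : Type v} [Finite V] {G : FeynmanGraph V}
    {H : FeynmanGraph W} (h : G.Isomorphic H) : G.excess = H.excess := by
  simp only [excess, h.numBubbles_eq, h.numComp_eq, h.numCycles_eq]

/-! ### The jackets have nonnegative genus -/

theorem SameFace.mem_component {V : Type u} [Finite V] {G : FeynmanGraph V} {c : Fin 4} {x y : V}
    (h : G.SameFace c x y) : y ∈ G.component x := by
  have key : ∀ y, (G.facePerm c).SameCycle x y → y ∈ G.component x := fun y h =>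
    h.mem_of_closed (fun z hz => G.isClosed_component x _ _ (G.isClosed_component x _ _ hz))
      (G.mem_component x)
  rcases h with h | h
  · exact key _ h
  · exact ((G.isClosed_component x).mem_iff 0 y).1 (key _ h)

/-- Closing a corner of a bubble: the effect on the number of components. -/
theorem numComp_switch_nbr {V : Type u} [Finite V] (G : FeynmanGraph V) (x : V) {j : Fin 4}
    (hj : j ≠ 0) (hx : G.nbr 0 x ≠ G.nbr j x) :
    ((G.switch x (G.nbr j x)).numComp = G.numComp ∨
      (G.switch x (G.nbr j x)).numComp = G.numComp + 1 ∧
        G.nbr 0 x ∉ (G.switch x (G.nbr j x)).component x) := by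
  set H := G.switch x (G.nbr j x) with hH
  have hne : G.nbr j x ≠ x := G.nbr_ne j x
  have hHj : ∀ c, c ≠ 0 → ∀ z, H.nbr c z = G.nbr c z := fun c hc z => G.switch_nbr _ _ hc z
  have sub : ∀ a b, b ∈ H.component a → b ∈ G.component a := by
    intro a b h
    refine H.component_subset (fun c z hz => ?_) (G.mem_component a) h
    by_cases hc : c = 0
    · subst hc
      have cl := G.isClosed_component a
      rw [hH, switch_nbr_zero _ hne]
      split_ifs with h1 h2 h3 h4
      · rw [h1] at hz; exact cl _ _ hz
      · rw [h2] at hz; exact (cl.mem_iff _ _).1 hz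
      · rw [h3] at hz; exact cl _ _ (cl _ _ ((cl.mem_iff _ _).1 hz))
      · rw [h4] at hz; exact cl _ _ ((cl.mem_iff _ _).1 ((cl.mem_iff _ _).1 hz))
      · exact cl _ _ hz
    · rw [hHj c hc]; exact G.isClosed_component a c z hz
  have hjx : G.nbr j x ∈ H.component x := by
    rw [← hHj j hj]; exact H.isClosed_component x j x (H.mem_component x)
  have h0j : G.nbr 0 (G.nbr j x) ∈ H.component (G.nbr 0 x) := by
    have := H.isClosed_component (G.nbr 0 x) 0 _ (H.mem_component _)
    rwa [hH, switch_nbr_left' _ hne] at this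
  have symm : ∀ {a b}, b ∈ H.component a → a ∈ H.component b :=
    fun h => H.componentSetoid.symm h
  have trans : ∀ {a b d}, b ∈ H.component a → d ∈ H.component b → d ∈ H.component a :=
    fun h h' => H.componentSetoid.trans h h'
  -- Components of `G` are those of the switched graph, with the components of `x` and `nbr 0 x`
  -- merged if they differ.
  have key : ∀ a b, b ∈ G.component a ↔ b ∈ H.component a ∨
      ((x ∈ H.component a ∨ G.nbr 0 x ∈ H.component a) ∧
        (x ∈ H.component b ∨ G.nbr 0 x ∈ H.component b)) := by
    intro a b
    have h0x : G.nbr 0 x ∈ G.component x := G.isClosed_component x 0 x (G.mem_component x)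
    constructor
    · intro h
      refine G.component_subset (S := {b | b ∈ H.component a ∨
        ((x ∈ H.component a ∨ G.nbr 0 x ∈ H.component a) ∧
        (x ∈ H.component b ∨ G.nbr 0 x ∈ H.component b))}) (fun c z hz => ?_)
        (Or.inl (H.mem_component a)) h
      by_cases hc : c = 0
      · subst hc
        have hcase : H.nbr 0 z = G.nbr 0 z ∨ ((x ∈ H.component z ∨ G.nbr 0 x ∈ H.component z) ∧
            (x ∈ H.component (G.nbr 0 z) ∨ G.nbr 0 x ∈ H.component (G.nbr 0 z))) := by
          have h1 := G.nbr_nbr 0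
          have h2 := G.nbr_ne 0
          by_cases z1 : z = x
          · subst z1; exact Or.inr ⟨Or.inl (H.mem_component _), Or.inr (H.mem_component _)⟩
          by_cases z2 : z = G.nbr j x
          · subst z2; exact Or.inr ⟨Or.inl (symm hjx), Or.inr (symm h0j)⟩
          by_cases z3 : z = G.nbr 0 x
          · subst z3; rw [h1]; exact Or.inr ⟨Or.inr (H.mem_component _), Or.inl (H.mem_component _)⟩
          by_cases z4 : z = G.nbr 0 (G.nbr j x)
          · subst z4; rw [h1]; exact Or.inr ⟨Or.inr (symm h0j), Or.inl (symm hjx)⟩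
          left
          exact switch_nbr_of_ne G z1 z3 z2 z4
        rcases hcase with hcase | ⟨h1, h2⟩
        · have hz' : G.nbr 0 z ∈ H.component z := by
            rw [← hcase]; exact H.isClosed_component z 0 z (H.mem_component z)
          rcases hz with hz | ⟨h3, h4⟩
          · exact Or.inl (trans hz hz')
          · exact Or.inr ⟨h3, h4.imp (trans (symm hz')) (trans (symm hz'))⟩
        · rcases hz with hz | ⟨h3, h4⟩
          · exact Or.inr ⟨h1.imp (trans hz) (trans hz), h2⟩
          · exact Or.inr ⟨h3, h2⟩
      · have hz' : G.nbr c z ∈ H.component z := by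
          rw [← hHj c hc]; exact H.isClosed_component z c z (H.mem_component z)
        rcases hz with hz | ⟨h3, h4⟩
        · exact Or.inl (trans hz hz')
        · exact Or.inr ⟨h3, h4.imp (trans (symm hz')) (trans (symm hz'))⟩
    · have gsymm : ∀ {a b}, b ∈ G.component a → a ∈ G.component b :=
        fun h => G.componentSetoid.symm h
      have gtrans : ∀ {a b d}, b ∈ G.component a → d ∈ G.component b → d ∈ G.component a :=
        fun h h' => G.componentSetoid.trans h h'
      rintro (h | ⟨h1, h2⟩)
      · exact sub _ _ h
      · have h3 : x ∈ G.component a := h1.elim (sub _ _) fun h => gtrans (sub _ _ h) (gsymm h0x)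
        have h4 : x ∈ G.component b := h2.elim (sub _ _) fun h => gtrans (sub _ _ h) (gsymm h0x)
        exact gtrans h3 (gsymm h4)
  by_cases hx0 : G.nbr 0 x ∈ H.component x
  · left
    have : H.componentSetoid = G.componentSetoid := by
      ext a b
      show b ∈ H.component a ↔ b ∈ G.component a
      rw [key]
      refine ⟨Or.inl, ?_⟩
      rintro (h | ⟨h1, h2⟩)
      · exact h
      · have h3 : x ∈ H.component a := h1.elim id fun h => trans h (symm hx0)
        have h4 : x ∈ H.component b := h2.elim id fun h => trans h (symm hx0)
        exact trans h3 (symm h4)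
    rw [numComp, numComp, this]
  · right
    exact ⟨(card_quotient_of_merge H.componentSetoid G.componentSetoid x (G.nbr 0 x) hx0 key).symm,
      hx0⟩

/-- The genus of a jacket is nonnegative. -/
theorem numCycles_add_le {V : Type u} [Finite V] (G : FeynmanGraph V) {i j k : Fin 4}
    (h : Triple i j k) : G.numCycles 0 j + G.numCycles 0 k ≤ G.numBubbles + 2 * G.numComp := by
  -- Descent on the number of corners where the propagator is not parallel to the edge of colour
  -- `j`: switching `x` with `nbr j x` makes them parallel there.
  induction hn : Set.ncard {x | G.nbr 0 x ≠ G.nbr j x} using Nat.strong_induction_on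
    generalizing G with | _ n ih
  -- In the terminal situation each bubble is a component, with two faces of colour `j` and one of
  -- colour `k`, and the bound is attained.
  by_cases hall : ∀ x, G.nbr 0 x = G.nbr j x
  · have c4 := G.four_mul_numCycles h.rotate
    have c2 := G.two_mul_numEdges j
    have cb := G.four_mul_numBubbles
    have e1 : G.numCycles 0 j = G.numEdges j := by
      unfold numCycles numEdges
      simp only [hall, or_self]
    have e2 : G.numCycles 0 k = G.numCycles j k := by
      unfold numCycles
      simp only [hall]
    have hle : G.numBubbles ≤ G.numComp := by
      have h1 : G.numCycles j k = G.numBubbles := by omega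
      rw [← h1]
      unfold numComp numCycles
      refine Nat.card_le_card_of_surjective (Quotient.lift (Quot.mk _) ?_) ?_
      · intro x y hxy
        have h0 : ∀ c x, Quot.mk (fun x y => G.nbr j x = y ∨ G.nbr k x = y) (G.nbr c x) =
            Quot.mk _ x := by
          intro c x
          have hj : ∀ x, Quot.mk (fun x y => G.nbr j x = y ∨ G.nbr k x = y) (G.nbr j x) =
            Quot.mk _ x := fun x => 
              (Quot.sound (r := fun x y => G.nbr j x = y ∨ G.nbr k x = y) (Or.inl rfl)).symm
          have hk : ∀ x, Quot.mk (fun x y => G.nbr j x = y ∨ G.nbr k x = y) (G.nbr k x) =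
            Quot.mk _ x := fun x => 
              (Quot.sound (r := fun x y => G.nbr j x = y ∨ G.nbr k x = y) (Or.inr rfl)).symm
          rcases h.cases c with rfl | rfl | rfl | rfl
          · rw [hall, hj]
          · rw [← h.rotate.mul, hj, hk]
          · rw [hj]
          · rw [hk]
        exact G.component_subset (S := {z | Quot.mk _ x = Quot.mk _ z})
          (fun c z hz => by show _ = _; rw [h0]; exact hz) rfl hxy
      · rintro ⟨x⟩; exact ⟨Quotient.mk _ x, rfl⟩
    omega
  · push Not at hall
    obtain ⟨x, hx⟩ := hall
    have hj := h.2.1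
    have hk := h.2.2.1
    set H := G.switch x (G.nbr j x) with hH
    have hne : G.nbr j x ≠ x := G.nbr_ne j x
    have lt : Set.ncard {x | H.nbr 0 x ≠ H.nbr j x} < n := by
      rw [← hn]
      refine Set.ncard_lt_ncard (Set.ssubset_iff_exists.2 ⟨?_, x, hx, ?_⟩) (Set.toFinite _)
      · intro z hz hz'
        apply hz
        rw [hH, switch_nbr _ _ _ hj, switch_nbr_of_ne, hz']
        · rintro rfl; exact hx hz'
        · rintro rfl
          rw [G.nbr_nbr] at hz'
          exact hx (by rw [← G.nbr_inj j, ← hz', G.nbr_nbr])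
        · rintro rfl
          rw [G.nbr_nbr] at hz'
          exact hx (by rw [← G.nbr_inj 0, hz', G.nbr_nbr])
        · rintro rfl
          rw [G.nbr_nbr, G.nbr_inj] at hz'
          exact hx (by rw [← G.nbr_inj 0, ← hz', G.nbr_nbr])
      · show ¬ (H.nbr 0 x ≠ H.nbr j x)
        rw [hH, switch_nbr_left _ hne, switch_nbr _ _ _ hj, not_not]
    have IH := ih _ lt H rfl
    have cj : H.numCycles 0 j = G.numCycles 0 j + 1 :=
      G.numCycles_switch_of_sameCycle hj (Ne.symm hx) (G.sameCycle_step j x)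
    have ck := G.numCycles_le_switch x (G.nbr j x) hk
    rw [← hH] at ck
    have cb : H.numBubbles = G.numBubbles := rfl
    -- Without a new component, the gain of one face of colour `j` compensates the possible loss of
    -- one of colour `k`. With a new component, undoing the switch merges faces of colour `k` in
    -- different components; so `F_k` also rose by one, and the two new faces match the increase of
    -- `2C`.
    rcases G.numComp_switch_nbr x hj hx with hc | ⟨hc, hx0⟩
    · rw [← hH] at hc; omega
    · rw [← hH] at hc hx0
      have hs : H.switch x (G.nbr 0 x) = G := G.switch_switch hne
      have := H.numCycles_switch_of_not hk (x := x) (y := G.nbr 0 x)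
        (fun hh => hx0 hh.mem_component)
      rw [hs] at this
      omega

theorem excess_nonneg {V : Type u} [Finite V] (G : FeynmanGraph V) : 0 ≤ G.excess := by
  have h1 := G.numCycles_add_le (i := 1) (j := 2) (k := 3) (by decide)
  have h2 := G.numCycles_add_le (i := 2) (j := 1) (k := 3) (by decide)
  have h3 := G.numCycles_add_le (i := 3) (j := 1) (k := 2) (by decide)
  unfold excess
  omega

end FeynmanGraph

/-! ### Classes of a disjoint union, and parity of sets with an involution. -/

theorem card_quotient_sum {V : Type u} {W : Type v} [Finite V] [Finite W] (r : Setoid V)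
    (s : Setoid W) (t : Setoid (V ⊕ W)) (hr : ∀ a b, t (Sum.inl a) (Sum.inl b) ↔ r a b)
    (hs : ∀ a b, t (Sum.inr a) (Sum.inr b) ↔ s a b) (hn : ∀ a b, ¬ t (Sum.inl a) (Sum.inr b)) :
    Nat.card (Quotient t) = Nat.card (Quotient r) + Nat.card (Quotient s) := by
  rw [← Nat.card_sum]
  refine (Nat.card_congr (Equiv.ofBijective (Sum.elim
    (Quotient.map' (s₂ := t) Sum.inl fun a b h => (hr a b).2 h)
    (Quotient.map' (s₂ := t) Sum.inr fun a b h => (hs a b).2 h)) ⟨?_, ?_⟩)).symm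
  · rintro (a | a) (b | b) h <;> induction a using Quotient.inductionOn with | _ a <;>
      induction b using Quotient.inductionOn with | _ b
    · exact congrArg Sum.inl (Quotient.sound ((hr a b).1 (Quotient.exact h)))
    · exact absurd (Quotient.exact h) (hn a b)
    · exact absurd (Quotient.exact h.symm) (hn b a)
    · exact congrArg Sum.inr (Quotient.sound ((hs a b).1 (Quotient.exact h)))
  · intro q
    induction q using Quotient.inductionOn with | _ x
    rcases x with a | b
    · exact ⟨Sum.inl (Quotient.mk _ a), rfl⟩
    · exact ⟨Sum.inr (Quotient.mk _ b), rfl⟩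

theorem even_card_of_involution {V : Type u} [Finite V] (S : Set V) (f : V → V)
    (hff : ∀ x, f (f x) = x) (hne : ∀ x, f x ≠ x) (hS : ∀ x ∈ S, f x ∈ S) : Even S.ncard := by
  have h : 2 * Nat.card (Quot fun x y : S => f x = y) = Nat.card S := by
    refine mul_card_quot _ (fun x => {x, ⟨f x, hS x x.2⟩}) 2
      (fun x => Set.ncard_pair fun h => hne x (congrArg Subtype.val h).symm)
      fun x y => ⟨?_, fun h => ?_⟩
    · rintro (rfl | rfl)
      · exact .refl _
      · exact .symm _ _ (.rel _ _ rfl)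
    · have : ∀ a b : S, Relation.EqvGen (fun x y : S => f x = y) a b → a = b ∨ a.1 = f b := by
        intro a b h
        induction h with
        | rel a b h => right; rw [← h, hff]
        | refl a => exact Or.inl rfl
        | symm a b _ ih => rcases ih with rfl | h <;> simp_all
        | trans a b d _ _ ih ih' => grind
      rcases this y x h with h | h
      · exact Or.inl h
      · exact Or.inr (Subtype.ext h)
  rw [← Nat.card_coe_set_eq, ← h]
  exact even_two_mul _

namespace FeynmanGraph

open Equiv Equiv.Perm

/-! ### Disjoint unions and connected sums -/

/-- Disjoint union. -/
def sum {V : Type u} {W : Type v} (G : FeynmanGraph V) (H : FeynmanGraph W) :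
    FeynmanGraph (V ⊕ W) where
  nbr c := Sum.map (G.nbr c) (H.nbr c)
  nbr_nbr c x := by rcases x with x | x <;> simp [nbr_nbr]
  nbr_ne c x := by rcases x with x | x <;> simp [nbr_ne]
  tetrahedral x := by rcases x with x | x <;> simp [tetrahedral]

@[simp]
theorem sum_nbr_inl {V : Type u} {W : Type v} (G : FeynmanGraph V) (H : FeynmanGraph W)
    (c : Fin 4) (x : V) : (G.sum H).nbr c (Sum.inl x) = Sum.inl (G.nbr c x) := rfl

@[simp]
theorem sum_nbr_inr {V : Type u} {W : Type v} (G : FeynmanGraph V) (H : FeynmanGraph W)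
    (c : Fin 4) (x : W) : (G.sum H).nbr c (Sum.inr x) = Sum.inr (H.nbr c x) := rfl

/-- The connected sum: cut the edges of colour `0` at `x` and at `y`, and join `x` to `y`, and the
other two ends to each other. -/
noncomputable def conn {V : Type u} {W : Type v} (G : FeynmanGraph V) (x : V)
    (H : FeynmanGraph W) (y : W) : FeynmanGraph (V ⊕ W) :=
  (G.sum H).switch (Sum.inl x) (Sum.inr y)

theorem component_sum_inl {V : Type u} {W : Type v} (G : FeynmanGraph V) (H : FeynmanGraph W)
    (a : V) : (G.sum H).component (Sum.inl a) = Sum.inl '' G.component a := by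
  apply Set.Subset.antisymm
  · refine component_subset _ ?_ ⟨a, G.mem_component a, rfl⟩
    rintro c _ ⟨x, hx, rfl⟩
    exact ⟨_, G.isClosed_component a c x hx, rfl⟩
  · rintro _ ⟨x, hx, rfl⟩
    exact G.component_subset (S := Sum.inl ⁻¹' (G.sum H).component (Sum.inl a))
      (fun c z hz => (G.sum H).isClosed_component _ c _ hz) (mem_component _ _) hx

theorem component_sum_inr {V : Type u} {W : Type v} (G : FeynmanGraph V) (H : FeynmanGraph W)
    (a : W) : (G.sum H).component (Sum.inr a) = Sum.inr '' H.component a := by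
  apply Set.Subset.antisymm
  · refine component_subset _ ?_ ⟨a, H.mem_component a, rfl⟩
    rintro c _ ⟨x, hx, rfl⟩
    exact ⟨_, H.isClosed_component a c x hx, rfl⟩
  · rintro _ ⟨x, hx, rfl⟩
    exact H.component_subset (S := Sum.inr ⁻¹' (G.sum H).component (Sum.inr a))
      (fun c z hz => (G.sum H).isClosed_component _ c _ hz) (mem_component _ _) hx

theorem numComp_sum {V : Type u} {W : Type v} [Finite V] [Finite W] (G : FeynmanGraph V)
    (H : FeynmanGraph W) : (G.sum H).numComp = G.numComp + H.numComp := by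
  refine card_quotient_sum _ _ _ (fun a b => ?_) (fun a b => ?_) fun a b => ?_
  · show Sum.inl b ∈ (G.sum H).component (Sum.inl a) ↔ b ∈ G.component a
    simp [component_sum_inl]
  · show Sum.inr b ∈ (G.sum H).component (Sum.inr a) ↔ b ∈ H.component a
    simp [component_sum_inr]
  · show ¬ Sum.inr b ∈ (G.sum H).component (Sum.inl a)
    simp [component_sum_inl]

theorem numBubbles_sum {V : Type u} {W : Type v} [Finite V] [Finite W] (G : FeynmanGraph V)
    (H : FeynmanGraph W) : (G.sum H).numBubbles = G.numBubbles + H.numBubbles := by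
  have h1 := (G.sum H).four_mul_numBubbles
  have h2 := G.four_mul_numBubbles
  have h3 := H.four_mul_numBubbles
  rw [Nat.card_sum] at h1
  omega

theorem not_sameFace_inl_inr {V : Type u} {W : Type v} [Finite V] [Finite W] (G : FeynmanGraph V)
    (H : FeynmanGraph W) (c : Fin 4) (a : V) (b : W) :
    ¬ (G.sum H).SameFace c (Sum.inl a) (Sum.inr b) := fun h => by
  have := h.mem_component
  simp [component_sum_inl] at this

theorem numCycles_sum {V : Type u} {W : Type v} [Finite V] [Finite W] (G : FeynmanGraph V)
    (H : FeynmanGraph W) (c : Fin 4) :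
    (G.sum H).numCycles 0 c = G.numCycles 0 c + H.numCycles 0 c := by
  have key : (G.sum H).facePerm c = Equiv.Perm.sumCongr (G.facePerm c) (H.facePerm c) := by
    ext x; rcases x with x | x <;> rfl
  have hz : ∀ n : ℤ, (G.sum H).facePerm c ^ n =
      Equiv.Perm.sumCongr (G.facePerm c ^ n) (H.facePerm c ^ n) := fun n => by
    rw [key]
    exact (map_zpow (Equiv.Perm.sumCongrHom V W) (G.facePerm c, H.facePerm c) n).symm
  have : ((G.sum H).facePerm c).numOrbits =
      (G.facePerm c).numOrbits + (H.facePerm c).numOrbits := by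
    refine card_quotient_sum _ _ _ (fun a b => ?_) (fun a b => ?_) fun a b => ?_
    · show SameCycle _ _ _ ↔ SameCycle _ _ _
      simp [SameCycle, hz]
    · show SameCycle _ _ _ ↔ SameCycle _ _ _
      simp [SameCycle, hz]
    · exact fun h => not_sameFace_inl_inr G H c a b (Or.inl h)
  simp only [← two_mul_numCycles] at this
  omega

theorem excess_sum {V : Type u} {W : Type v} [Finite V] [Finite W] (G : FeynmanGraph V)
    (H : FeynmanGraph W) : (G.sum H).excess = G.excess + H.excess := by
  simp only [excess, numComp_sum, numBubbles_sum, numCycles_sum]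
  push_cast
  ring

theorem conn_nbr_inl {V : Type u} {W : Type v} (G : FeynmanGraph V) (x : V)
    (H : FeynmanGraph W) (y : W) {c : Fin 4} (hc : c ≠ 0) (z : V) :
    (G.conn x H y).nbr c (Sum.inl z) = Sum.inl (G.nbr c z) := by
  rw [conn, switch_nbr _ _ _ hc, sum_nbr_inl]

theorem conn_nbr_inr {V : Type u} {W : Type v} (G : FeynmanGraph V) (x : V)
    (H : FeynmanGraph W) (y : W) {c : Fin 4} (hc : c ≠ 0) (z : W) :
    (G.conn x H y).nbr c (Sum.inr z) = Sum.inr (H.nbr c z) := by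
  rw [conn, switch_nbr _ _ _ hc, sum_nbr_inr]

open Classical in
theorem conn_nbr_zero_inl {V : Type u} {W : Type v} (G : FeynmanGraph V) (x : V)
    (H : FeynmanGraph W) (y : W) (z : V) :
    (G.conn x H y).nbr 0 (Sum.inl z) = if z = x then Sum.inr y else
      if z = G.nbr 0 x then Sum.inr (H.nbr 0 y) else Sum.inl (G.nbr 0 z) := by
  rw [conn, switch_nbr_zero _ (by simp)]
  simp

open Classical in
theorem conn_nbr_zero_inr {V : Type u} {W : Type v} (G : FeynmanGraph V) (x : V)
    (H : FeynmanGraph W) (y : W) (z : W) :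
    (G.conn x H y).nbr 0 (Sum.inr z) = if z = y then Sum.inl x else
      if z = H.nbr 0 y then Sum.inl (G.nbr 0 x) else Sum.inr (H.nbr 0 z) := by
  rw [conn, switch_nbr_zero _ (by simp)]
  simp

theorem conn_nbr_nbr {V : Type u} {W : Type v} (G : FeynmanGraph V) (x : V)
    (H : FeynmanGraph W) (y : W) : G.conn (G.nbr 0 x) H (H.nbr 0 y) = G.conn x H y :=
  (G.sum H).switch_nbr_nbr (Sum.inl x) (Sum.inr y)

/-- A propagator is never a bridge. -/
theorem nbr_zero_mem_of_unique {V : Type u} [Finite V] (G : FeynmanGraph V) {T : Set V} {x : V}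
    (h1 : ∀ c, c ≠ 0 → ∀ z ∈ T, G.nbr c z ∈ T)
    (h2 : ∀ z ∈ T, z ≠ x → z ≠ G.nbr 0 x → G.nbr 0 z ∈ T) (hx : x ∈ T) : G.nbr 0 x ∈ T := by
  by_contra hx'
  -- Parity: colour `1` pairs off the elements of `T`, while colour `0` would pair off `T` without
  -- `x`.
  have e1 := even_card_of_involution T (G.nbr 1) (G.nbr_nbr 1) (G.nbr_ne 1) (h1 1 (by decide))
  have e2 := even_card_of_involution (T \ {x}) (G.nbr 0) (G.nbr_nbr 0) (G.nbr_ne 0) (by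
    rintro z ⟨hz, hzx⟩
    refine ⟨h2 z hz hzx ?_, ?_⟩
    · rintro rfl; exact hx' hz
    · rintro rfl
      rw [G.nbr_nbr] at hx'
      exact hx' hz)
  have := Set.ncard_sdiff_singleton_add_one hx
  rw [← this] at e1
  exact (Nat.even_add_one.1 e1) e2

/-- The cut propagator of `G` is not a bridge, so a closed set contains both of its ends or neither.
If it contains both, it contains all of `G` and, across the two new edges, all of `H`. -/
theorem Connected.conn {V : Type u} {W : Type v} [Finite V] {G : FeynmanGraph V} {H : FeynmanGraph W}
    (hG : G.Connected) (hH : H.Connected) (x : V) (y : W) : (G.conn x H y).Connected := by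
  classical
  rw [connected_iff]
  refine ⟨⟨Sum.inl x⟩, fun S hS hne => ?_⟩
  have h0 := hS.mem_iff 0
  have hx : Sum.inl x ∈ S ↔ Sum.inr y ∈ S := by
    have := h0 (Sum.inl x)
    rw [conn_nbr_zero_inl, if_pos rfl] at this
    exact this.symm
  have hx' : Sum.inl (G.nbr 0 x) ∈ S ↔ Sum.inr (H.nbr 0 y) ∈ S := by
    have := h0 (Sum.inl (G.nbr 0 x))
    rw [conn_nbr_zero_inl, if_neg (G.nbr_ne 0 x), if_pos rfl] at this
    exact this.symm
  have key : ∀ T : Set (V ⊕ W), (∀ c z, (G.conn x H y).nbr c z ∈ T ↔ z ∈ T) →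
      Sum.inl x ∈ T → Sum.inl (G.nbr 0 x) ∈ T → T = Set.univ := by
    intro T hT h1 h2
    have h3 : Sum.inr y ∈ T := by
      have := hT 0 (Sum.inl x)
      rw [conn_nbr_zero_inl, if_pos rfl] at this
      exact this.2 h1
    have h4 : Sum.inr (H.nbr 0 y) ∈ T := by
      have := hT 0 (Sum.inl (G.nbr 0 x))
      rw [conn_nbr_zero_inl, if_neg (G.nbr_ne 0 x), if_pos rfl] at this
      exact this.2 h2
    have e1 : Sum.inl ⁻¹' T = Set.univ := by
      refine hG.eq_univ (fun c z hz => ?_) h1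
      by_cases hc : c = 0
      · subst hc
        by_cases e1 : z = x
        · rw [e1]; exact h2
        by_cases e2 : z = G.nbr 0 x
        · rw [e2, G.nbr_nbr]; exact h1
        have := (hT 0 (Sum.inl z)).2 hz
        rwa [conn_nbr_zero_inl, if_neg e1, if_neg e2] at this
      · have := (hT c (Sum.inl z)).2 hz
        rwa [conn_nbr_inl _ _ _ _ hc] at this
    have e2 : Sum.inr ⁻¹' T = Set.univ := by
      refine hH.eq_univ (fun c z hz => ?_) h3
      by_cases hc : c = 0
      · subst hc
        by_cases e1 : z = y
        · rw [e1]; exact h4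
        by_cases e2 : z = H.nbr 0 y
        · rw [e2, H.nbr_nbr]; exact h3
        have := (hT 0 (Sum.inr z)).2 hz
        rwa [conn_nbr_zero_inr, if_neg e1, if_neg e2] at this
      · have := (hT c (Sum.inr z)).2 hz
        rwa [conn_nbr_inr _ _ _ _ hc] at this
    ext z
    simp only [Set.mem_univ, iff_true]
    rcases z with z | z
    · exact (Set.ext_iff.1 e1 z).2 (Set.mem_univ z)
    · exact (Set.ext_iff.1 e2 z).2 (Set.mem_univ z)
  have iff0 : ∀ T : Set (V ⊕ W), (∀ c z, (G.conn x H y).nbr c z ∈ T ↔ z ∈ T) →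
      (Sum.inl x ∈ T ↔ Sum.inl (G.nbr 0 x) ∈ T) := by
    intro T hT
    have h1 : ∀ c, c ≠ 0 → ∀ z ∈ Sum.inl ⁻¹' T, G.nbr c z ∈ Sum.inl ⁻¹' T := fun c hc z hz => by
      have := (hT c (Sum.inl z)).2 hz
      rwa [conn_nbr_inl _ _ _ _ hc] at this
    have h2 : ∀ z ∈ Sum.inl ⁻¹' T, z ≠ x → z ≠ G.nbr 0 x → G.nbr 0 z ∈ Sum.inl ⁻¹' T :=
      fun z hz e1 e2 => by
        have := (hT 0 (Sum.inl z)).2 hz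
        rwa [conn_nbr_zero_inl, if_neg e1, if_neg e2] at this
    exact ⟨fun h => G.nbr_zero_mem_of_unique h1 h2 h, fun h => by
      have := G.nbr_zero_mem_of_unique (x := G.nbr 0 x) h1
        (fun z hz e1 e2 => h2 z hz (by rwa [G.nbr_nbr] at e2) e1) h
      rwa [G.nbr_nbr] at this⟩
  by_cases hxS : Sum.inl x ∈ S
  · exact key S (hS.mem_iff) hxS ((iff0 S hS.mem_iff).1 hxS)
  · have hc := hS.compl
    have := key Sᶜ hc.mem_iff hxS ((iff0 _ hc.mem_iff).1 hxS)
    obtain ⟨z, hz⟩ := hne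
    exact absurd hz ((Set.ext_iff.1 this z).2 (Set.mem_univ z))

theorem numCycles_conn {V : Type u} {W : Type v} [Finite V] [Finite W] (G : FeynmanGraph V)
    (x : V) (H : FeynmanGraph W) (y : W) {c : Fin 4} (hc : c ≠ 0) :
    (G.conn x H y).numCycles 0 c + 1 = G.numCycles 0 c + H.numCycles 0 c := by
  rw [← numCycles_sum]
  exact numCycles_switch_of_not _ hc (not_sameFace_inl_inr G H c x y)

/-- The degree is additive under connected sums. -/
theorem Connected.excess_conn {V : Type u} {W : Type v} [Finite V] [Finite W] {G : FeynmanGraph V}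
    {H : FeynmanGraph W} (hG : G.Connected) (hH : H.Connected) (x : V) (y : W) :
    (G.conn x H y).excess = G.excess + H.excess := by
  have h1 := G.numCycles_conn x H y (c := 1) (by decide)
  have h2 := G.numCycles_conn x H y (c := 2) (by decide)
  have h3 := G.numCycles_conn x H y (c := 3) (by decide)
  have h4 : (G.conn x H y).numBubbles = G.numBubbles + H.numBubbles := G.numBubbles_sum H
  have h5 := (hG.conn hH x y).numComp_eq
  have h6 := hG.numComp_eq
  have h7 := hH.numComp_eq
  unfold excess
  rw [h4, h5, h6, h7]
  push_cast
  omega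

/-- The summands of a connected sum are connected. -/
theorem Connected.of_conn {V : Type u} {W : Type v} {G : FeynmanGraph V} {H : FeynmanGraph W}
    {x : V} {y : W} (h : (G.conn x H y).Connected) : G.Connected ∧ H.Connected := by
  classical
  constructor
  · rw [connected_iff]
    refine ⟨⟨x⟩, fun S hS ⟨z, hz⟩ => ?_⟩
    have key : ∀ S : Set V, G.IsClosed S → x ∈ S → S = Set.univ := by
      intro S hS hx
      have : (Sum.inl '' S ∪ Set.range Sum.inr : Set (V ⊕ W)) = Set.univ := by
        refine h.eq_univ ?_ (Or.inl ⟨x, hx, rfl⟩)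
        rintro c _ (⟨z, hz, rfl⟩ | ⟨z, rfl⟩)
        · by_cases hc : c = 0
          · subst hc
            rw [conn_nbr_zero_inl]
            split_ifs
            · simp
            · simp
            · exact Or.inl ⟨_, hS 0 z hz, rfl⟩
          · rw [conn_nbr_inl _ _ _ _ hc]
            exact Or.inl ⟨_, hS c z hz, rfl⟩
        · by_cases hc : c = 0
          · subst hc
            rw [conn_nbr_zero_inr]
            split_ifs
            · exact Or.inl ⟨_, hx, rfl⟩
            · exact Or.inl ⟨_, hS 0 x hx, rfl⟩
            · simp
          · rw [conn_nbr_inr _ _ _ _ hc]; simp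
      ext z
      have := (Set.ext_iff.1 this (Sum.inl z)).2 (Set.mem_univ _)
      simpa using this
    by_cases hx : x ∈ S
    · exact key S hS hx
    · have := key Sᶜ hS.compl hx
      exact absurd hz ((Set.ext_iff.1 this z).2 (Set.mem_univ z))
  · rw [connected_iff]
    refine ⟨⟨y⟩, fun S hS ⟨z, hz⟩ => ?_⟩
    have key : ∀ S : Set W, H.IsClosed S → y ∈ S → S = Set.univ := by
      intro S hS hy
      have : (Sum.inr '' S ∪ Set.range Sum.inl : Set (V ⊕ W)) = Set.univ := by
        refine h.eq_univ ?_ (Or.inl ⟨y, hy, rfl⟩)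
        rintro c _ (⟨z, hz, rfl⟩ | ⟨z, rfl⟩)
        · by_cases hc : c = 0
          · subst hc
            rw [conn_nbr_zero_inr]
            split_ifs
            · simp
            · simp
            · exact Or.inl ⟨_, hS 0 z hz, rfl⟩
          · rw [conn_nbr_inr _ _ _ _ hc]
            exact Or.inl ⟨_, hS c z hz, rfl⟩
        · by_cases hc : c = 0
          · subst hc
            rw [conn_nbr_zero_inl]
            split_ifs
            · exact Or.inl ⟨_, hy, rfl⟩
            · exact Or.inl ⟨_, hS 0 y hy, rfl⟩
            · simp
          · rw [conn_nbr_inl _ _ _ _ hc]; simp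
      ext z
      have := (Set.ext_iff.1 this (Sum.inr z)).2 (Set.mem_univ _)
      simpa using this
    by_cases hy : y ∈ S
    · exact key S hS hy
    · have := key Sᶜ hS.compl hy
      exact absurd hz ((Set.ext_iff.1 this z).2 (Set.mem_univ z))

/-! ### Splitting off a union of components -/

/-- The subgraph on a union of components. -/
def restrict {V : Type u} (G : FeynmanGraph V) (S : Set V) (hS : G.IsClosed S) :
    FeynmanGraph S where
  nbr c x := ⟨G.nbr c x, hS c x x.2⟩
  nbr_nbr c x := Subtype.ext (G.nbr_nbr c x)
  nbr_ne c x h := G.nbr_ne c x (congrArg Subtype.val h)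
  tetrahedral x := Subtype.ext (G.tetrahedral x)

open Classical in
theorem isIso_restrict_sum {V : Type u} (G : FeynmanGraph V) (S : Set V) (hS : G.IsClosed S) :
    ((G.restrict S hS).sum (G.restrict Sᶜ hS.compl)).IsIso G (Equiv.Set.sumCompl S) := by
  rintro c (x | x)
  · simp [restrict]
  · simp [restrict]

/-- A switch between the two sides of a disconnected graph is a connected sum. -/
theorem switch_isomorphic_conn {V : Type u} (G : FeynmanGraph V) (S : Set V) (hS : G.IsClosed S)
    (x : S) (y : (Sᶜ : Set V)) : (G.switch x y).Isomorphic
      ((G.restrict S hS).conn x (G.restrict Sᶜ hS.compl) y) := by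
  classical
  have := (G.isIso_restrict_sum S hS).switch (Sum.inl x) (Sum.inr y)
  simp only [Equiv.Set.sumCompl_apply_inl, Equiv.Set.sumCompl_apply_inr] at this
  exact Isomorphic.symm ⟨_, this⟩

/-! ### Commutation of switches -/

theorem switch_comm {V : Type u} (G : FeynmanGraph V) {x y z t : V} (hzx : z ≠ x) (hzy : z ≠ y)
    (htx : t ≠ x) (hty : t ≠ y) (hzx' : z ≠ G.nbr 0 x) (hzy' : z ≠ G.nbr 0 y)
    (htx' : t ≠ G.nbr 0 x) (hty' : t ≠ G.nbr 0 y) :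
    (G.switch x y).switch z t = (G.switch z t).switch x y := by
  by_cases hxy : y = x
  · rw [hxy, switch_self, switch_self]
  by_cases hzt : t = z
  · rw [hzt, switch_self, switch_self]
  have h1 := G.nbr_nbr 0
  have h2 := G.nbr_ne 0
  apply ext_nbr
  intro c a
  by_cases hc : c = 0
  · subst hc
    rw [switch_nbr_zero (G.switch x y) hzt, switch_nbr_zero (G.switch z t) hxy,
      switch_nbr_of_ne G hzx hzx' hzy hzy', switch_nbr_of_ne G htx htx' hty hty',
      switch_nbr_of_ne G (z := x), switch_nbr_of_ne G (z := y),
      switch_nbr_zero _ hxy, switch_nbr_zero _ hzt] <;> grind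
  · simp only [switch_nbr _ _ _ hc]

/-- Two successive switches at the same end `x`. -/
theorem switch_switch_comm {V : Type u} (G : FeynmanGraph V) {x y z : V} (hyx : y ≠ x)
    (hyx' : y ≠ G.nbr 0 x) (hzx : z ≠ x) (hzx' : z ≠ G.nbr 0 x) (hzy : z ≠ y)
    (hzy' : z ≠ G.nbr 0 y) :
    (G.switch x y).switch x z = (G.switch x z).switch (G.nbr 0 x) (G.nbr 0 y) := by
  have h1 := G.nbr_nbr 0
  have h2 := G.nbr_ne 0
  have hy0 : G.nbr 0 y ≠ G.nbr 0 x := fun h => hyx ((G.nbr_inj 0).1 h)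
  apply ext_nbr
  intro c a
  by_cases hc : c = 0
  · subst hc
    rw [switch_nbr_zero _ hzx, switch_nbr_left _ hyx, switch_nbr_of_ne G hzx hzx' hzy hzy',
      switch_nbr_zero _ hy0, switch_nbr_left' _ hzx, switch_nbr_of_ne G (z := G.nbr 0 y),
      switch_nbr_zero _ hyx, switch_nbr_zero _ hzx] <;> grind
  · simp only [switch_nbr _ _ _ hc]

end FeynmanGraph

namespace FeynmanGraph

open Equiv Equiv.Perm

/-! ### Double covers -/

/-- The double cover defined by a cocycle `f` with values in `ZMod 2`. -/
def cover {V : Type u} (G : FeynmanGraph V) (f : Fin 4 → V → ZMod 2)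
    (hf : ∀ c x, f c (G.nbr c x) = f c x) (ht : ∀ x, f 2 x + f 1 (G.nbr 2 x) = f 3 x) :
    FeynmanGraph (V × ZMod 2) where
  nbr c p := (G.nbr c p.1, p.2 + f c p.1)
  nbr_nbr c p := by
    ext
    · exact G.nbr_nbr c p.1
    · simp [hf, add_assoc, CharTwo.add_self_eq_zero]
  nbr_ne c p h := G.nbr_ne c p.1 (congrArg Prod.fst h)
  tetrahedral p := by
    ext
    · exact G.tetrahedral p.1
    · simp [← ht, add_assoc]

open Classical in
/-- The two sheets over a face on which the cocycle has a potential. -/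
noncomputable def sheetEquiv {V : Type u} (t : V → ZMod 2) : V × ZMod 2 ≃ V ⊕ V where
  toFun p := if p.2 = t p.1 then Sum.inl p.1 else Sum.inr p.1
  invFun := Sum.elim (fun x => (x, t x)) fun x => (x, t x + 1)
  left_inv := by
    rintro ⟨x, s⟩
    by_cases h : s = t x
    · simp [h]
    · simp only [h, if_false, Sum.elim_inr, Prod.mk.injEq, true_and]
      revert h
      generalize t x = b
      revert s b
      decide
  right_inv := by rintro (x | x) <;> simp

/-- A potential along the faces of colour `c` separates the two sheets over them, so the face
permutation of the cover is conjugate to two disjoint copies of that of `G`. -/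
theorem numCycles_cover {V : Type u} [Finite V] (G : FeynmanGraph V) (f : Fin 4 → V → ZMod 2)
    (hf : ∀ c x, f c (G.nbr c x) = f c x) (ht : ∀ x, f 2 x + f 1 (G.nbr 2 x) = f 3 x)
    (c : Fin 4) (t : V → ZMod 2)
    (h : ∀ x, t (G.nbr c (G.nbr 0 x)) = t x + (f 0 x + f c (G.nbr 0 x))) :
    (G.cover f hf ht).numCycles 0 c = 2 * G.numCycles 0 c := by
  have := numOrbits_congr ((G.cover f hf ht).facePerm c) ((G.sum G).facePerm c) (sheetEquiv t) (by
    rintro ⟨x, s⟩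
    have h1 : s + f 0 x + f c (G.nbr 0 x) = t x + (f 0 x + f c (G.nbr 0 x)) ↔ s = t x := by
      rw [add_assoc, add_left_inj]
    simp only [facePerm_apply, sheetEquiv, cover, Equiv.coe_fn_mk, h, h1]
    by_cases hs : s = t x <;> simp [hs])
  rw [← two_mul_numCycles, ← two_mul_numCycles, numCycles_sum] at this
  omega

/-- On a planar jacket, a cocycle which is trivial on the faces is trivial. -/
theorem exists_potential {V : Type u} [Finite V] {G : FeynmanGraph V} (hG : G.Connected)
    {i j k : Fin 4} (h : Triple i j k)
    (hpl : G.numCycles 0 j + G.numCycles 0 k = G.numBubbles + 2) (f : Fin 4 → V → ZMod 2)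
    (hf : ∀ c x, f c (G.nbr c x) = f c x) (ht : ∀ x, f 2 x + f 1 (G.nbr 2 x) = f 3 x)
    (tj tk : V → ZMod 2)
    (hj : ∀ x, tj (G.nbr j (G.nbr 0 x)) = tj x + (f 0 x + f j (G.nbr 0 x)))
    (hk : ∀ x, tk (G.nbr k (G.nbr 0 x)) = tk x + (f 0 x + f k (G.nbr 0 x))) :
    ∃ s : V → ZMod 2, ∀ c x, s (G.nbr c x) = s x + f c x := by
  classical
  set D := G.cover f hf ht with hD
  have c1 := G.numCycles_cover f hf ht j tj hj
  have c2 := G.numCycles_cover f hf ht k tk hk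
  rw [← hD] at c1 c2
  have c3 := D.numCycles_add_le h
  have c4 : D.numBubbles = 2 * G.numBubbles := by
    have h1 := D.four_mul_numBubbles
    have h2 := G.four_mul_numBubbles
    rw [Nat.card_prod, Nat.card_zmod] at h1
    omega
  -- The cover has `2B` bubbles but `2(B + 2)` faces of colours `j` and `k`, so the genus bound
  -- requires at least two components.
  have hnc : ¬ D.Connected := fun hc => by
    have := hc.numComp_eq
    omega
  obtain ⟨x0⟩ := hG.1
  set S := D.component (x0, 0) with hSdef
  have hS : D.IsClosed S := D.isClosed_component _
  have hx0 : (x0, 0) ∈ S := D.mem_component _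
  have z2 : ∀ s t : ZMod 2, t = s ∨ t = s + 1 := by decide
  -- A component containing both points of one fibre would contain every fibre, and the cover would
  -- be connected.
  have hU : ∀ y, ¬ ((y, 0) ∈ S ∧ (y, 1) ∈ S) := by
    intro y hy
    have hU : {y | ∀ s, (y, s) ∈ S} = Set.univ := by
      refine hG.eq_univ (x := y) (fun c z hz s => ?_) ?_
      · have := hS c _ (hz (s + f c z))
        simpa [hD, cover, add_assoc, CharTwo.add_self_eq_zero] using this
      · intro s
        rcases z2 0 s with rfl | rfl
        · exact hy.1
        · simpa using hy.2
    apply hnc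
    rw [connected_iff]
    refine ⟨⟨(x0, 0)⟩, fun T hT ⟨p, hp⟩ => ?_⟩
    have hSu : ∀ p, p ∈ S := fun p => (Set.ext_iff.1 hU p.1).2 trivial p.2
    by_cases hx : (x0, (0 : ZMod 2)) ∈ T
    · exact Set.eq_univ_of_forall fun q => D.component_subset hT hx (hSu q)
    · exact absurd hp (D.component_subset hT.compl hx (hSu p))
  have hE : ∀ y, ∃ s, (y, s) ∈ S := by
    intro y
    have hU : {y | ∃ s, (y, s) ∈ S} = Set.univ := by
      refine hG.eq_univ (x := x0) ?_ ⟨0, hx0⟩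
      rintro c z ⟨s, hs⟩
      exact ⟨_, hS c _ hs⟩
    exact (Set.ext_iff.1 hU y).2 trivial
  -- The component meets each fibre exactly once; the section it defines is the potential.
  choose s hs using hE
  refine ⟨s, fun c x => ?_⟩
  have h1 : (G.nbr c x, s x + f c x) ∈ S := hS c _ (hs x)
  have h2 := hs (G.nbr c x)
  have h3 : ∀ a b : ZMod 2, a ≠ b → a = 0 ∧ b = 1 ∨ a = 1 ∧ b = 0 := by decide
  by_contra hne
  rcases h3 _ _ hne with ⟨e1, e2⟩ | ⟨e1, e2⟩
  · rw [e1] at h2; rw [e2] at h1; exact hU _ ⟨h2, h1⟩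
  · rw [e1] at h2; rw [e2] at h1; exact hU _ ⟨h1, h2⟩

/-! ### Recognizing a graph from its bubbles -/

/-- The corner `m` of the bubble whose corner `0` is `x`. -/
def corner {V : Type u} (G : FeynmanGraph V) (m : Fin 4) (x : V) : V :=
  if m = 0 then x else G.nbr m x

@[simp]
theorem corner_zero {V : Type u} (G : FeynmanGraph V) (x : V) : G.corner 0 x = x := rfl

theorem corner_of_ne {V : Type u} (G : FeynmanGraph V) {m : Fin 4} (hm : m ≠ 0) (x : V) :
    G.corner m x = G.nbr m x := if_neg hm

theorem nbr_corner {V : Type u} (G : FeynmanGraph V) {c : Fin 4} (hc : c ≠ 0) (m : Fin 4) (x : V) :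
    G.nbr c (G.corner m x) = G.corner (m ^^^ c) x := by
  have h1 : ∀ m c : Fin 4, m ^^^ c = 0 ↔ m = c := by decide
  have h2 : ∀ c : Fin 4, 0 ^^^ c = c := by decide
  have h3 : ∀ m c : Fin 4, c ^^^ m = m ^^^ c := by decide
  by_cases hm : m = 0
  · subst hm
    rw [h2, corner_zero, corner_of_ne _ hc]
  · rw [corner_of_ne _ hm]
    by_cases hmc : m = c
    · subst hmc
      rw [G.nbr_nbr, (h1 m m).2 rfl, corner_zero]
    · rw [corner_of_ne _ (fun h => hmc ((h1 m c).1 h)), G.nbr_xor hc hm (Ne.symm hmc), h3]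

theorem corner_corner {V : Type u} (G : FeynmanGraph V) (c m : Fin 4) (x : V) :
    G.corner c (G.corner m x) = G.corner (m ^^^ c) x := by
  by_cases hc : c = 0
  · subst hc; simp
  · rw [corner_of_ne _ hc, nbr_corner _ hc]

/-- A finite graph is determined by the corners `0` of its bubbles and the positions of
the propagators. -/
theorem exists_isIso_of_base {V : Type u} {B : Type v} [Finite V] (G : FeynmanGraph V)
    {p : B × Fin 4 → B × Fin 4} (hp : ∀ x, p (p x) = x) (hne : ∀ x, p x ≠ x) (b : B → V)
    (h : ∀ a m, G.nbr 0 (G.corner m (b a)) = G.corner (p (a, m)).2 (b (p (a, m)).1))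
    (hs : ∀ x, ∃ a m, G.corner m (b a) = x) [Finite B] (hcard : Nat.card B ≤ G.numBubbles) :
    ∃ e : B × Fin 4 ≃ V, (ofPropagator p hp hne).IsIso G e ∧ ∀ a m, e (a, m) = G.corner m (b a) := by
  have hsurj : Function.Surjective fun q : B × Fin 4 => G.corner q.2 (b q.1) := fun x => by
    obtain ⟨a, m, hx⟩ := hs x
    exact ⟨(a, m), hx⟩
  have hc : Nat.card (B × Fin 4) = Nat.card V := by
    refine le_antisymm ?_ (Nat.card_le_card_of_surjective _ hsurj)
    rw [Nat.card_prod, Nat.card_fin, ← G.four_mul_numBubbles]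
    omega
  refine ⟨Equiv.ofBijective _ ((Nat.bijective_iff_surjective_and_card _).2 ⟨hsurj, hc⟩), ?_,
    fun a m => rfl⟩
  rintro c ⟨a, m⟩
  show G.corner _ (b _) = G.nbr c (G.corner m (b a))
  by_cases hc : c = 0
  · subst hc
    rw [h]; rfl
  · rw [nbr_corner _ hc]
    simp [ofPropagator, hc]

/-- The bubbles based at `b` are closed under all colours, so connectedness makes them exhaust the
graph, and only their number remains to be checked. -/
theorem Connected.exists_isIso_of_base {V : Type u} {B : Type v} [Finite V] {G : FeynmanGraph V}
    (hG : G.Connected) {p : B × Fin 4 → B × Fin 4} (hp : ∀ x, p (p x) = x)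
    (hne : ∀ x, p x ≠ x) (b : B → V)
    (h : ∀ a m, G.nbr 0 (G.corner m (b a)) = G.corner (p (a, m)).2 (b (p (a, m)).1))
    [Nonempty B] [Finite B] (hcard : Nat.card B ≤ G.numBubbles) :
    ∃ e : B × Fin 4 ≃ V, (ofPropagator p hp hne).IsIso G e ∧ ∀ a m, e (a, m) = G.corner m (b a) := by
  refine G.exists_isIso_of_base hp hne b h (fun x => ?_) hcard
  obtain ⟨a⟩ := ‹Nonempty B›
  have : {x | ∃ a m, G.corner m (b a) = x} = Set.univ := by
    refine hG.eq_univ (x := b a) ?_ ⟨a, 0, rfl⟩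
    rintro c _ ⟨a, m, rfl⟩
    by_cases hc : c = 0
    · subst hc; exact ⟨_, _, (h a m).symm⟩
    · rw [nbr_corner _ hc]; exact ⟨_, _, rfl⟩
  exact (Set.ext_iff.1 this x).2 trivial

/-! ### Two-particle-irreducible graphs of small degree -/

/-- In a 2PI graph two propagators do not separate. -/
theorem IsTwoPI.eq_univ {V : Type u} {G : FeynmanGraph V} (h2 : G.IsTwoPI) {S : Set V}
    (hS : ∀ c, c ≠ 0 → ∀ z ∈ S, G.nbr c z ∈ S) (x y : V)
    (hxy : ∀ z ∈ S, G.nbr 0 z ∉ S → z = x ∨ z = y) {z : V} (hz : z ∈ S) : S = Set.univ := by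
  by_contra hne
  have key : ∀ y', (y = y' ∨ y = x ∨ y = G.nbr 0 x) → y' ≠ x → y' ≠ G.nbr 0 x → False := by
    intro y' hy h3 h4
    refine h2 x y' ⟨h3, h4, fun hall => hne (Set.eq_univ_of_forall fun w => ?_)⟩
    have := hall z w
    induction this with
    | refl => exact hz
    | tail _ hbc ih =>
      obtain ⟨c, rfl, hc⟩ := hbc
      by_cases hc0 : c = 0
      · subst hc0
        by_contra hcon
        apply hc
        refine ⟨rfl, ?_⟩
        rcases hxy _ ih hcon with h | h
        · exact Or.inl h
        · rcases hy with hy | hy | hy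
          · right; right; left; rw [h, hy]
          · left; rw [h, hy]
          · right; left; rw [h, hy]
      · exact hS c hc0 _ ih
  -- If `x` and `y` are on one propagator, a second one is needed to form a pair of edges. One of
  -- the corners `nbr 1 x`, `nbr 2 x` is on another propagator, and cutting more does no harm.
  by_cases h1 : y = x ∨ y = G.nbr 0 x
  · by_cases h3 : G.nbr 1 x = G.nbr 0 x
    · refine key (G.nbr 2 x) (Or.inr h1) (G.nbr_ne 2 x) fun h => G.nbr_ne 3 x ?_
      rw [← G.tetrahedral, h, ← h3, G.nbr_nbr]
    · exact key (G.nbr 1 x) (Or.inr h1) (G.nbr_ne 1 x) h3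
  · push Not at h1
    exact key y (Or.inl rfl) h1.1 h1.2

/-- The set of corners of a bubble. -/
def bubble {V : Type u} (G : FeynmanGraph V) (x : V) : Set V := {y | ∃ m, G.corner m x = y}

theorem nbr_mem_bubble {V : Type u} (G : FeynmanGraph V) (x : V) {c : Fin 4} (hc : c ≠ 0) (z : V)
    (hz : z ∈ G.bubble x) : G.nbr c z ∈ G.bubble x := by
  obtain ⟨m, rfl⟩ := hz
  exact ⟨_, (G.nbr_corner hc m x).symm⟩

theorem mem_bubble {V : Type u} (G : FeynmanGraph V) (x : V) : x ∈ G.bubble x := ⟨0, rfl⟩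

theorem mem_bubble_iff {V : Type u} (G : FeynmanGraph V) {i j k : Fin 4} (h : Triple i j k)
    (x y : V) : y ∈ G.bubble x ↔ y = x ∨ y = G.nbr i x ∨ y = G.nbr j x ∨ y = G.nbr k x := by
  constructor
  · rintro ⟨m, rfl⟩
    rcases h.cases m with rfl | rfl | rfl | rfl
    · simp
    · simp [corner_of_ne _ h.1]
    · simp [corner_of_ne _ h.2.1]
    · simp [corner_of_ne _ h.2.2.1]
  · rintro (rfl | rfl | rfl | rfl)
    · exact ⟨0, rfl⟩
    · exact ⟨i, corner_of_ne _ h.1 _⟩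
    · exact ⟨j, corner_of_ne _ h.2.1 _⟩
    · exact ⟨k, corner_of_ne _ h.2.2.1 _⟩

theorem corner_injective {V : Type u} (G : FeynmanGraph V) (x : V) :
    Function.Injective fun m => G.corner m x := by
  intro m n h
  by_contra hne
  have h1 : ∀ m n : Fin 4, m ≠ n → m ^^^ n ≠ 0 := by decide
  have h2 : ∀ n : Fin 4, n ^^^ n = 0 := by decide
  have h3 := congrArg (G.corner n) h
  simp only [corner_corner, h2, corner_zero] at h3
  rw [corner_of_ne _ (h1 m n hne)] at h3
  exact G.nbr_ne _ _ h3

theorem ncard_bubble {V : Type u} (G : FeynmanGraph V) (x : V) : (G.bubble x).ncard = 4 := by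
  have : G.bubble x = Set.range fun m => G.corner m x := rfl
  rw [this, ← Set.image_univ, Set.ncard_image_of_injective _ (G.corner_injective x)]
  simp

/-- There are no tadpoles. -/
theorem IsTwoPI.nbr_zero_ne {V : Type u} [Finite V] {G : FeynmanGraph V} (h2 : G.IsTwoPI)
    (hV : 1 < G.numBubbles) {c : Fin 4} (hc : c ≠ 0) (x : V) :
    G.nbr 0 x ≠ G.nbr c x := by
  intro hx
  obtain ⟨d, e, h⟩ := exists_triple_left hc
  -- Only the corners `nbr d x` and `nbr e x` can lead out of the bubble, so it would be the whole
  -- graph.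
  have := h2.eq_univ (S := G.bubble x) (fun c hc z => G.nbr_mem_bubble x hc z)
    (G.nbr d x) (G.nbr e x) (fun z hz hz' => ?_) (G.mem_bubble x)
  · have h1 := G.ncard_bubble x
    rw [this, Set.ncard_univ] at h1
    have := G.four_mul_numBubbles
    omega
  · rw [G.mem_bubble_iff h] at hz hz'
    rcases hz with rfl | rfl | h | h
    · rw [hx] at hz'; simp at hz'
    · rw [← hx, G.nbr_nbr] at hz'; simp at hz'
    · exact Or.inl h
    · exact Or.inr h

theorem IsTwoPI.nbr_zero_notMem_bubble {V : Type u} [Finite V] {G : FeynmanGraph V}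
    (h2 : G.IsTwoPI) (hV : 1 < G.numBubbles) {x y : V}
    (hy : y ∈ G.bubble x) : G.nbr 0 y ∉ G.bubble x := by
  rintro ⟨n, hn⟩
  obtain ⟨m, rfl⟩ := hy
  have h1 : ∀ m n : Fin 4, ∃ c, m ^^^ c = n := by decide
  obtain ⟨c, hc⟩ := h1 m n
  rw [← hc, ← corner_corner] at hn
  by_cases hc0 : c = 0
  · subst hc0
    exact G.nbr_ne 0 _ hn.symm
  · rw [corner_of_ne _ hc0] at hn
    exact h2.nbr_zero_ne hV hc0 _ hn.symm

/-- With a single bubble the excess is odd and nonnegative. -/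
theorem one_le_excess_restrict_bubble {V : Type u} [Finite V] (G : FeynmanGraph V) (x : V)
    (h : G.IsClosed (G.bubble x)) : 1 ≤ (G.restrict _ h).excess := by
  have h0 := (G.restrict _ h).excess_nonneg
  have h1 : (G.restrict _ h).numBubbles = 1 := by
    rw [numBubbles, Nat.card_coe_set_eq, ncard_bubble]
  rw [excess, h1] at h0 ⊢
  omega

/-- A bubble with a self-crossing face that becomes two faces after smoothing. -/
theorem Connected.not_sameCycle_of_isTwoPI {V : Type u} [Finite V] {G : FeynmanGraph V}
    (hG : G.Connected) (h2 : G.IsTwoPI) (hV : 1 < G.numBubbles) (hex : G.excess ≤ 2)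
    {c d e : Fin 4} (h : Triple c d e) (x : V) :
    ¬ (G.facePerm c).SameCycle x (G.nbr 0 (G.nbr d x)) := by
  intro hx
  have hc := h.1
  have hd := h.2.1
  have he := h.2.2.1
  have htad : ∀ c, c ≠ 0 → ∀ x, G.nbr 0 x ≠ G.nbr c x := fun c hc x =>
    h2.nbr_zero_ne hV hc x
  have hcd := h.mul G
  have hdc : ∀ x, G.nbr d (G.nbr c x) = G.nbr e x := h.rotate.swap.mul G
  have hce := h.swap.mul G
  have hec : ∀ x, G.nbr e (G.nbr c x) = G.nbr d x := h.rotate.rotate.mul G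
  have inv := G.nbr_nbr
  have hout : ∀ z ∈ G.bubble x, G.nbr 0 z ∉ G.bubble x := fun z hz =>
    h2.nbr_zero_notMem_bubble hV hz
  have ib := fun y => G.mem_bubble_iff h x y
  have mx := (ib x).2 (by simp)
  have mc := (ib (G.nbr c x)).2 (by simp)
  have md := (ib (G.nbr d x)).2 (by simp)
  have me := (ib (G.nbr e x)).2 (by simp)
  have hdx : G.nbr d x ≠ x := G.nbr_ne d x
  have hec' : G.nbr e x ≠ G.nbr c x := by rw [← hdc]; exact G.nbr_ne d _
  have nin : ∀ y ∈ G.bubble x, ∀ z ∈ G.bubble x, y ≠ G.nbr 0 z := fun y hy z hz hyz =>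
    hout z hz (hyz ▸ hy)
  have neb : ∀ {y z}, y ∉ G.bubble x → z ∈ G.bubble x → y ≠ z := fun hy hz hyz => hy (hyz ▸ hz)
  have nxc : G.nbr c x ≠ x := G.nbr_ne c x
  have nxe : G.nbr e x ≠ x := G.nbr_ne e x
  have ncd : G.nbr c x ≠ G.nbr d x := by rw [← hce, Ne, G.nbr_inj]; exact nxe.symm
  have ned : G.nbr e x ≠ G.nbr d x := by rw [← hcd]; exact G.nbr_ne c _
  -- Two switches detach the bubble: its corners are joined in pairs along the edges of colour `d`,
  -- and so are the four outer ends of its propagators.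
  set G1 := G.switch x (G.nbr d x) with hG1
  have G1c : ∀ c, c ≠ 0 → ∀ z, G1.nbr c z = G.nbr c z := fun c hc z => G.switch_nbr _ _ hc z
  have G1x : G1.nbr 0 x = G.nbr d x := G.switch_nbr_left hdx
  have G1d : G1.nbr 0 (G.nbr d x) = x := G.switch_nbr_right hdx
  have G1cx : G1.nbr 0 (G.nbr c x) = G.nbr 0 (G.nbr c x) :=
    G.switch_nbr_of_ne nxc (nin _ mc _ mx) ncd (nin _ mc _ md)
  have G1ex : G1.nbr 0 (G.nbr e x) = G.nbr 0 (G.nbr e x) :=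
    G.switch_nbr_of_ne nxe (nin _ me _ mx) ned (nin _ me _ md)
  set H := G1.switch (G.nbr c x) (G.nbr e x) with hH
  have hne1 : G.nbr d x ≠ G.nbr 0 x := (htad d hd x).symm
  have hne2 : G.nbr e x ≠ G1.nbr 0 (G.nbr c x) := by rw [G1cx]; exact nin _ me _ mc
  have Hc : ∀ c, c ≠ 0 → ∀ z, H.nbr c z = G.nbr c z := fun c hc z => by
    rw [hH, G1.switch_nbr _ _ hc, G1c c hc]
  have Hcx : H.nbr 0 (G.nbr c x) = G.nbr e x := G1.switch_nbr_left hec'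
  have Hex : H.nbr 0 (G.nbr e x) = G.nbr c x := G1.switch_nbr_right hec'
  have Hx : H.nbr 0 x = G.nbr d x := by
    rw [hH, G1.switch_nbr_of_ne nxc.symm (by rw [G1cx]; exact nin _ mx _ mc) nxe.symm
      (by rw [G1ex]; exact nin _ mx _ me), G1x]
  have Hd : H.nbr 0 (G.nbr d x) = x := by rw [← Hx, H.nbr_nbr]
  have Hbub : H.bubble x = G.bubble x := by
    ext y
    rw [H.mem_bubble_iff h, G.mem_bubble_iff h, Hc c hc, Hc d hd, Hc e he]
  have hcl : H.IsClosed (H.bubble x) := by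
    intro a z hz
    by_cases ha : a = 0
    · subst ha
      rw [Hbub, ib] at hz ⊢
      rcases hz with rfl | rfl | rfl | rfl <;> simp [Hx, Hcx, Hd, Hex]
    · exact H.nbr_mem_bubble x ha z hz
  -- the number of faces
  have d1 : G1.numCycles 0 d = G.numCycles 0 d + 1 :=
    G.numCycles_switch_of_sameCycle hd hne1 (G.sameCycle_step d x)
  have d2 : H.numCycles 0 d = G1.numCycles 0 d + 1 := by
    refine G1.numCycles_switch_of_sameCycle hd hne2 ?_
    have := G1.sameCycle_step d (G.nbr c x)
    rwa [G1c d hd, hdc] at this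
  have c1 : G1.numCycles 0 c = G.numCycles 0 c + 1 :=
    G.numCycles_switch_of_sameCycle hc hne1 hx
  have c2 : H.numCycles 0 c = G1.numCycles 0 c + 1 := by
    refine G1.numCycles_switch_of_sameCycle hc hne2 ?_
    have h1 := G1.sameCycle_step c (G.nbr c x)
    have h2 := G1.sameCycle_step c (G.nbr d x)
    rw [G1c c hc, inv, G1x] at h1
    rw [G1c c hc, hcd] at h2
    exact h1.trans h2
  -- Colours `c` and `d` gain two faces each; colour `e` loses at most one in the first switch and
  -- regains one in the second.
  have e1 := G.numCycles_le_switch x (G.nbr d x) he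
  rw [← hG1] at e1
  have e2 : H.numCycles 0 e = G1.numCycles 0 e + 1 := by
    refine G1.numCycles_switch_of_sameCycle he hne2 ?_
    have h1 := G1.sameCycle_step e (G.nbr c x)
    have h2 := G1.sameCycle_step e x
    rw [G1c e he, hec, G1d] at h1
    rw [G1c e he] at h2
    exact h1.trans h2
  -- the number of components
  have hcomp : H.numComp ≤ 2 := by
    have hall : ∀ z, z ∉ G.bubble x → z ∈ H.component (G.nbr 0 x) := by
      set S := H.component (G.nbr 0 x) with hS
      have hScl : H.IsClosed S := H.isClosed_component _
      have hSb : ∀ z ∈ S, z ∉ G.bubble x := by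
        have : H.IsClosed (G.bubble x)ᶜ := by rw [← Hbub]; exact hcl.compl
        exact fun z hz => H.component_subset this (hout x mx) hz
      have H0d : G.nbr 0 (G.nbr d x) ∈ S := by
        have := hScl 0 _ (H.mem_component _)
        rw [hH, G1.switch_nbr_of_ne (neb (hout x mx) mc)
          (by rw [G1cx, Ne, G.nbr_inj]; exact nxc.symm) (neb (hout x mx) me)
          (by rw [G1ex, Ne, G.nbr_inj]; exact nxe.symm), hG1, G.switch_nbr_left' hdx] at this
        exact this
      have H0ce : G.nbr 0 (G.nbr c x) ∈ S ↔ G.nbr 0 (G.nbr e x) ∈ S := by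
        have := hScl.mem_iff 0 (G.nbr 0 (G.nbr e x))
        rw [← G1ex, hH, G1.switch_nbr_right' hec', G1cx, G1ex] at this
        exact this
      have Hgen : ∀ z ∈ S, z ≠ G.nbr 0 x → z ≠ G.nbr 0 (G.nbr c x) → z ≠ G.nbr 0 (G.nbr d x) →
          z ≠ G.nbr 0 (G.nbr e x) → G.nbr 0 z ∈ S := by
        intro z hz z1 z2 z3 z4
        have hzb := hSb z hz
        have := hScl 0 z hz
        rwa [hH, G1.switch_nbr_of_ne (neb hzb mc) (by rwa [G1cx])
          (neb hzb me) (by rwa [G1ex]), hG1, G.switch_nbr_of_ne (neb hzb mx) z1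
          (neb hzb md) z3] at this
      have hS0 : ∀ c, c ≠ 0 → ∀ z ∈ S, G.nbr c z ∈ S := fun c hc z hz => by
        rw [← Hc c hc]; exact hScl c z hz
      -- Either the two pairs of outer ends are connected outside the bubble, and then `S` is the
      -- entire outside, or `S` is attached to the rest of `G` by two propagators only, against 2PI.
      by_cases hcS : G.nbr 0 (G.nbr c x) ∈ S
      · have heS := H0ce.1 hcS
        have : S ∪ G.bubble x = Set.univ := by
          refine hG.eq_univ (x := x) ?_ (Or.inr mx)
          rintro a z (hz | hz)
          · by_cases ha : a = 0
            · subst ha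
              by_cases z1 : z = G.nbr 0 x
              · right; rw [z1, inv]; exact mx
              by_cases z2 : z = G.nbr 0 (G.nbr c x)
              · right; rw [z2, inv]; exact mc
              by_cases z3 : z = G.nbr 0 (G.nbr d x)
              · right; rw [z3, inv]; exact md
              by_cases z4 : z = G.nbr 0 (G.nbr e x)
              · right; rw [z4, inv]; exact me
              exact Or.inl (Hgen z hz z1 z2 z3 z4)
            · exact Or.inl (hS0 a ha z hz)
          · by_cases ha : a = 0
            · subst ha
              left
              rw [ib] at hz
              rcases hz with rfl | rfl | rfl | rfl
              · exact H.mem_component _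
              · exact hcS
              · exact H0d
              · exact heS
            · exact Or.inr (G.nbr_mem_bubble x ha z hz)
        intro z hz
        exact ((Set.ext_iff.1 this z).2 trivial).resolve_right hz
      · exfalso
        have heS : G.nbr 0 (G.nbr e x) ∉ S := fun h => hcS (H0ce.2 h)
        have : S = Set.univ := by
          refine h2.eq_univ hS0 (G.nbr 0 x) (G.nbr 0 (G.nbr d x)) ?_
            (H.mem_component _)
          intro z hz hz'
          by_contra hcon
          push Not at hcon
          exact hz' (Hgen z hz hcon.1 (fun h => hcS (h ▸ hz)) hcon.2 (fun h => heS (h ▸ hz)))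
        exact hSb x ((Set.ext_iff.1 this x).2 trivial) mx
    have : Function.Surjective (fun b : Bool => if b then Quotient.mk H.componentSetoid x else
        Quotient.mk H.componentSetoid (G.nbr 0 x)) := by
      intro q
      induction q using Quotient.inductionOn with | _ z
      by_cases hz : z ∈ G.bubble x
      · refine ⟨true, Quotient.sound ?_⟩
        show z ∈ H.component x
        obtain ⟨m, rfl⟩ := Hbub.symm ▸ hz
        by_cases hm : m = 0
        · subst hm; exact H.mem_component _
        · rw [corner_of_ne _ hm]; exact H.isClosed_component _ _ _ (H.mem_component _)
      · exact ⟨false, Quotient.sound (hall z hz)⟩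
    have := Nat.card_le_card_of_surjective _ this
    rw [numComp]
    simpa [Nat.card_eq_fintype_card] using this
  have iso : ((H.restrict _ hcl).sum (H.restrict _ hcl.compl)).Isomorphic H := by
    classical
    exact ⟨_, H.isIso_restrict_sum _ hcl⟩
  -- At least four more faces and at most one more component: the excess drops by at least 2, hence
  -- to at most 0, whereas the isolated bubble alone contributes at least 1.
  have x1 := iso.excess_eq
  rw [excess_sum] at x1
  have x2 := H.one_le_excess_restrict_bubble x hcl
  have x3 := (H.restrict _ hcl.compl).excess_nonneg
  have x4 := H.excess_eq h
  have x5 := G.excess_eq h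
  have x6 : H.numBubbles = G.numBubbles := rfl
  have x7 := hG.numComp_eq
  omega

/-- Faces of 2PI graphs of degree at most one do not cross themselves. -/
theorem Connected.not_sameFace_of_isTwoPI {V : Type u} [Finite V] {G : FeynmanGraph V}
    (hG : G.Connected) (h2 : G.IsTwoPI) (hV : 1 < G.numBubbles) (hex : G.excess ≤ 2)
    {c d e : Fin 4} (h : Triple c d e) (x : V) : ¬ G.SameFace c x (G.nbr d x) := by
  rintro (hx | hx)
  · refine hG.not_sameCycle_of_isTwoPI h2 hV hex h.swap x (hx.trans ?_)
    have := G.sameCycle_step c (G.nbr d x)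
    rwa [h.mul] at this
  · exact hG.not_sameCycle_of_isTwoPI h2 hV hex h x hx

end FeynmanGraph

/-! ### Cycle lengths and the number of cycles. -/

namespace Equiv.Perm

theorem le_ncard_cycle {V : Type u} [Finite V] (f : Perm V) (x : V) (L : ℕ)
    (h : ∀ m, 0 < m → m < L → (f ^ m) x ≠ x) : L ≤ Set.ncard {y | f.SameCycle y x} := by
  have hinj : Set.InjOn (fun m => (f ^ m) x) (Set.Iio L) := by
    have key : ∀ m n, m < n → n < L → (f ^ m) x ≠ (f ^ n) x := by
      intro m n hmn hn he
      refine h (n - m) (by omega) (by omega) ?_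
      have : n = m + (n - m) := by omega
      rw [this, pow_add, mul_apply] at he
      exact ((f ^ m).injective he).symm
    intro m hm n hn he
    rcases lt_trichotomy m n with hlt | heq | hlt
    · exact absurd he (key m n hlt hn)
    · exact heq
    · exact absurd he.symm (key n m hlt hm)
  have h1 := hinj.ncard_image
  have h2 : (Set.Iio L).ncard = L := by
    rw [← Finset.coe_Iio, Set.ncard_coe_finset, Nat.card_Iio]
  rw [← h2, ← h1]
  refine Set.ncard_le_ncard ?_ (Set.toFinite _)
  rintro _ ⟨m, -, rfl⟩
  exact sameCycle_pow_left.2 (.refl _ _)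

theorem pow_apply_eq_of_ncard {V : Type u} [Finite V] (f : Perm V) (x : V) (L : ℕ)
    (h : ∀ m, 0 < m → m < L → (f ^ m) x ≠ x) (hL : Set.ncard {y | f.SameCycle y x} = L) :
    (f ^ L) x = x := by
  by_contra hne
  have := le_ncard_cycle f x (L + 1) fun m hm hm' => by
    rcases Nat.lt_or_ge m L with h1 | h1
    · exact h m hm h1
    · obtain rfl : m = L := by omega
      exact hne
  omega

/-- If no cycle is shorter than `L`, there are at most `|V| / L` cycles, and in case of equality
all the cycles have length `L`. -/
theorem mul_numOrbits_le {V : Type u} [Finite V] (f : Perm V) (L : ℕ)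
    (h : ∀ x m, 0 < m → m < L → (f ^ m) x ≠ x) : L * f.numOrbits ≤ Nat.card V :=
  mul_card_quotient_le _ L fun x => le_ncard_cycle f x L (h x)

theorem pow_apply_eq_of_card_le {V : Type u} [Finite V] (f : Perm V) (L : ℕ)
    (h : ∀ x m, 0 < m → m < L → (f ^ m) x ≠ x) (hL : Nat.card V ≤ L * f.numOrbits) (x : V) :
    (f ^ L) x = x :=
  pow_apply_eq_of_ncard f x L (h x) (ncard_class_eq (SameCycle.setoid f) L
    (fun x => le_ncard_cycle f x L (h x)) hL x)

theorem ncard_cycle_le {V : Type u} [Finite V] (f : Perm V) (x : V) {L : ℕ} (hL : 0 < L)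
    (h : (f ^ L) x = x) : Set.ncard {y | f.SameCycle y x} ≤ L := by
  have h2 : (Set.Iio L).ncard = L := by
    rw [← Finset.coe_Iio, Set.ncard_coe_finset, Nat.card_Iio]
  rw [← h2]
  refine le_trans (Set.ncard_le_ncard (t := (fun m => (f ^ m) x) '' Set.Iio L) ?_ (Set.toFinite _))
    (Set.ncard_image_le (Set.finite_Iio L))
  intro y hy
  refine (SameCycle.symm hy).mem_of_closed ?_ ⟨0, hL, rfl⟩
  rintro _ ⟨m, hm, rfl⟩
  rcases Nat.lt_or_ge (m + 1) L with h1 | h1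
  · exact ⟨m + 1, h1, by simp [pow_succ']⟩
  · obtain rfl : L = m + 1 := by simp at hm; omega
    refine ⟨0, hL, ?_⟩
    simp only [pow_zero, one_apply]
    rw [← mul_apply, ← pow_succ', h]

end Equiv.Perm

namespace FeynmanGraph

open Equiv Equiv.Perm

/-! ### Planar jackets without short faces -/

/-- A planar jacket is orientable, so that the faces of the remaining colour have even length. -/
theorem Connected.exists_orientation {V : Type u} [Finite V] {G : FeynmanGraph V}
    (hG : G.Connected) {i j k : Fin 4} (h : Triple i j k)
    (hpl : G.numCycles 0 j + G.numCycles 0 k = G.numBubbles + 2) :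
    ∃ s : V → ZMod 2, ∀ x, s (G.facePerm i x) = s x + 1 := by
  have ht : ∀ i : Fin 4, i ≠ 0 → ((if (2 : Fin 4) = i then (0 : ZMod 2) else 1) +
      (if (1 : Fin 4) = i then 0 else 1) = if (3 : Fin 4) = i then 0 else 1) := by decide
  have hj : j ≠ i := h.2.2.2.1.symm
  have hk : k ≠ i := h.2.2.2.2.1.symm
  have h0 : (0 : Fin 4) ≠ i := h.1.symm
  -- The cocycle equal to `1` on the edges of the jacket vanishes on faces of colours `j` and `k`,
  -- each step of which adds `1 + 1`. Its potential is a bipartition of the jacket. An edge of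
  -- colour `i` composes one of colour `j` and one of colour `k`, so it does not change sides.
  obtain ⟨s, hs⟩ := exists_potential hG h hpl (fun c _ => if c = i then 0 else 1)
    (fun _ _ => rfl) (fun _ => ht i h.1) (fun _ => 0) (fun _ => 0)
    (fun x => by simp [h0, hj]; decide) (fun x => by simp [h0, hk]; decide)
  refine ⟨s, fun x => ?_⟩
  rw [facePerm_apply, hs, hs]
  simp [h0]

open Classical in
/-- Two straight curves of a planar jacket cross evenly. -/
theorem Connected.crossing_even {V : Type u} [Finite V] {G : FeynmanGraph V}
    (hG : G.Connected) {i j k : Fin 4} (h : Triple i j k)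
    (hpl : G.numCycles 0 j + G.numCycles 0 k = G.numBubbles + 2) (x v : V)
    (hv : ¬ G.SameFace i x v) (h4 : (G.facePerm i ^ 4) v = v) :
    (if G.SameFace i x (G.nbr j (G.facePerm i v)) then (1 : ZMod 2) else 0) +
      (if G.SameFace i x (G.nbr j ((G.facePerm i ^ 2) v)) then 1 else 0) +
      (if G.SameFace i x (G.nbr j ((G.facePerm i ^ 3) v)) then 1 else 0) +
      (if G.SameFace i x (G.nbr j v) then 1 else 0) = 0 := by
  set a : V → ZMod 2 := fun y => if G.SameFace i x y then 1 else 0 with ha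
  have a0 : ∀ y, a (G.nbr 0 y) = a y := fun y => by
    have : G.SameFace i x (G.nbr 0 y) ↔ G.SameFace i x y :=
      ⟨fun h => h.trans (G.sameFace_nbr_zero i y).symm, fun h => h.trans (G.sameFace_nbr_zero i y)⟩
    simp only [ha, this]
  have ai : ∀ y, a (G.nbr i y) = a y := fun y => by
    have : G.SameFace i x (G.nbr i y) ↔ G.SameFace i x y :=
      ⟨fun h => h.trans (G.sameFace_nbr i y).symm, fun h => h.trans (G.sameFace_nbr i y)⟩
    simp only [ha, this]
  have hij := h.mul G
  have hji : ∀ y, G.nbr j (G.nbr i y) = G.nbr k y := h.rotate.swap.mul G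
  have hik : ∀ y, G.nbr i (G.nbr k y) = G.nbr j y := h.swap.mul G
  have hki : ∀ y, G.nbr k (G.nbr i y) = G.nbr j y := h.rotate.rotate.mul G
  have hjk : ∀ y, G.nbr j (G.nbr k y) = G.nbr i y := h.rotate.mul G
  have hkj : ∀ y, G.nbr k (G.nbr j y) = G.nbr i y := h.rotate.rotate.swap.mul G
  have akj : ∀ y, a (G.nbr k y) = a (G.nbr j y) := fun y => by rw [← hij, ai]
  have two : ∀ s : ZMod 2, s + s = 0 := by decide
  have i0 := h.1
  have j0 := h.2.1
  have k0 := h.2.2.1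
  have ij := h.2.2.2.1
  have ik := h.2.2.2.2.1
  have jk := h.2.2.2.2.2
  -- The cocycle is the intersection number with the curve through `x`: it vanishes on faces of
  -- colour `j`, and on faces of colour `k` its potential is the indicator `a`. Along a curve other
  -- than that of `x` it adds one exactly at the bubbles where the two curves cross; after one turn
  -- `s` is back at its value.
  obtain ⟨s, hs⟩ := exists_potential hG h hpl
    (fun c y => if c = i ∨ c = k then a y + a (G.nbr k y) else 0)
    (by
      intro c y
      rcases h.cases c with rfl | rfl | rfl | rfl
      · simp [i0.symm, k0.symm]
      · simp [ai, hki, akj]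
      · simp [ij.symm, jk]
      · simp [G.nbr_nbr, add_comm])
    (by
      intro y
      have H : ∀ i j k : Fin 4, Triple i j k → (i = 1 ∧ j = 2 ∧ k = 3) ∨ (i = 1 ∧ j = 3 ∧ k = 2) ∨
        (i = 2 ∧ j = 1 ∧ k = 3) ∨ (i = 2 ∧ j = 3 ∧ k = 1) ∨ (i = 3 ∧ j = 1 ∧ k = 2) ∨
        (i = 3 ∧ j = 2 ∧ k = 1) := by decide
      rcases H i j k h with ⟨rfl, rfl, rfl⟩ | ⟨rfl, rfl, rfl⟩ | ⟨rfl, rfl, rfl⟩ | ⟨rfl, rfl, rfl⟩ |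
        ⟨rfl, rfl, rfl⟩ | ⟨rfl, rfl, rfl⟩ <;> simp [akj, ai, hkj, hji, hjk, add_comm, two])
    (fun _ => 0) a
    (by intro y; simp [i0.symm, k0.symm, ij.symm, jk])
    (by
      intro y
      have e1 : ∀ p q : ZMod 2, p = q + (q + p) := by decide
      simp only [i0.symm, k0.symm, or_self, if_false, or_true, if_true, zero_add, a0]
      exact e1 _ _)
  have step : ∀ y, ¬ G.SameFace i x y → s (G.facePerm i y) = s y + a (G.nbr j (G.facePerm i y)) := by
    intro y hy
    have hay : a y = 0 := by simp [ha, hy]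
    rw [facePerm_apply, hs, hs, hji]
    simp [i0.symm, k0.symm, a0, hay]
  have hnot : ∀ n, ¬ G.SameFace i x ((G.facePerm i ^ n) v) := fun n hn =>
    hv (hn.trans (Or.inl (sameCycle_pow_left.2 (.refl _ _))))
  have s1 := step v hv
  have s2 := step _ (hnot 1)
  have s3 := step _ (hnot 2)
  have s4 := step _ (hnot 3)
  rw [← mul_apply, ← pow_succ'] at s2 s3 s4
  rw [pow_one] at s2
  rw [h4] at s4
  show a _ + a _ + a _ + a _ = 0
  rw [s3, s2, s1] at s4
  have e1 : ∀ p q r t u : ZMod 2, u = u + p + q + r + t → p + q + r + t = 0 := by decide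
  exact e1 _ _ _ _ _ s4

/-- Three pairwise crossing curves of length four form a whole planar jacket. -/
theorem Connected.card_le_of_triangle {V : Type u} [Finite V] {G : FeynmanGraph V}
    (hG : G.Connected) {i j k : Fin 4} (h : Triple i j k)
    (hpl : G.numCycles 0 j + G.numCycles 0 k = G.numBubbles + 2)
    (hself : ∀ x, ¬ G.SameFace i x (G.nbr j x)) (h4 : ∀ x, (G.facePerm i ^ 4) x = x) (x : V)
    (hx : (G.facePerm j ^ 3) x = x) : Nat.card V ≤ 24 := by
  classical
  set F := G.SameFace i with hF
  have F0 : ∀ {a b}, F a b → F a (G.nbr 0 b) := fun h => h.trans (G.sameFace_nbr_zero i _)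
  have Fi : ∀ {a b}, F a b → F a (G.nbr i b) := fun h => h.trans (G.sameFace_nbr i _)
  have hij := h.mul G
  have hji : ∀ y, G.nbr j (G.nbr i y) = G.nbr k y := h.rotate.swap.mul G
  have hik : ∀ y, G.nbr i (G.nbr k y) = G.nbr j y := h.swap.mul G
  -- The side `y` of the triangle crosses each neighbouring side `x`, `z` at a vertex of the
  -- triangle, hence at least twice by parity. As the curve of `y` has four crossings, it meets no
  -- further curve.
  have key : ∀ x, (G.facePerm j ^ 3) x = x → ∀ w, F (G.facePerm j x) w →
      F x (G.nbr j w) ∨ F ((G.facePerm j ^ 2) x) (G.nbr j w) := by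
    intro x hx w hw
    set y := G.facePerm j x with hy
    set z := (G.facePerm j ^ 2) x with hz
    have hyz : z = G.nbr j (G.nbr 0 y) := by rw [hz, pow_two]; rfl
    have hzx : x = G.nbr j (G.nbr 0 z) := by
      have h1 : (G.facePerm j ^ 3) x = G.facePerm j ((G.facePerm j ^ 2) x) := by
        rw [pow_succ', mul_apply]
      rw [h1] at hx
      exact hx.symm
    have hyx : y = G.nbr j (G.nbr 0 x) := rfl
    have nxy : ¬ F x y := fun hh => hself (G.nbr 0 x)
      ((G.sameFace_nbr_zero i x).symm.trans hh)
    have nzy : ¬ F z y := fun hh => hself (G.nbr 0 y)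
      ((G.sameFace_nbr_zero i y).symm.trans (hyz ▸ hh.symm))
    have nzx : ∀ w, ¬ (F x w ∧ F z w) := fun w hw => hself (G.nbr 0 z)
      ((G.sameFace_nbr_zero i z).symm.trans (hzx ▸ hw.2.trans hw.1.symm))
    have p0 : F x (G.nbr j y) := by
      rw [hyx, G.nbr_nbr]; exact G.sameFace_nbr_zero i x
    have r1 : F z (G.nbr j (G.facePerm i y)) := by
      rw [facePerm_apply, hji, ← hij, ← hyz]; exact G.sameFace_nbr i z
    have P := hG.crossing_even h hpl x y nxy (h4 y)
    have R := hG.crossing_even h hpl z y nzy (h4 y)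
    have n0 := nzx (G.nbr j y)
    have n1 := nzx (G.nbr j (G.facePerm i y))
    have n2 := nzx (G.nbr j ((G.facePerm i ^ 2) y))
    have n3 := nzx (G.nbr j ((G.facePerm i ^ 3) y))
    rw [← hF] at P R
    have all : ∀ v, (G.facePerm i).SameCycle y v → F x (G.nbr j v) ∨ F z (G.nbr j v) := by
      have q1 : F x (G.nbr j (G.facePerm i y)) ∨ F z (G.nbr j (G.facePerm i y)) := Or.inr r1
      have m1 : ¬ F x (G.nbr j (G.facePerm i y)) := fun hh => n1 ⟨hh, r1⟩
      have m0 : ¬ F z (G.nbr j y) := fun hh => n0 ⟨p0, hh⟩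
      rw [if_neg m1, if_pos p0] at P
      rw [if_pos r1, if_neg m0] at R
      have q23 : (F x (G.nbr j ((G.facePerm i ^ 2) y)) ∨ F z (G.nbr j ((G.facePerm i ^ 2) y))) ∧
          (F x (G.nbr j ((G.facePerm i ^ 3) y)) ∨ F z (G.nbr j ((G.facePerm i ^ 3) y))) := by
        by_cases a2 : F x (G.nbr j ((G.facePerm i ^ 2) y)) <;>
          by_cases a3 : F x (G.nbr j ((G.facePerm i ^ 3) y)) <;>
          by_cases b2 : F z (G.nbr j ((G.facePerm i ^ 2) y)) <;>
          by_cases b3 : F z (G.nbr j ((G.facePerm i ^ 3) y)) <;>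
          simp only [a2, a3, b2, b3, if_true, if_false, true_or, or_true, or_self, and_true, and_self,
            and_false] at P R n2 n3 ⊢ <;> revert P R n2 n3 <;> decide
      intro v hv
      have : v ∈ ({y, G.facePerm i y, (G.facePerm i ^ 2) y, (G.facePerm i ^ 3) y} : Set V) := by
        refine hv.mem_of_closed ?_ (by simp)
        rintro _ (rfl | rfl | rfl | rfl)
        · simp
        · simp [pow_two]
        · rw [show G.facePerm i ((G.facePerm i ^ 2) y) = (G.facePerm i ^ 3) y by
            rw [pow_succ' _ 2, mul_apply]]
          simp
        · rw [show G.facePerm i ((G.facePerm i ^ 3) y) = y by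
            rw [← mul_apply, ← pow_succ', h4]]
          simp
      rcases this with rfl | rfl | rfl | rfl
      · exact Or.inl p0
      · exact q1
      · exact q23.1
      · exact q23.2
    rcases hw with hw | hw
    · exact all w hw
    · have h1 := all _ (sameCycle_apply_right.2 hw)
      rw [facePerm_apply, G.nbr_nbr, hji, ← hij] at h1
      exact h1.imp (fun hh => by simpa [G.nbr_nbr] using Fi hh)
        fun hh => by simpa [G.nbr_nbr] using Fi hh
  have hx1 : (G.facePerm j ^ 3) (G.facePerm j x) = G.facePerm j x := by
    rw [← mul_apply, ← pow_succ, pow_succ', mul_apply, hx]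
  have hx2 : (G.facePerm j ^ 3) ((G.facePerm j ^ 2) x) = (G.facePerm j ^ 2) x := by
    rw [← mul_apply, ← pow_add, add_comm, pow_add, mul_apply, hx]
  have k1 := key x hx
  have k2 := key _ hx1
  have k3 := key _ hx2
  have e1 : G.facePerm j (G.facePerm j x) = (G.facePerm j ^ 2) x := by rw [pow_two]; rfl
  have e2 : G.facePerm j ((G.facePerm j ^ 2) x) = x := by
    rw [← mul_apply, ← pow_succ', hx]
  have e3 : (G.facePerm j ^ 2) (G.facePerm j x) = x := by
    rw [← mul_apply, ← pow_succ, hx]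
  have e4 : (G.facePerm j ^ 2) ((G.facePerm j ^ 2) x) = G.facePerm j x := by
    rw [← mul_apply, ← pow_add]
    show (G.facePerm j ^ (1 + 3)) x = _
    rw [pow_add, mul_apply, hx, pow_one]
  rw [e1, e3] at k2
  rw [e2, e4] at k3
  -- Applied to the three sides, this makes their union closed under colour `j`; closure under `0`
  -- and `i` is clear, and `k` is the composite of `i` and `j`.
  have huniv : {w | F x w} ∪ {w | F (G.facePerm j x) w} ∪ {w | F ((G.facePerm j ^ 2) x) w} =
      Set.univ := by
    refine hG.eq_univ (x := x) ?_ (Or.inl (Or.inl (SameFace.refl G i x)))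
    have cj : ∀ w ∈ {w | F x w} ∪ {w | F (G.facePerm j x) w} ∪ {w | F ((G.facePerm j ^ 2) x) w},
        G.nbr j w ∈
          {w | F x w} ∪ {w | F (G.facePerm j x) w} ∪ {w | F ((G.facePerm j ^ 2) x) w} := by
      rintro w ((hw | hw) | hw)
      · exact (k3 w hw).elim Or.inr fun h => Or.inl (Or.inr h)
      · exact (k1 w hw).elim (fun h => Or.inl (Or.inl h)) Or.inr
      · exact (k2 w hw).elim (fun h => Or.inl (Or.inr h)) fun h => Or.inl (Or.inl h)
    have ci : ∀ w ∈ {w | F x w} ∪ {w | F (G.facePerm j x) w} ∪ {w | F ((G.facePerm j ^ 2) x) w},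
        G.nbr i w ∈
          {w | F x w} ∪ {w | F (G.facePerm j x) w} ∪ {w | F ((G.facePerm j ^ 2) x) w} := by
      rintro w ((hw | hw) | hw)
      · exact Or.inl (Or.inl (Fi hw))
      · exact Or.inl (Or.inr (Fi hw))
      · exact Or.inr (Fi hw)
    intro c w hw
    rcases h.cases c with rfl | rfl | rfl | rfl
    · rcases hw with (hw | hw) | hw
      · exact Or.inl (Or.inl (F0 hw))
      · exact Or.inl (Or.inr (F0 hw))
      · exact Or.inr (F0 hw)
    · exact ci w hw
    · exact cj w hw
    · rw [← hij]; exact ci _ (cj w hw)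
  -- Four points in each direction of travel.
  have hcard : ∀ x, Set.ncard {w | F x w} ≤ 8 := by
    intro x
    have h1 := ncard_cycle_le (G.facePerm i) x (by norm_num) (h4 x)
    have h2 : {w | F x w} ⊆ {w | (G.facePerm i).SameCycle w x} ∪
        G.nbr 0 '' {w | (G.facePerm i).SameCycle w x} := by
      rintro w (hw | hw)
      · exact Or.inl hw.symm
      · exact Or.inr ⟨_, hw.symm, G.nbr_nbr 0 w⟩
    have h3 := Set.ncard_le_ncard h2 (Set.toFinite _)
    have h4 := Set.ncard_union_le {w | (G.facePerm i).SameCycle w x}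
      (G.nbr 0 '' {w | (G.facePerm i).SameCycle w x})
    have h5 := Set.ncard_image_le (f := G.nbr 0) (Set.toFinite {w | (G.facePerm i).SameCycle w x})
    omega
  have u1 := Set.ncard_union_le ({w | F x w} ∪ {w | F (G.facePerm j x) w})
    {w | F ((G.facePerm j ^ 2) x) w}
  have u2 := Set.ncard_union_le {w | F x w} {w | F (G.facePerm j x) w}
  rw [huniv, Set.ncard_univ] at u1
  have := hcard x
  have := hcard (G.facePerm j x)
  have := hcard ((G.facePerm j ^ 2) x)
  omega

/-- The graph with six bubbles all of whose faces of colours `j` and `k` are triangles. -/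
theorem Connected.isomorphic_octahedron {V : Type u} [Finite V] {G : FeynmanGraph V}
    (hG : G.Connected) (i : Fin 3) (hB : G.numBubbles = 6)
    (hj : ∀ x, (G.facePerm (i + 1).succ ^ 3) x = x)
    (hk : ∀ x, (G.facePerm (i + 2).succ ^ 3) x = x) : G.Isomorphic (octahedron i) := by
  obtain ⟨x⟩ := hG.1
  have T : ∀ i : Fin 3, Triple i.succ (i + 1).succ (i + 2).succ := by decide
  have hT := T i
  obtain ⟨a, ha⟩ : ∃ a, a = G.nbr 0 := ⟨_, rfl⟩
  obtain ⟨b, hb⟩ : ∃ b, b = G.nbr (i + 1).succ := ⟨_, rfl⟩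
  obtain ⟨c, hc⟩ : ∃ c, c = G.nbr (i + 2).succ := ⟨_, rfl⟩
  have aa : ∀ x, a (a x) = x := by rw [ha]; exact G.nbr_nbr 0
  have bb : ∀ x, b (b x) = x := by rw [hb]; exact G.nbr_nbr _
  have cc : ∀ x, c (c x) = x := by rw [hc]; exact G.nbr_nbr _
  have hbc : ∀ x, b (c x) = G.nbr i.succ x := by rw [hb, hc]; exact hT.rotate.mul G
  have hcb : ∀ x, c (b x) = b (c x) := fun x => by
    rw [hbc, hb, hc]; exact hT.rotate.rotate.swap.mul G x
  have ab3 : ∀ x, b (a (b (a (b (a x))))) = x := fun x => by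
    rw [ha, hb]; exact hj x
  have ac3 : ∀ x, c (a (c (a (c (a x))))) = x := fun x => by
    rw [ha, hc]; exact hk x
  -- Together with the commutation of `b` and `c`, the braid relations are those of the Coxeter
  -- group of type `A₃`, with `a` as the middle node. This is the symmetric group on four letters,
  -- whose order 24 is the number of corners of six bubbles.
  have aba : ∀ x, a (b (a x)) = b (a (b x)) := fun x => by
    conv_rhs => rw [← ab3 x]
    simp only [aa, bb]
  have cac : ∀ x, c (a (c x)) = a (c (a x)) := fun x => by
    rw [← ac3 (a (c (a x)))]
    simp only [aa, cc]
  have cabc : ∀ x, c (a (b (c x))) = a (c (a (b x))) := fun x => by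
    rw [← hcb, cac]
  have hp : ∀ i x, octahedronProp i (octahedronProp i x) = x := by decide
  have hne : ∀ i x, octahedronProp i x ≠ x := by decide
  -- The six words are the corners `0` reached from `x` by following the model. Each incidence to be
  -- verified is an instance of the word problem, solved by the relations above.
  have key := hG.exists_isIso_of_base (p := octahedronProp i) (hp i) (hne i) (fun q : Fin 3 × Bool =>
      match q with
      | (0, false) => x
      | (0, true) => a (b (c (a x)))
      | (1, false) => b (a x)
      | (1, true) => c (a (b (c x)))
      | (2, false) => a (b x)
      | (2, true) => a (c x)) ?_ (by simp [hB, Nat.card_eq_fintype_card])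
  · obtain ⟨e, he, -⟩ := key
    exact Isomorphic.symm ⟨e, he⟩
  · have s0 : ∀ i : Fin 3, i.succ ≠ 0 := by decide
    have sij := hT.2.2.2.1.symm
    have sik := hT.2.2.2.2.1.symm
    have sjk := hT.2.2.2.2.2.symm
    rintro ⟨l, s⟩ m
    rcases hT.cases m with rfl | rfl | rfl | rfl <;> fin_cases l <;> cases s <;>
      simp only [octahedronProp, s0, sij, sik, sjk, corner, if_true, if_false, ← ha, ← hb, ← hc,
        ← hbc, aa, bb, hcb, aba, cac, cabc, Bool.not_true, Bool.not_false, Fin.zero_eta,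
        Fin.mk_one, Fin.reduceFinMk, zero_add, Fin.isValue, Fin.reduceAdd,
        Bool.false_eq_true]

/-- Planarity turns the excess into `2 + B - 2 F_i`. Faces of colour `i` have length at least 4, so
`F_i ≤ B / 2`; as the excess is at most 2, equality holds and all these lengths are 4. The faces of
colours `j` and `k` then fix `B = 6`. -/
theorem Connected.isomorphic_octahedron_of_planar {V : Type u} [Finite V] {G : FeynmanGraph V}
    (hG : G.Connected) (h2 : G.IsTwoPI) (hV : 1 < G.numBubbles) (hex : G.excess ≤ 2)
    (hd : G.IsDipoleFree) {i j k : Fin 4} (h : Triple i j k)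
    (hpl : G.numCycles 0 j + G.numCycles 0 k = G.numBubbles + 2) :
    G.excess = 2 ∧ ∃ i, G.Isomorphic (octahedron i) := by
  have p1 : ∀ c, c ≠ 0 → ∀ x, (G.facePerm c ^ 1) x ≠ x := by
    intro c hc x hx
    rw [pow_one, facePerm_apply] at hx
    exact h2.nbr_zero_ne hV hc x (by rw [← hx, G.nbr_nbr, hx])
  have p2 : ∀ c, c ≠ 0 → ∀ x, (G.facePerm c ^ 2) x ≠ x := by
    intro c hc x hx
    rw [pow_two, mul_apply, facePerm_apply, facePerm_apply] at hx
    refine hd c x ⟨hc, fun d hd' => h2.nbr_zero_ne hV hd' x, ?_⟩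
    conv_lhs => rw [← hx, G.nbr_nbr, G.nbr_nbr]
  have short : ∀ c, c ≠ 0 → ∀ x m, 0 < m → m < 3 → (G.facePerm c ^ m) x ≠ x := by
    intro c hc x m hm hm'
    obtain rfl | rfl : m = 1 ∨ m = 2 := by omega
    · exact p1 c hc x
    · exact p2 c hc x
  have short4 : ∀ c, c ≠ 0 → (∀ x, (G.facePerm c ^ 3) x ≠ x) →
      ∀ x m, 0 < m → m < 4 → (G.facePerm c ^ m) x ≠ x := by
    intro c hc h3 x m hm hm'
    rcases Nat.lt_or_ge m 3 with h | h
    · exact short c hc x m hm h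
    · obtain rfl : m = 3 := by omega
      exact h3 x
  have hB := G.four_mul_numBubbles
  have hN := fun c => G.two_mul_numCycles c
  obtain ⟨s, hs⟩ := hG.exists_orientation h hpl
  -- Each step along a face of colour `i` changes the side of the bipartition, so odd lengths do not
  -- occur.
  have i3 : ∀ x, (G.facePerm i ^ 3) x ≠ x := by
    intro x hx
    have : s ((G.facePerm i ^ 3) x) = s x + 1 + 1 + 1 := by
      rw [pow_succ', mul_apply, hs, pow_two, mul_apply, hs, hs]
    rw [hx] at this
    revert this
    generalize s x = t
    revert t
    decide
  have i4 := mul_numOrbits_le _ 4 (short4 i h.1 i3)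
  have hE := G.excess_eq h
  rw [hG.numComp_eq] at hE
  have hi := hN i
  have hj := hN j
  have hk := hN k
  have i4' := pow_apply_eq_of_card_le _ 4 (short4 i h.1 i3) (by omega)
  have j3 := mul_numOrbits_le _ 3 (short j h.2.1)
  have k3 := mul_numOrbits_le _ 3 (short k h.2.2.1)
  -- A triangle of colour `j` or `k` bounds the graph; with no triangle there would be at most `B`
  -- faces of these two colours instead of `B + 2`.
  have hB6 : Nat.card V ≤ 24 := by
    by_contra hcon
    have jn : ∀ x, (G.facePerm j ^ 3) x ≠ x := fun x hx => hcon
      (hG.card_le_of_triangle h hpl (hG.not_sameFace_of_isTwoPI h2 hV hex h) i4' x hx)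
    have kn : ∀ x, (G.facePerm k ^ 3) x ≠ x := fun x hx => hcon
      (hG.card_le_of_triangle h.swap (by omega)
        (hG.not_sameFace_of_isTwoPI h2 hV hex h.swap) i4' x hx)
    have j4 := mul_numOrbits_le _ 4 (short4 j h.2.1 jn)
    have k4 := mul_numOrbits_le _ 4 (short4 k h.2.2.1 kn)
    omega
  -- Lengths at least 3 give `3 F_j ≤ 2B` and `3 F_k ≤ 2B`. With `F_j + F_k = B + 2` this yields `B
  -- ≥ 6`, so `B = 6`, `F_j = F_k = 4`, and every such face is a triangle.
  have j3' := pow_apply_eq_of_card_le _ 3 (short j h.2.1) (by omega)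
  have k3' := pow_apply_eq_of_card_le _ 3 (short k h.2.2.1) (by omega)
  refine ⟨by omega, ?_⟩
  have H : ∀ i j k : Fin 4, Triple i j k → ∃ l : Fin 3, l.succ = i ∧
      (((l + 1).succ = j ∧ (l + 2).succ = k) ∨ ((l + 1).succ = k ∧ (l + 2).succ = j)) := by decide
  obtain ⟨l, -, ⟨rfl, rfl⟩ | ⟨rfl, rfl⟩⟩ := H i j k h
  · exact ⟨l, hG.isomorphic_octahedron l (by omega) j3' k3'⟩
  · exact ⟨l, hG.isomorphic_octahedron l (by omega) k3' j3'⟩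

/-- The dipole-free 2PI graphs of small degree are the octahedra. -/
theorem Connected.isomorphic_octahedron_of_isDipoleFree {V : Type u} [Finite V]
    {G : FeynmanGraph V} (hG : G.Connected) (h2 : G.IsTwoPI) (hV : 1 < G.numBubbles)
    (hex : G.excess ≤ 2) (hd : G.IsDipoleFree) :
    G.excess = 2 ∧ ∃ i, G.Isomorphic (octahedron i) := by
  have t1 : Triple 1 2 3 := by decide
  have h1 := G.numCycles_add_le t1
  have h3 := G.numCycles_add_le t1.rotate
  have h4 := G.numCycles_add_le t1.rotate.rotate
  have hE := G.excess_eq t1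
  rw [hG.numComp_eq] at hE h1 h3 h4
  -- Three nonnegative half-integers with sum at most 1 cannot all be positive, so some jacket is
  -- planar.
  by_cases e1 : G.numCycles 0 2 + G.numCycles 0 3 = G.numBubbles + 2
  · exact hG.isomorphic_octahedron_of_planar h2 hV hex hd t1 e1
  by_cases e2 : G.numCycles 0 3 + G.numCycles 0 1 = G.numBubbles + 2
  · exact hG.isomorphic_octahedron_of_planar h2 hV hex hd t1.rotate e2
  by_cases e3 : G.numCycles 0 1 + G.numCycles 0 2 = G.numBubbles + 2
  · exact hG.isomorphic_octahedron_of_planar h2 hV hex hd t1.rotate.rotate e3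
  omega

end FeynmanGraph

namespace FeynmanGraph

open Equiv Equiv.Perm

/-! ### Cutting along two propagators -/

/-- A connected graph which is not 2PI is a connected sum. -/
theorem Connected.exists_conn_of_not_isTwoPI {V : Type u} [Finite V] {G : FeynmanGraph V}
    (hG : G.Connected) (h2 : ¬ G.IsTwoPI) :
    ∃ (S : Set V) (H : FeynmanGraph S) (K : FeynmanGraph (Sᶜ : Set V)) (x : S) (y : (Sᶜ : Set V)),
      H.Connected ∧ K.Connected ∧ G.Isomorphic (H.conn x K y) := by
  classical
  simp only [IsTwoPI, not_forall, not_not] at h2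
  obtain ⟨x, y, hyx, hyx', hcut⟩ := h2
  obtain ⟨a, hab⟩ := not_forall.1 hcut
  obtain ⟨b, hab⟩ := not_forall.1 hab
  set r := fun s t => ∃ c, G.nbr c s = t ∧
        ¬ (c = 0 ∧ (s = x ∨ s = G.nbr 0 x ∨ s = y ∨ s = G.nbr 0 y)) with hr
  set S : Set V := {z | Relation.ReflTransGen r a z} with hSdef
  have haS : a ∈ S := Relation.ReflTransGen.refl
  have hbS : b ∉ S := hab
  have hc : ∀ c, c ≠ 0 → ∀ z ∈ S, G.nbr c z ∈ S := fun c hc z hz =>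
    Relation.ReflTransGen.tail hz ⟨c, rfl, fun h => hc h.1⟩
  have h0 : ∀ z ∈ S, z ≠ x → z ≠ G.nbr 0 x → z ≠ y → z ≠ G.nbr 0 y → G.nbr 0 z ∈ S :=
    fun z hz h1 h2 h3 h4 => Relation.ReflTransGen.tail hz ⟨0, rfl, fun h => by
      rcases h.2 with h | h | h | h
      exacts [h1 h, h2 h, h3 h, h4 h]⟩
  clear_value S
  clear hSdef hab
  have inv := G.nbr_nbr 0
  have notclosed : ¬ G.IsClosed S := fun h => hbS ((Set.ext_iff.1 (hG.eq_univ h haS) b).2 trivial)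
  -- Both propagators leave `S`: if one did not, the other would be the only exit, and a propagator
  -- is never a bridge.
  have cross : ∀ x y, (∀ z ∈ S, z ≠ x → z ≠ G.nbr 0 x → z ≠ y → z ≠ G.nbr 0 y → G.nbr 0 z ∈ S) →
      (x ∈ S ↔ G.nbr 0 x ∉ S) := by
    intro x y h0
    by_contra hx
    have hx' : x ∈ S ↔ G.nbr 0 x ∈ S := by tauto
    have h1 : ∀ z ∈ S, z ≠ y → z ≠ G.nbr 0 y → G.nbr 0 z ∈ S := fun z hz h3 h4 => by
      by_cases e1 : z = x
      · rw [e1] at hz ⊢; exact hx'.1 hz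
      by_cases e2 : z = G.nbr 0 x
      · rw [e2] at hz ⊢; rw [inv]; exact hx'.2 hz
      exact h0 z hz e1 e2 h3 h4
    refine notclosed fun c z hz => ?_
    by_cases hc0 : c = 0
    · subst hc0
      by_cases e1 : z = y
      · subst e1; exact G.nbr_zero_mem_of_unique hc h1 hz
      by_cases e2 : z = G.nbr 0 y
      · subst e2
        refine G.nbr_zero_mem_of_unique hc (fun z hz h3 h4 => h1 z hz ?_ h3) hz
        rwa [inv] at h4
      exact h1 z hz e1 e2
    · exact hc c hc0 z hz
  have cx := cross x y h0
  have cy := cross y x fun z hz h1 h2 h3 h4 => h0 z hz h3 h4 h1 h2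
  obtain ⟨x', hx', ex⟩ : ∃ x' ∈ S, x' = x ∨ x' = G.nbr 0 x := by
    by_cases h : x ∈ S
    · exact ⟨x, h, Or.inl rfl⟩
    · exact ⟨G.nbr 0 x, by tauto, Or.inr rfl⟩
  obtain ⟨y', hy', ey⟩ : ∃ y' ∈ S, y' = y ∨ y' = G.nbr 0 y := by
    by_cases h : y ∈ S
    · exact ⟨y, h, Or.inl rfl⟩
    · exact ⟨G.nbr 0 y, by tauto, Or.inr rfl⟩
  have nx' : G.nbr 0 x' ∉ S := by
    rcases ex with rfl | rfl
    · exact cx.1 hx'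
    · rw [inv]; tauto
  have ny' : G.nbr 0 y' ∉ S := by
    rcases ey with rfl | rfl
    · exact cy.1 hy'
    · rw [inv]; tauto
  have hne : y' ≠ x' := by
    rcases ex with rfl | rfl <;> rcases ey with rfl | rfl
    · exact hyx
    · intro h; exact hyx' (by rw [← h, inv])
    · exact hyx'
    · intro h; exact hyx ((G.nbr_inj 0).1 h)
  have h0' : ∀ z ∈ S, z ≠ x' → z ≠ y' → G.nbr 0 z ∈ S := by
    intro z hz h1 h2
    have h3 : z ≠ G.nbr 0 x' := fun h => nx' (h ▸ hz)
    have h4 : z ≠ G.nbr 0 y' := fun h => ny' (h ▸ hz)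
    rcases ex with rfl | rfl <;> rcases ey with rfl | rfl <;>
      (try simp only [inv] at h3 h4) <;>
      exact h0 z hz (by assumption) (by assumption) (by assumption) (by assumption)
  -- Joining the two inner ends to each other, and the two outer ends to each other, separates `S`.
  -- Undoing this switch is a connected sum.
  have hcl : (G.switch x' y').IsClosed S := by
    intro c z hz
    by_cases hc0 : c = 0
    · subst hc0
      rw [switch_nbr_zero _ hne]
      split_ifs with a1 a2 a3 a4
      · exact hy'
      · exact hx'
      · exact absurd (a3 ▸ hz) nx'
      · exact absurd (a4 ▸ hz) ny'
      · exact h0' z hz a1 a2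
    · rw [switch_nbr _ _ _ hc0]; exact hc c hc0 z hz
  have key := (G.switch x' y').switch_isomorphic_conn S hcl ⟨x', hx'⟩ ⟨G.nbr 0 x', nx'⟩
  simp only at key
  rw [switch_switch _ hne] at key
  have h := Connected.of_conn (key.connected hG)
  exact ⟨S, _, _, _, _, h.1, h.2, key⟩

/-- A closed set of the switched graph contains `x` and `y` together, and likewise their old
partners. In `G` it is therefore either closed or bounded by exactly these two propagators, which
2PI excludes. -/
theorem Connected.switch_of_isTwoPI {V : Type u} {G : FeynmanGraph V}
    (hG : G.Connected) (h2 : G.IsTwoPI) (x y : V) : (G.switch x y).Connected := by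
  classical
  by_cases hne : y = x
  · rw [hne, switch_self]; exact hG
  rw [connected_iff]
  refine ⟨hG.1, fun S hS ⟨z, hz⟩ => ?_⟩
  have hc : ∀ c, c ≠ 0 → ∀ z ∈ S, G.nbr c z ∈ S := fun c hc z hz => by
    rw [← switch_nbr G x y hc]; exact hS c z hz
  have hxy : y ∈ S ↔ x ∈ S := by
    have := hS.mem_iff 0 x; rwa [switch_nbr_left _ hne] at this
  have hxy' : G.nbr 0 y ∈ S ↔ G.nbr 0 x ∈ S := by
    have := hS.mem_iff 0 (G.nbr 0 x); rwa [switch_nbr_left' _ hne] at this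
  have h0 : ∀ z ∈ S, G.nbr 0 z ∉ S → z = x ∨ z = y ∨ z = G.nbr 0 x ∨ z = G.nbr 0 y := by
    intro z hz hz'
    have := hS 0 z hz
    rw [switch_nbr_zero _ hne] at this
    split_ifs at this with a1 a2 a3 a4
    · exact Or.inl a1
    · exact Or.inr (Or.inl a2)
    · exact Or.inr (Or.inr (Or.inl a3))
    · exact Or.inr (Or.inr (Or.inr a4))
    · exact absurd this hz'
  have inv := G.nbr_nbr 0
  by_cases e1 : x ∈ S <;> by_cases e2 : G.nbr 0 x ∈ S
  · refine hG.eq_univ (fun c z hz => ?_) hz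
    by_cases hc0 : c = 0
    · subst hc0
      by_contra hcon
      rcases h0 z hz hcon with rfl | rfl | rfl | rfl
      · exact hcon e2
      · exact hcon (hxy'.2 e2)
      · rw [inv] at hcon; exact hcon e1
      · rw [inv] at hcon; exact hcon (hxy.2 e1)
    · exact hc c hc0 z hz
  · refine h2.eq_univ hc x y (fun z hz hz' => ?_) hz
    rcases h0 z hz hz' with h | h | h | h
    · exact Or.inl h
    · exact Or.inr h
    · exact absurd (h ▸ hz) e2
    · exact absurd (h ▸ hz) (fun h => e2 (hxy'.1 h))
  · refine h2.eq_univ hc (G.nbr 0 x) (G.nbr 0 y) (fun z hz hz' => ?_) hz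
    rcases h0 z hz hz' with h | h | h | h
    · exact absurd (h ▸ hz) e1
    · exact absurd (h ▸ hz) (fun h => e1 (hxy.1 h))
    · exact Or.inl h
    · exact Or.inr h
  · exfalso
    have hcl : G.IsClosed S := by
      intro c z hz
      by_cases hc0 : c = 0
      · subst hc0
        by_contra hcon
        rcases h0 z hz hcon with rfl | rfl | rfl | rfl
        · exact e1 hz
        · exact e1 (hxy.1 hz)
        · exact e2 hz
        · exact e2 (hxy'.1 hz)
      · exact hc c hc0 z hz
    have := hG.eq_univ hcl hz
    exact e1 ((Set.ext_iff.1 this x).2 trivial)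

/-! ### The melon -/

/-- Two bubbles whose corresponding corners are joined. -/
def melon : FeynmanGraph (Bool × Fin 4) :=
  ofPropagator (fun z => (!z.1, z.2)) (by decide) (by decide)

@[simp]
theorem melon_nbr_zero (b : Bool) (k : Fin 4) : melon.nbr 0 (b, k) = (!b, k) := rfl

theorem melon_nbr {c : Fin 4} (hc : c ≠ 0) (b : Bool) (k : Fin 4) :
    melon.nbr c (b, k) = (b, k ^^^ c) := by
  simp [melon, ofPropagator, hc]

/-- The position, in a graph, of the points of a face of colour `c` after a melonic insertion on the
propagator at `w`. -/
def melonProj {V : Type u} (A : FeynmanGraph V) (w : V) (c : Fin 4) : V ⊕ (Bool × Fin 4) → Option V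
  | Sum.inl z => some z
  | Sum.inr (b, k) =>
      if k = 0 then some (if b then w else A.nbr 0 w)
      else if k = c then some (if b then A.nbr 0 w else w) else none

/-- A face of colour `c` runs through the melon from corner `0` to corner `c` of one bubble and back
from `c` to `0` in the other, so its inserted points are assigned to the end of the propagator by
which it enters. The points without a position lie on short faces inside the melon. -/
theorem sameCycle_melonProj {V : Type u} [Finite V] (A : FeynmanGraph V) (w : V) {c : Fin 4}
    (hc : c ≠ 0) {x y : V ⊕ (Bool × Fin 4)}
    (h : ((A.conn w melon (false, 0)).facePerm c).SameCycle x y) {x' : V}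
    (hx : A.melonProj w c x = some x') :
    ∃ y', A.melonProj w c y = some y' ∧ (A.facePerm c).SameCycle x' y' := by
  classical
  refine h.mem_of_closed (S := {z | ∃ y', A.melonProj w c z = some y' ∧
    (A.facePerm c).SameCycle x' y'}) ?_ ⟨x', hx, .refl _ _⟩
  have inv := A.nbr_nbr 0
  have hcc := (by decide : ∀ c : Fin 4, c ^^^ c = 0) c
  have h0c := (by decide : ∀ c : Fin 4, 0 ^^^ c = c) c
  rintro (z | ⟨b, k⟩) ⟨y', hy', hs⟩
  · simp only [melonProj, Option.some.injEq] at hy'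
    subst hy'
    show ∃ y', _
    rw [facePerm_apply, conn_nbr_zero_inl]
    split_ifs with e1 e2
    · subst e1
      rw [conn_nbr_inr _ _ _ _ hc, melon_nbr hc, h0c]
      exact ⟨z, by simp [melonProj, hc], hs⟩
    · subst e2
      rw [conn_nbr_inr _ _ _ _ hc, melon_nbr_zero, melon_nbr hc, h0c]
      exact ⟨_, by simp [melonProj, hc], hs⟩
    · rw [conn_nbr_inl _ _ _ _ hc]
      exact ⟨_, rfl, hs.trans (sameCycle_apply_right.2 (.refl _ _))⟩
  · simp only [melonProj] at hy'
    show ∃ y', _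
    rw [facePerm_apply, conn_nbr_zero_inr]
    by_cases k0 : k = 0
    · subst k0
      cases b
      · simp only [if_true, Bool.false_eq_true, if_false, Option.some.injEq] at hy'
        subst hy'
        rw [if_pos rfl, conn_nbr_inl _ _ _ _ hc]
        refine ⟨_, rfl, hs.trans ?_⟩
        have := (sameCycle_apply_right (f := A.facePerm c)).2
          (SameCycle.refl (A.facePerm c) (A.nbr 0 w))
        rwa [facePerm_apply, inv] at this
      · simp only [if_true, Option.some.injEq] at hy'
        subst hy'
        rw [if_neg (by simp), if_pos (by simp), conn_nbr_inl _ _ _ _ hc]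
        exact ⟨_, rfl, hs.trans (sameCycle_apply_right.2 (.refl _ _))⟩
    · by_cases kc : k = c
      · subst kc
        rw [if_neg (by simp [k0]), if_neg (by simp [k0]), conn_nbr_inr _ _ _ _ hc, melon_nbr_zero,
          melon_nbr hc, hcc]
        refine ⟨y', ?_, hs⟩
        rw [← hy']
        cases b <;> simp [melonProj, k0]
      · simp [k0, kc] at hy'

/-! ### Dipoles -/

theorem isIso_sum_of_embedding {V : Type u} {W : Type v} (G : FeynmanGraph V) (M : FeynmanGraph W)
    {f : W → V} (hf : Function.Injective f) (h : ∀ c t, f (M.nbr c t) = G.nbr c (f t)) :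
    ∃ (hS : G.IsClosed (Set.range f)ᶜ) (e : ((Set.range f)ᶜ : Set V) ⊕ W ≃ V),
      ((G.restrict _ hS).sum M).IsIso G e ∧ (∀ z, e (Sum.inl z) = z) ∧ ∀ t, e (Sum.inr t) = f t := by
  classical
  have hS : G.IsClosed (Set.range f) := by
    rintro c _ ⟨t, rfl⟩
    exact ⟨_, h c t⟩
  let e : ((Set.range f)ᶜ : Set V) ⊕ W ≃ V :=
    (Equiv.sumComm _ _).trans ((Equiv.sumCongr (Equiv.ofInjective f hf) (Equiv.refl _)).trans
      (Equiv.Set.sumCompl (Set.range f)))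
  have h1 : ∀ z, e (Sum.inl z) = z := fun z => rfl
  have h2 : ∀ t, e (Sum.inr t) = f t := fun z => rfl
  refine ⟨hS.compl, e, ?_, h1, h2⟩
  rintro c (z | t)
  · rw [sum_nbr_inl, h1, h1]; rfl
  · rw [sum_nbr_inr, h2, h2, h]

/-- A dipole both of whose left legs are joined closes to a melon. -/
theorem Connected.isomorphic_melon {V : Type u} [Finite V] {G : FeynmanGraph V}
    (hG : G.Connected) (h2 : G.IsTwoPI) (hV : 1 < G.numBubbles) {i j k : Fin 4} (h : Triple i j k)
    {p q : V} (hj : G.nbr 0 (G.nbr j p) = G.nbr j q) (hk : G.nbr 0 (G.nbr k p) = G.nbr k q)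
    (h0 : G.nbr 0 p = q) : G.Isomorphic melon := by
  have inv := G.nbr_nbr 0
  have hj' : G.nbr 0 (G.nbr j q) = G.nbr j p := by rw [← hj, inv]
  have hk' : G.nbr 0 (G.nbr k q) = G.nbr k p := by rw [← hk, inv]
  have h0' : G.nbr 0 q = p := by rw [← h0, inv]
  have ib := fun x y => G.mem_bubble_iff h x y
  -- Only the two corners `i` can lead out of the pair of bubbles, so by 2PI the pair is the whole
  -- graph.
  have hS := h2.eq_univ (S := G.bubble p ∪ G.bubble q) (by
      rintro c hc z (hz | hz)
      · exact Or.inl (G.nbr_mem_bubble _ hc z hz)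
      · exact Or.inr (G.nbr_mem_bubble _ hc z hz)) (G.nbr i p) (G.nbr i q) (by
      rintro z (hz | hz) hz' <;> rw [ib] at hz <;> rcases hz with rfl | rfl | rfl | rfl
      · exact absurd (Or.inr (h0 ▸ G.mem_bubble _)) hz'
      · exact Or.inl rfl
      · exact absurd (Or.inr (by rw [hj, ib]; simp)) hz'
      · exact absurd (Or.inr (by rw [hk, ib]; simp)) hz'
      · exact absurd (Or.inl (by rw [h0']; exact G.mem_bubble _)) hz'
      · exact Or.inr rfl
      · exact absurd (Or.inl (by rw [hj', ib]; simp)) hz'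
      · exact absurd (Or.inl (by rw [hk', ib]; simp)) hz') (Or.inl (G.mem_bubble p))
  have hij := h.mul G
  have hik := h.swap.mul G
  have hi : G.nbr 0 (G.nbr i p) = G.nbr i q := by
    have hm : G.nbr 0 (G.nbr i p) ∈ G.bubble p ∪ G.bubble q := hS ▸ Set.mem_univ _
    rcases hm with hm | hm
    · exact absurd hm (h2.nbr_zero_notMem_bubble hV ((ib _ _).2 (by simp)))
    · rw [ib] at hm
      rcases hm with hm | hm | hm | hm
      · rw [← h0, G.nbr_inj] at hm
        exact absurd hm (G.nbr_ne i p)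
      · exact hm
      · rw [← hj, G.nbr_inj, ← hik, G.nbr_inj] at hm
        exact absurd hm.symm (G.nbr_ne k p)
      · rw [← hk, G.nbr_inj, ← hij, G.nbr_inj] at hm
        exact absurd hm.symm (G.nbr_ne j p)
  have hi' : G.nbr 0 (G.nbr i q) = G.nbr i p := by rw [← hi, inv]
  obtain ⟨e, he, -⟩ := hG.exists_isIso_of_base (p := fun z : Bool × Fin 4 => (!z.1, z.2)) (by decide)
    (by decide) (fun b => if b then q else p) (by
      have h1 := h.1
      have h2 := h.2.1
      have h3 := h.2.2.1
      rintro (_ | _) m <;> rcases h.cases m with rfl | rfl | rfl | rfl <;> simp [corner, *])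
    (by simp; omega)
  exact Isomorphic.symm ⟨e, he⟩

/-- A crosswise leg would lead the face of colour `k` from `p` to `nbr i q`, then to `nbr j q` and
`nbr j p`, so it would cross itself in the bubble of `p`. -/
theorem Connected.nbr_zero_ne_of_dipole {V : Type u} [Finite V] {G : FeynmanGraph V}
    (hG : G.Connected) (h2 : G.IsTwoPI) (hV : 1 < G.numBubbles) (hex : G.excess ≤ 2)
    {i j k : Fin 4} (h : Triple i j k)
    {p q : V} (hj : G.nbr 0 (G.nbr j p) = G.nbr j q) : G.nbr 0 p ≠ G.nbr i q := by
  intro hi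
  refine hG.not_sameFace_of_isTwoPI h2 hV hex h.rotate.rotate.swap p
    ((G.sameFace_nbr_zero k p).trans ?_)
  rw [hi]
  refine (G.sameFace_nbr k _).trans ?_
  rw [h.rotate.rotate.mul G]
  refine (G.sameFace_nbr_zero k _).trans ?_
  rw [← hj, G.nbr_nbr]
  exact .refl _ _ _

/-- A dipole in a 2PI graph of small degree. -/
theorem Connected.exists_switch_of_dipole {V : Type u} [Finite V] {G : FeynmanGraph V}
    (hG : G.Connected) (h2 : G.IsTwoPI) (hV : 1 < G.numBubbles) (hex : G.excess ≤ 2)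
    {i : Fin 4} {x : V} (hd : G.IsDipoleAt i x) : G.Isomorphic melon ∨ G.excess = 2 ∧
      ∃ (S : Set V) (A : FeynmanGraph S) (w u : S), A.Connected ∧ A.excess = 0 ∧ u ≠ w ∧
        (A.facePerm i).SameCycle w (A.nbr 0 u) ∧
        G.Isomorphic ((A.conn w melon (false, 0)).switch (Sum.inl u) (Sum.inr (false, i))) := by
  classical
  obtain ⟨hi0, -, hd⟩ := hd
  obtain ⟨j, k, h⟩ := exists_triple_left hi0
  have inv := G.nbr_nbr
  have hij := h.mul G
  have hik := h.swap.mul G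
  have hji : ∀ x, G.nbr j (G.nbr i x) = G.nbr k x := h.rotate.swap.mul G
  have hki : ∀ x, G.nbr k (G.nbr i x) = G.nbr j x := h.rotate.rotate.mul G
  have hkj : ∀ x, G.nbr k (G.nbr j x) = G.nbr i x := h.rotate.rotate.swap.mul G
  have hjk : ∀ x, G.nbr j (G.nbr k x) = G.nbr i x := h.rotate.mul G
  -- Normalisation: with `p` and `q` as corners `0`, the corners `j` and `k` of the two bubbles are
  -- joined, the left legs are `p, q` and the right legs `nbr i p, nbr i q`.
  obtain ⟨p, hp⟩ : ∃ p, p = G.nbr j x := ⟨_, rfl⟩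
  obtain ⟨q, hq⟩ : ∃ q, q = G.nbr j (G.nbr 0 x) := ⟨_, rfl⟩
  have hj : G.nbr 0 (G.nbr j p) = G.nbr j q := by rw [hp, hq, inv, inv]
  have hk : G.nbr 0 (G.nbr k p) = G.nbr k q := by rw [hp, hq, hkj, hkj, hd]
  clear hp hq hd
  have hj' : G.nbr 0 (G.nbr j q) = G.nbr j p := by rw [← hj, inv]
  have hk' : G.nbr 0 (G.nbr k q) = G.nbr k p := by rw [← hk, inv]
  by_cases e1 : G.nbr 0 p = q
  · exact Or.inl (hG.isomorphic_melon h2 hV h hj hk e1)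
  by_cases e2 : G.nbr 0 (G.nbr i p) = G.nbr i q
  · refine Or.inl (hG.isomorphic_melon h2 hV h (p := G.nbr i p) (q := G.nbr i q) ?_ ?_ e2)
    · rw [hji, hji, hk]
    · rw [hki, hki, hj]
  right
  have e3 := hG.nbr_zero_ne_of_dipole h2 hV hex h hj
  have e4 : G.nbr 0 (G.nbr i p) ≠ q := by
    have := hG.nbr_zero_ne_of_dipole h2 hV hex h (p := G.nbr i p) (q := G.nbr i q)
      (by rw [hji, hji, hk])
    rwa [inv] at this
  have e1' : G.nbr 0 q ≠ p := fun h => e1 (by rw [← h, inv])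
  have e2' : G.nbr 0 (G.nbr i q) ≠ G.nbr i p := fun h => e2 (by rw [← h, inv])
  have e3' : G.nbr 0 (G.nbr i q) ≠ p := fun h => e3 (by rw [← h, inv])
  have e4' : G.nbr 0 q ≠ G.nbr i p := fun h => e4 (by rw [← h, inv])
  have ib := fun x y => G.mem_bubble_iff h x y
  have tad : ∀ x, ∀ y ∈ G.bubble x, G.nbr 0 y ∉ G.bubble x := fun x y hy =>
    h2.nbr_zero_notMem_bubble hV hy
  have hqp : ∀ m n, G.corner m p ≠ G.corner n q := by
    intro m n hmn
    have h1 : G.nbr j q ∈ G.bubble p := by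
      have h2 : ∀ n m : Fin 4, ∃ l, n ^^^ l = m := by decide
      obtain ⟨l, hl⟩ := h2 n j
      rw [← G.corner_of_ne h.2.1, ← hl, ← G.corner_corner, ← hmn, corner_corner]
      exact ⟨_, rfl⟩
    rw [← hj] at h1
    exact tad p _ ((ib p _).2 (by simp)) h1
  have hinj : Function.Injective fun z : Bool × Fin 4 => G.corner z.2 (if z.1 then q else p) := by
    rintro ⟨b, m⟩ ⟨b', m'⟩ he
    cases b <;> cases b' <;> simp at he
    · rw [G.corner_injective p he]
    · exact absurd he (hqp _ _)
    · exact absurd he.symm (hqp _ _)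
    · rw [G.corner_injective q he]
  have hqp' : ∀ y ∈ G.bubble p, ∀ z ∈ G.bubble q, y ≠ z := by
    rintro _ ⟨m, rfl⟩ _ ⟨n, rfl⟩; exact hqp m n
  have mem : ∀ x, x ∈ G.bubble x ∧ G.nbr i x ∈ G.bubble x ∧ G.nbr j x ∈ G.bubble x ∧
      G.nbr k x ∈ G.bubble x := fun x => by simp [ib]
  obtain ⟨mp, mip, mjp, mkp⟩ := mem p
  obtain ⟨mq, miq, mjq, mkq⟩ := mem q
  have cor : ∀ x, x ≠ G.nbr i x ∧ x ≠ G.nbr j x ∧ x ≠ G.nbr k x ∧ G.nbr i x ≠ G.nbr j x ∧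
      G.nbr i x ≠ G.nbr k x ∧ G.nbr j x ≠ G.nbr k x := fun x => by
    refine ⟨(G.nbr_ne _ _).symm, (G.nbr_ne _ _).symm, (G.nbr_ne _ _).symm, ?_, ?_, ?_⟩
    · rw [← hik, Ne, G.nbr_inj]; exact (G.nbr_ne _ _).symm
    · rw [← hij, Ne, G.nbr_inj]; exact (G.nbr_ne _ _).symm
    · rw [← hji, Ne, G.nbr_inj]; exact (G.nbr_ne _ _).symm
  obtain ⟨c1, c2, c3, c4, c5, c6⟩ := cor p
  obtain ⟨d1, d2, d3, d4, d5, d6⟩ := cor q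
  -- the four legs lead out of the dipole
  have out : ∀ y, (y = p ∨ y = G.nbr i p ∨ y = q ∨ y = G.nbr i q) →
      G.nbr 0 y ∉ G.bubble p ∧ G.nbr 0 y ∉ G.bubble q := by
    have hne : ∀ {y z}, G.nbr 0 z = y → ∀ t, t ≠ z → G.nbr 0 t ≠ y := fun hz t ht he =>
      ht ((G.nbr_inj 0).1 (he.trans hz.symm))
    rintro y (rfl | rfl | rfl | rfl)
    · refine ⟨tad _ _ mp, fun hm => ?_⟩
      rw [ib] at hm
      rcases hm with hm | hm | hm | hm
      exacts [e1 hm, e3 hm, hne hj _ c2 hm, hne hk _ c3 hm]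
    · refine ⟨tad _ _ mip, fun hm => ?_⟩
      rw [ib] at hm
      rcases hm with hm | hm | hm | hm
      exacts [e4 hm, e2 hm, hne hj _ c4 hm, hne hk _ c5 hm]
    · refine ⟨fun hm => ?_, tad _ _ mq⟩
      rw [ib] at hm
      rcases hm with hm | hm | hm | hm
      exacts [e1' hm, e4' hm, hne hj' _ d2 hm, hne hk' _ d3 hm]
    · refine ⟨fun hm => ?_, tad _ _ miq⟩
      rw [ib] at hm
      rcases hm with hm | hm | hm | hm
      exacts [e3' hm, e2' hm, hne hj' _ d4 hm, hne hk' _ d5 hm]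
  obtain ⟨op, op'⟩ := out p (by simp)
  obtain ⟨oip, oip'⟩ := out (G.nbr i p) (by simp)
  obtain ⟨oq, oq'⟩ := out q (by simp)
  obtain ⟨oiq, oiq'⟩ := out (G.nbr i q) (by simp)
  have nm : ∀ {y z} {S : Set V}, y ∉ S → z ∈ S → z ≠ y := fun h1 h2 h3 => h1 (h3 ▸ h2)
  -- The right legs are joined to each other, which turns the dipole into a melon inserted between
  -- the left legs.
  obtain ⟨G₁, hG₁⟩ : ∃ G₁, G₁ = G.switch (G.nbr i p) (G.nbr i q) := ⟨_, rfl⟩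
  have i0 := h.1
  have j0 := h.2.1
  have k0 := h.2.2.1
  have hne1 : G.nbr i q ≠ G.nbr i p := (hqp' _ mip _ miq).symm
  have hC : G₁.Connected := hG₁ ▸ hG.switch_of_isTwoPI h2 _ _
  have nj := G.numCycles_switch_of_sameCycle (x := G.nbr i p) (y := G.nbr i q) j0 (Ne.symm e2) (by
    refine (G.sameCycle_step j _).trans ?_
    rw [hji, hk]
    refine (G.sameCycle_step j _).trans ?_
    rw [hjk])
  have nk := G.numCycles_switch_of_sameCycle (x := G.nbr i p) (y := G.nbr i q) k0 (Ne.symm e2) (by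
    refine (G.sameCycle_step k _).trans ?_
    rw [hki, hj]
    refine (G.sameCycle_step k _).trans ?_
    rw [hkj])
  have ni := G.numCycles_le_switch (G.nbr i p) (G.nbr i q) i0
  rw [← hG₁] at nj nk ni
  have x1 := G.excess_eq h
  have x2 := G₁.excess_eq h
  have x3 : G₁.numBubbles = G.numBubbles := rfl
  have x4 := G₁.excess_nonneg
  rw [hG.numComp_eq] at x1
  rw [hC.numComp_eq] at x2
  -- Colours `j` and `k` gain a face each and colour `i` loses at most one, so the excess decreases
  -- by at least 2: it was 2 and becomes 0.
  refine ⟨by omega, ?_⟩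
  have z1 : G₁.nbr 0 p = G.nbr 0 p := by
    rw [hG₁]
    exact switch_nbr_of_ne _ c1 (nm oip mp) (hqp' _ mp _ miq) (nm oiq mp)
  have z2 : G₁.nbr 0 q = G.nbr 0 q := by
    rw [hG₁]
    exact switch_nbr_of_ne _ (hqp' _ mip _ mq).symm (nm oip' mq) d1 (nm oiq' mq)
  have z3 : ∀ y, y = G.nbr j p ∨ y = G.nbr k p ∨ y = G.nbr j q ∨ y = G.nbr k q →
      G₁.nbr 0 y = G.nbr 0 y := by
    rw [hG₁]
    rintro y (rfl | rfl | rfl | rfl)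
    · exact switch_nbr_of_ne _ c4.symm (nm oip mjp) (hqp' _ mjp _ miq) (nm oiq mjp)
    · exact switch_nbr_of_ne _ c5.symm (nm oip mkp) (hqp' _ mkp _ miq) (nm oiq mkp)
    · exact switch_nbr_of_ne _ (hqp' _ mip _ mjq).symm (nm oip' mjq) d4.symm (nm oiq' mjq)
    · exact switch_nbr_of_ne _ (hqp' _ mip _ mkq).symm (nm oip' mkq) d5.symm (nm oiq' mkq)
  have z4 : G₁.nbr 0 (G.nbr i p) = G.nbr i q := by rw [hG₁, switch_nbr_left _ hne1]
  have z5 : G₁.nbr 0 (G.nbr i q) = G.nbr i p := by rw [hG₁, switch_nbr_right _ hne1]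
  have hne2 : q ≠ p := (hqp' _ mp _ mq).symm
  -- Joining the left legs as well detaches a closed melon; the rest is `A`.
  obtain ⟨G₂, hG₂⟩ : ∃ G₂, G₂ = G₁.switch p q := ⟨_, rfl⟩
  have y1 : G₂.nbr 0 p = q := by rw [hG₂, switch_nbr_left _ hne2]
  have y2 : G₂.nbr 0 q = p := by rw [hG₂, switch_nbr_right _ hne2]
  have yp : ∀ y ∈ G.bubble p, y ≠ p → G₂.nbr 0 y = G₁.nbr 0 y := by
    intro y hy hyp
    rw [hG₂]
    exact switch_nbr_of_ne _ hyp (z1 ▸ nm op hy) (hqp' _ hy _ mq) (z2 ▸ nm oq hy)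
  have yq : ∀ y ∈ G.bubble q, y ≠ q → G₂.nbr 0 y = G₁.nbr 0 y := by
    intro y hy hyp
    rw [hG₂]
    exact switch_nbr_of_ne _ (hqp' _ mp _ hy).symm (z1 ▸ nm op' hy) hyp (z2 ▸ nm oq' hy)
  obtain ⟨hS, e, he, el, er⟩ := isIso_sum_of_embedding G₂ melon hinj (by
    rintro c ⟨b, m⟩
    by_cases hc : c = 0
    · subst hc
      rw [melon_nbr_zero]
      cases b <;> rcases h.cases m with rfl | rfl | rfl | rfl
      · simp [y1]
      · simp [corner_of_ne, i0, yp _ mip c1.symm, z4]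
      · simp [corner_of_ne, j0, yp _ mjp c2.symm, z3, hj]
      · simp [corner_of_ne, k0, yp _ mkp c3.symm, z3, hk]
      · simp [y2]
      · simp [corner_of_ne, i0, yq _ miq d1.symm, z5]
      · simp [corner_of_ne, j0, yq _ mjq d2.symm, z3, hj']
      · simp [corner_of_ne, k0, yq _ mkq d3.symm, z3, hk']
    · rw [melon_nbr hc, hG₂, hG₁, switch_nbr _ _ _ hc, switch_nbr _ _ _ hc, nbr_corner _ hc])
  have range : ∀ y, y ∉ G.bubble p → y ∉ G.bubble q → y ∈ (Set.range
      fun z : Bool × Fin 4 => G.corner z.2 (if z.1 then q else p))ᶜ := by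
    rintro _ hy hy' ⟨⟨_ | _, m⟩, rfl⟩
    · exact hy ⟨m, rfl⟩
    · exact hy' ⟨m, rfl⟩
  obtain ⟨A, hA⟩ : ∃ A, A = G₂.restrict _ hS := ⟨_, rfl⟩
  obtain ⟨w, hw⟩ : ∃ w : ((Set.range fun z : Bool × Fin 4 => G.corner z.2 (if z.1 then q else p))ᶜ :
    Set V), w = G.nbr 0 p := ⟨⟨_, range _ op op'⟩, rfl⟩
  obtain ⟨t, ht⟩ : ∃ w : ((Set.range fun z : Bool × Fin 4 => G.corner z.2 (if z.1 then q else p))ᶜ :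
    Set V), w = G.nbr 0 (G.nbr i p) := ⟨⟨_, range _ oip oip'⟩, rfl⟩
  rw [← hA] at he
  have sw1 : (A.conn w melon (false, 0)).IsIso G₁ e := by
    have := he.switch (Sum.inl w) (Sum.inr (false, 0))
    rw [el, er, hw] at this
    simp only [Bool.false_eq_true, if_false, corner_zero] at this
    rw [switch_symm G₂, hG₂, ← z1, switch_switch _ hne2] at this
    exact this
  have sw2 : ((A.conn w melon (false, 0)).switch (Sum.inl t) (Sum.inr (false, i))).IsIso G e := by
    have := sw1.switch (Sum.inl t) (Sum.inr (false, i))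
    rw [el, er, ht] at this
    simp only [Bool.false_eq_true, if_false, corner_of_ne _ i0] at this
    rwa [switch_symm G₁, hG₁, switch_switch _ hne1] at this
  have iso1 : (A.conn w melon (false, 0)).Isomorphic G₁ := ⟨e, sw1⟩
  have iso2 : ((A.conn w melon (false, 0)).switch (Sum.inl t) (Sum.inr (false, i))).Isomorphic G :=
    ⟨e, sw2⟩
  obtain ⟨cA, cM⟩ := Connected.of_conn (iso1.symm.connected hC)
  have y3 := cA.excess_conn cM w (false, 0)
  have y4 := iso1.excess_eq
  have y5 := A.excess_nonneg
  have y6 := melon.excess_nonneg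
  refine ⟨_, A, w, t, cA, by omega, ?_, ?_, iso2.symm⟩
  · intro htw
    rw [htw, hw, G.nbr_inj] at ht
    exact c1 ht
  · have n1 := iso1.numCycles_eq i
    have n2 := iso2.numCycles_eq i
    obtain ⟨K, hK⟩ : ∃ K, K = A.conn w melon (false, 0) := ⟨_, rfl⟩
    have hKr : K.nbr 0 (Sum.inr (false, i)) = Sum.inr (true, i) := by
      rw [hK, conn_nbr_zero_inr]; simp [i0]
    have hKr0 : K.nbr 0 (Sum.inr (true, 0)) = Sum.inl (A.nbr 0 w) := by
      rw [hK, conn_nbr_zero_inr]; simp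
    rw [← hK] at n1 n2
    have hne3 : Sum.inr (false, i) ≠ K.nbr 0 (Sum.inl t) := fun hh => by
      rw [hh, K.nbr_nbr] at hKr; simp at hKr
    -- Since the excess changed by exactly 2, undoing the first switch must create a face of colour
    -- `i`. This fixes both the common face and the relative direction of the two ends.
    have hs : (K.facePerm i).SameCycle (Sum.inl t) (Sum.inr (true, i)) := by
      by_cases hf : K.SameFace i (Sum.inl t) (Sum.inr (false, i))
      · rcases hf with hf | hf
        · have := K.numCycles_switch_of_sameCycle' i0 hne3 hf
          omega
        · rwa [hKr] at hf
      · have := K.numCycles_switch_of_not i0 hf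
        omega
    have hs2 := K.sameCycle_step i (Sum.inr (true, i))
    rw [show K.nbr i (Sum.inr (true, i)) = Sum.inr (true, 0) by
      rw [hK, conn_nbr_inr _ _ _ _ i0, melon_nbr i0]
      simp, hKr0] at hs2
    have hs3 := hs.trans hs2
    rw [hK] at hs3
    obtain ⟨y', hy', hs4⟩ := sameCycle_melonProj A w i0 hs3 rfl
    simp only [melonProj, Option.some.injEq] at hy'
    rw [← hy'] at hs4
    exact (A.sameCycle_nbr_zero_comm).1 hs4

end FeynmanGraph

namespace FeynmanGraph

open Equiv Equiv.Perm

/-! ### Algebra of connected sums -/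

theorem IsIso.sum {V V' W W' : Type*} {G : FeynmanGraph V} {G' : FeynmanGraph V'}
    {H : FeynmanGraph W} {H' : FeynmanGraph W'} {e : V ≃ V'} {f : W ≃ W'} (h : G.IsIso G' e)
    (h' : H.IsIso H' f) : (G.sum H).IsIso (G'.sum H') (Equiv.sumCongr e f) := by
  rintro c (x | x)
  · simp [sum_nbr_inl, h c x]
  · simp [sum_nbr_inr, h' c x]

theorem IsIso.conn {V V' W W' : Type*} {G : FeynmanGraph V} {G' : FeynmanGraph V'}
    {H : FeynmanGraph W} {H' : FeynmanGraph W'} {e : V ≃ V'} {f : W ≃ W'} (h : G.IsIso G' e)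
    (h' : H.IsIso H' f) (x : V) (y : W) :
    (G.conn x H y).IsIso (G'.conn (e x) H' (f y)) (Equiv.sumCongr e f) :=
  (h.sum h').switch (Sum.inl x) (Sum.inr y)

theorem isIso_refl {V : Type*} (G : FeynmanGraph V) : G.IsIso G (Equiv.refl V) := fun _ _ => rfl

theorem isIso_conn_comm {V W : Type*} (G : FeynmanGraph V) (x : V) (H : FeynmanGraph W) (y : W) :
    (G.conn x H y).IsIso (H.conn y G x) (Equiv.sumComm V W) := by
  have h : (G.sum H).IsIso (H.sum G) (Equiv.sumComm V W) := by
    rintro c (x | x) <;> rfl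
  have := h.switch (Sum.inl x) (Sum.inr y)
  rw [switch_symm (H.sum G)] at this
  exact this

theorem switch_sum {V W : Type*} (G : FeynmanGraph V) (H : FeynmanGraph W) (x y : V) :
    (G.switch x y).sum H = (G.sum H).switch (Sum.inl x) (Sum.inl y) := by
  classical
  by_cases hxy : y = x
  · rw [hxy, switch_self, switch_self]
  have hxy' : (Sum.inl y : V ⊕ W) ≠ Sum.inl x := by simpa using hxy
  apply ext_nbr
  intro c z
  by_cases hc : c = 0
  · subst hc
    rw [switch_nbr_zero _ hxy']
    rcases z with z | z
    · simp only [sum_nbr_inl, switch_nbr_zero _ hxy, Sum.inl.injEq]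
      split_ifs <;> rfl
    · simp [sum_nbr_inl, sum_nbr_inr]
  · rw [switch_nbr _ _ _ hc]
    rcases z with z | z
    · simp [sum_nbr_inl, switch_nbr _ _ _ hc]
    · simp [sum_nbr_inr]

theorem sum_switch {V W : Type*} (G : FeynmanGraph V) (H : FeynmanGraph W) (x y : W) :
    G.sum (H.switch x y) = (G.sum H).switch (Sum.inr x) (Sum.inr y) := by
  classical
  by_cases hxy : y = x
  · rw [hxy, switch_self, switch_self]
  have hxy' : (Sum.inr y : V ⊕ W) ≠ Sum.inr x := by simpa using hxy
  apply ext_nbr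
  intro c z
  by_cases hc : c = 0
  · subst hc
    rw [switch_nbr_zero _ hxy']
    rcases z with z | z
    · simp [sum_nbr_inl, sum_nbr_inr]
    · simp only [sum_nbr_inr, switch_nbr_zero _ hxy, Sum.inr.injEq]
      split_ifs <;> rfl
  · rw [switch_nbr _ _ _ hc]
    rcases z with z | z
    · simp [sum_nbr_inl]
    · simp [sum_nbr_inr, switch_nbr _ _ _ hc]

theorem isIso_sum_assoc {U V W : Type*} (G : FeynmanGraph U) (H : FeynmanGraph V)
    (K : FeynmanGraph W) :
    ((G.sum H).sum K).IsIso (G.sum (H.sum K)) (Equiv.sumAssoc U V W) := by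
  rintro c ((x | x) | x) <;> rfl

/-- The two switches commute when they cut different propagators of `H`. When `z` is the other end
of the propagator at `y`, both cut the same one and `switch_switch_comm` takes over. -/
theorem isIso_conn_assoc {U V W : Type*} (G : FeynmanGraph U) (x : U) (H : FeynmanGraph V) {y z : V}
    (hz : z ≠ y) (K : FeynmanGraph W) (t : W) :
    ((G.conn x H y).conn (Sum.inr z) K t).IsIso (G.conn x (H.conn z K t) (Sum.inl y))
      (Equiv.sumAssoc U V W) := by
  have h1 := ((isIso_sum_assoc G H K).switch (Sum.inl (Sum.inl x)) (Sum.inl (Sum.inr y))).switch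
    (Sum.inl (Sum.inr z)) (Sum.inr t)
  have h2 : (G.conn x H y).conn (Sum.inr z) K t = (((G.sum H).sum K).switch (Sum.inl (Sum.inl x))
    (Sum.inl (Sum.inr y))).switch (Sum.inl (Sum.inr z)) (Sum.inr t) := by
    rw [conn, conn, switch_sum]
  have h3 : G.conn x (H.conn z K t) (Sum.inl y) = ((G.sum (H.sum K)).switch (Sum.inr (Sum.inl z))
    (Sum.inr (Sum.inr t))).switch (Sum.inl x) (Sum.inr (Sum.inl y)) := by
    rw [conn, conn, sum_switch]
  rw [h2, h3]
  convert h1 using 1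
  simp only [Equiv.sumAssoc_apply_inl_inl, Equiv.sumAssoc_apply_inl_inr, Equiv.sumAssoc_apply_inr]
  by_cases hz' : z = H.nbr 0 y
  · subst hz'
    have := switch_switch_comm (G.sum (H.sum K)) (x := Sum.inr (Sum.inl y))
      (y := Sum.inr (Sum.inr (K.nbr 0 t))) (z := Sum.inl x) (by simp)
      (by simp [sum_nbr_inr, sum_nbr_inl]) (by simp) (by simp [sum_nbr_inr]) (by simp)
      (by simp [sum_nbr_inr])
    have e1 := (G.sum (H.sum K)).switch_nbr_nbr (Sum.inr (Sum.inl y))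
      (Sum.inr (Sum.inr (K.nbr 0 t)))
    simp only [sum_nbr_inr, sum_nbr_inl, K.nbr_nbr] at e1 this
    rw [e1, switch_symm _ (Sum.inl x), this, switch_symm _ (Sum.inl x)]
  · refine switch_comm _ ?_ ?_ ?_ ?_ ?_ ?_ ?_ ?_ <;>
      simp [sum_nbr_inl, sum_nbr_inr, Ne.symm hz]
    intro h
    exact hz' (by rw [h, H.nbr_nbr])

/-! ### Melonic insertions as connected sums -/

theorem melonInsert_eq_conn {V : Type u} (G : FeynmanGraph V) (x : V) :
    G.melonInsert x = G.conn x melon (false, 0) := by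
  classical
  apply ext_nbr
  intro c z
  by_cases hc : c = 0
  · subst hc
    rcases z with z | ⟨b, k⟩
    · rw [conn_nbr_zero_inl]
      simp [melonInsert, melonNbr]
    · rw [conn_nbr_zero_inr]
      by_cases hk : k = 0
      · subst hk; cases b <;> simp [melonInsert, melonNbr]
      · simp [melonInsert, melonNbr, hk]
  · rcases z with z | ⟨b, k⟩
    · rw [conn_nbr_inl _ _ _ _ hc]
      simp [melonInsert, melonNbr, hc]
    · rw [conn_nbr_inr _ _ _ _ hc, melon_nbr hc]
      simp [melonInsert, melonNbr, hc]

/-- The translations of the melon. -/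
def melonShift (p : Bool × Fin 4) : Bool × Fin 4 ≃ Bool × Fin 4 where
  toFun q := (xor q.1 p.1, q.2 ^^^ p.2)
  invFun q := (xor q.1 p.1, q.2 ^^^ p.2)
  left_inv := by revert p; decide
  right_inv := by revert p; decide

theorem isIso_melonShift (p : Bool × Fin 4) : melon.IsIso melon (melonShift p) := by
  have h0 : ∀ (p : Bool × Fin 4) (b : Bool) (k : Fin 4),
      melonShift p (!b, k) = (!(melonShift p (b, k)).1, (melonShift p (b, k)).2) := by decide
  have h1 : ∀ (p : Bool × Fin 4) (b : Bool) (k c : Fin 4),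
      melonShift p (b, k ^^^ c) = ((melonShift p (b, k)).1, (melonShift p (b, k)).2 ^^^ c) := by decide
  rintro c ⟨b, k⟩
  by_cases hc : c = 0
  · subst hc
    rw [melon_nbr_zero, h0]; rfl
  · rw [melon_nbr hc, h1]
    exact (melon_nbr hc _ _).symm

theorem melonShift_zero (p : Bool × Fin 4) : melonShift p (false, 0) = p := by
  revert p; decide

/-- The translations act transitively on the eight corners of the melon, so it does not matter which
of its propagators is opened. -/
theorem conn_melon_isomorphic {V : Type u} (G : FeynmanGraph V) (x : V) (p : Bool × Fin 4) :
    (G.conn x melon p).Isomorphic (G.melonInsert x) := by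
  have := (G.isIso_refl).conn (isIso_melonShift p) x (false, 0)
  rw [melonShift_zero, ← melonInsert_eq_conn] at this
  exact Isomorphic.symm ⟨_, this⟩

/-! ### Decorations -/

theorem IsMelonicDecoration.of_isomorphic {W : Type v} {C : FeynmanGraph W} {V V' : Type u}
    {G : FeynmanGraph V} {G' : FeynmanGraph V'} (hG : IsMelonicDecoration C G)
    (h : G'.Isomorphic G) : IsMelonicDecoration C G' := by
  cases hG with
  | core _ h' => exact .core _ (h.trans h')
  | insert H x _ hH h' => exact .insert H x _ hH (h.trans h')

theorem IsMelonicDecoration.core_isomorphic {W : Type v} {C : FeynmanGraph W} {W' : Type w}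
    {C' : FeynmanGraph W'} (h : C.Isomorphic C') {V : Type u}
    {G : FeynmanGraph V} (hG : IsMelonicDecoration C G) : IsMelonicDecoration C' G := by
  induction hG with
  | core _ h' => exact .core _ (h'.trans h)
  | insert H x _ _ h' ih => exact .insert H x _ ih h'

theorem IsMelonicDecoration.conn_melon {W : Type v} {C : FeynmanGraph W} {V : Type u}
    {G : FeynmanGraph V} (hG : IsMelonicDecoration C G) (x : V) (p : Bool × Fin 4) :
    IsMelonicDecoration C (G.conn x melon p) :=
  .insert G x _ hG (G.conn_melon_isomorphic x p)

/-- A class of graphs closed under melonic insertions contains the connected sums with the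
decorations of a graph if it contains those with this graph. -/
theorem IsMelonicDecoration.conn_induction {W : Type v} {C : FeynmanGraph W} {U V : Type u}
    {P Q : ∀ {V : Type u}, FeynmanGraph V → Prop}
    (hP : ∀ {V : Type u} (G : FeynmanGraph V) x p, P G → P (G.conn x melon p))
    (hQ : ∀ {V : Type u} (G : FeynmanGraph V) x p, Q G → Q (G.conn x melon p))
    (hQ' : ∀ {V V' : Type u} (G : FeynmanGraph V) (G' : FeynmanGraph V'), G'.Isomorphic G → Q G → Q G')
    (h : ∀ {V V' : Type u} (G : FeynmanGraph V) (H : FeynmanGraph V') x y, P G → H.Isomorphic C →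
      Q (G.conn x H y))
    {H : FeynmanGraph V} (hH : IsMelonicDecoration C H) {G : FeynmanGraph U}
    (hG : P G) (x : U) (y : V) : Q (G.conn x H y) := by
  induction hH generalizing U with
  | core H h' => exact h G H x y hG h'
  | @insert V V' H z H' _ h ih =>
    rw [melonInsert_eq_conn] at h
    obtain ⟨e, he⟩ := h
    refine hQ' _ _ ⟨_, (G.isIso_refl).conn he x y⟩ ?_
    generalize e y = t
    -- If the cut propagator is a corner of `H`, the last melon can be inserted after the connected
    -- sum. If it is a corner of the melon, that melon is transferred to `G`. Either way the
    -- decoration of `H` has one melon less.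
    rcases t with t | t
    · obtain ⟨z', m, hm, hne⟩ : ∃ z' m, H.conn z melon (false, 0) = H.conn z' melon m ∧ z' ≠ t := by
        by_cases hzt : z = t
        · refine ⟨H.nbr 0 z, _, (conn_nbr_nbr _ _ _ _).symm, ?_⟩
          rw [hzt]; exact H.nbr_ne 0 t
        · exact ⟨z, _, rfl, hzt⟩
      rw [hm]
      exact hQ' _ _ (Isomorphic.symm ⟨_, isIso_conn_assoc G x H hne melon m⟩)
        (hQ _ (Sum.inr z') m (ih hG x t))
    · have h1 := (G.isIso_refl).conn (isIso_conn_comm H z melon (false, 0)) x (Sum.inr t)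
      refine hQ' _ _ ⟨_, h1⟩ ?_
      obtain ⟨z', m, hm, hne⟩ : ∃ z' m, melon.conn (false, 0) H z = melon.conn m H z' ∧ m ≠ t := by
        by_cases hzt : (false, 0) = t
        · refine ⟨H.nbr 0 z, melon.nbr 0 (false, 0), (conn_nbr_nbr _ _ _ _).symm, ?_⟩
          rw [hzt]; exact melon.nbr_ne 0 t
        · exact ⟨z, _, rfl, hzt⟩
      rw [hm]
      exact hQ' _ _ (Isomorphic.symm ⟨_, isIso_conn_assoc G x melon hne H z'⟩)
        (ih (hP G x t hG) (Sum.inr m) z')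

/-- Inserting a melonic graph on a propagator is a decoration. -/
theorem IsMelonicDecoration.conn {W : Type v} {C : FeynmanGraph W} {U V : Type u}
    {H : FeynmanGraph V} (hH : IsMelonicDecoration melon H) {G : FeynmanGraph U}
    (hG : IsMelonicDecoration C G) (x : U) (y : V) : IsMelonicDecoration C (G.conn x H y) :=
  hH.conn_induction (P := IsMelonicDecoration C) (Q := IsMelonicDecoration C)
    (fun _ x p hG => hG.conn_melon x p) (fun _ x p hG => hG.conn_melon x p)
    (fun _ _ h hG => hG.of_isomorphic h)
    (fun G _ x y hG ⟨e, he⟩ =>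
      (hG.conn_melon x (e y)).of_isomorphic ⟨_, (G.isIso_refl).conn he x y⟩) hG x y

theorem IsMelonicDecoration.conn_left {W : Type v} {C : FeynmanGraph W} {U V : Type u}
    {H : FeynmanGraph V} (hH : IsMelonicDecoration melon H) {G : FeynmanGraph U}
    (hG : IsMelonicDecoration C G) (x : U) (y : V) : IsMelonicDecoration C (H.conn y G x) :=
  (hH.conn hG x y).of_isomorphic ⟨_, isIso_conn_comm H y G x⟩

/-! ### Elementary graphs -/

theorem card_le_mul_numOrbits {V : Type u} [Finite V] (f : Perm V) {L : ℕ} (hL : 0 < L)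
    (h : ∀ x, (f ^ L) x = x) : Nat.card V ≤ L * f.numOrbits :=
  card_le_mul_card_quotient _ L fun x => ncard_cycle_le f x hL (h x)

theorem card_le_mul_numCycles {V : Type u} [Finite V] (G : FeynmanGraph V) {c : Fin 4} {L : ℕ}
    (hL : 0 < L) (h : ∀ x, (G.facePerm c ^ L) x = x) : Nat.card V ≤ L * (2 * G.numCycles 0 c) := by
  rw [two_mul_numCycles]
  exact card_le_mul_numOrbits _ hL h

theorem doubleTadpole_involutive (i : Fin 3) (x : Unit × Fin 4) :
    (x.1, x.2 ^^^ i.succ ^^^ i.succ) = x := by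
  revert i x; decide

theorem doubleTadpole_ne (i : Fin 3) (x : Unit × Fin 4) : (x.1, x.2 ^^^ i.succ) ≠ x := by
  revert i x; decide

/-- The graphs with one bubble. -/
def doubleTadpole (i : Fin 3) : FeynmanGraph (Unit × Fin 4) :=
  ofPropagator (fun z => (z.1, z.2 ^^^ i.succ)) (doubleTadpole_involutive i) (doubleTadpole_ne i)

theorem ofPropagator_nbr {B : Type u} {p : B × Fin 4 → B × Fin 4} (hp : ∀ x, p (p x) = x)
    (hne : ∀ x, p x ≠ x) {c : Fin 4} (hc : c ≠ 0) (b : B) (k : Fin 4) :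
    (ofPropagator p hp hne).nbr c (b, k) = (b, k ^^^ c) := by simp [ofPropagator, hc]

theorem ofPropagator_mem {B : Type u} {p : B × Fin 4 → B × Fin 4} (hp : ∀ x, p (p x) = x)
    (hne : ∀ x, p x ≠ x) {S : Set (B × Fin 4)} (hS : (ofPropagator p hp hne).IsClosed S) (b : B)
    (k l : Fin 4) : (b, k) ∈ S ↔ (b, l) ∈ S := by
  have h : ∀ k l : Fin 4, k = l ∨ ∃ c, c ≠ 0 ∧ k ^^^ c = l := by decide
  rcases h k l with rfl | ⟨c, hc, rfl⟩
  · rfl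
  · rw [← ofPropagator_nbr hp hne hc, hS.mem_iff]

/-- A graph is connected if its bubbles are. -/
theorem ofPropagator_connected {B : Type u} {p : B × Fin 4 → B × Fin 4} (hp : ∀ x, p (p x) = x)
    (hne : ∀ x, p x ≠ x) (b₀ : B)
    (h : ∀ T : Set B, (∀ b ∈ T, ∀ k, (p (b, k)).1 ∈ T) → T.Nonempty → b₀ ∈ T) :
    (ofPropagator p hp hne).Connected := by
  have key : ∀ S, (ofPropagator p hp hne).IsClosed S → S.Nonempty → (b₀, 0) ∈ S := by
    rintro S hS ⟨⟨b, k⟩, hk⟩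
    refine h {b | (b, 0) ∈ S} ?_ ⟨b, (ofPropagator_mem hp hne hS b k 0).1 hk⟩
    intro b hb k
    have h1 := hS 0 _ ((ofPropagator_mem hp hne hS b 0 k).1 hb)
    exact (ofPropagator_mem hp hne hS _ _ 0).1 h1
  rw [connected_iff]
  refine ⟨⟨(b₀, 0)⟩, fun S hS hn => ?_⟩
  by_contra hcon
  exact (key Sᶜ hS.compl (Set.nonempty_compl.2 hcon)) (key S hS hn)

theorem melon_connected : melon.Connected := by
  refine ofPropagator_connected _ _ false ?_
  rintro T hT ⟨b, hb⟩
  cases b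
  · exact hb
  · exact hT true hb 0

theorem doubleTadpole_connected (i : Fin 3) : (doubleTadpole i).Connected :=
  ofPropagator_connected _ _ () fun _ _ h => by
    obtain ⟨⟨⟩, hb⟩ := h
    exact hb

/-- Cycles of length at most 2 give at least two faces of each colour, which is already the maximum
allowed by `excess_nonneg`. -/
theorem melon_excess : melon.excess = 0 := by
  have h0 := melon.excess_nonneg
  have hE := melon.excess_eq (i := 1) (j := 2) (k := 3) (by decide)
  rw [melon_connected.numComp_eq] at hE
  have hB := melon.four_mul_numBubbles
  have h2 : ∀ c : Fin 4, c ≠ 0 → Nat.card (Bool × Fin 4) ≤ 2 * (2 * melon.numCycles 0 c) := by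
    intro c hc
    refine melon.card_le_mul_numCycles (by norm_num) fun x => ?_
    rw [pow_two]
    revert x c
    show ∀ c : Fin 4, c ≠ 0 → ∀ x, melon.nbr c (melon.nbr 0 (melon.nbr c (melon.nbr 0 x))) = x
    decide
  have h3 := h2 1 (by decide)
  have h4 := h2 2 (by decide)
  have h5 := h2 3 (by decide)
  simp only [Nat.card_eq_fintype_card, Fintype.card_prod, Fintype.card_bool, Fintype.card_fin]
    at hB h3 h4 h5
  omega

/-- Two faces of colour `i.succ` and at least one of each other colour give excess at most 1; it is
nonnegative and odd. -/
theorem doubleTadpole_excess (i : Fin 3) : (doubleTadpole i).excess = 1 := by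
  have h0 := (doubleTadpole i).excess_nonneg
  have T : ∀ i : Fin 3, Triple i.succ (i + 1).succ (i + 2).succ := by decide
  have hE := (doubleTadpole i).excess_eq (T i)
  rw [(doubleTadpole_connected i).numComp_eq] at hE
  have hB := (doubleTadpole i).four_mul_numBubbles
  have h1 := (doubleTadpole i).card_le_mul_numCycles (c := i.succ) (L := 1) (by norm_num) (by
    clear h0 hE hB
    revert i
    simp only [pow_one]
    show ∀ i : Fin 3, ∀ x, (doubleTadpole i).nbr i.succ ((doubleTadpole i).nbr 0 x) = x
    decide)
  have h2 : ∀ c : Fin 4, c ≠ 0 → Nat.card (Unit × Fin 4) ≤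
      2 * (2 * (doubleTadpole i).numCycles 0 c) := by
    intro c hc
    refine (doubleTadpole i).card_le_mul_numCycles (by norm_num) fun x => ?_
    rw [pow_two]
    clear h0 hE hB h1
    revert x c i
    show ∀ i : Fin 3, ∀ c : Fin 4, c ≠ 0 → ∀ x, (doubleTadpole i).nbr c ((doubleTadpole i).nbr 0
      ((doubleTadpole i).nbr c ((doubleTadpole i).nbr 0 x))) = x
    decide
  have h4 := h2 (i + 1).succ (Fin.succ_ne_zero _)
  have h5 := h2 (i + 2).succ (Fin.succ_ne_zero _)
  simp only [Nat.card_eq_fintype_card, Fintype.card_prod, Fintype.card_unit, Fintype.card_fin]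
    at hB h1 h4 h5
  omega

theorem Connected.isomorphic_doubleTadpole {V : Type u} [Finite V] {G : FeynmanGraph V}
    (hG : G.Connected) (hB : G.numBubbles = 1) : ∃ i, G.Isomorphic (doubleTadpole i) := by
  obtain ⟨x⟩ := hG.1
  have hV := G.four_mul_numBubbles
  have huniv : G.bubble x = Set.univ := by
    refine Set.eq_of_subset_of_ncard_le (Set.subset_univ _) ?_ (Set.toFinite _)
    rw [Set.ncard_univ, ncard_bubble]; omega
  have hmem : ∀ z, ∃ m, G.corner m x = z := fun z => by
    have : z ∈ G.bubble x := huniv ▸ Set.mem_univ z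
    exact this
  obtain ⟨m, hm⟩ := hmem (G.nbr 0 x)
  have hm0 : m ≠ 0 := by
    rintro rfl
    exact G.nbr_ne 0 x hm.symm
  obtain ⟨i, rfl⟩ := Fin.exists_succ_eq.2 hm0
  refine ⟨i, ?_⟩
  obtain ⟨d, e, h⟩ := exists_triple_left hm0
  rw [corner_of_ne _ hm0] at hm
  have inv := G.nbr_nbr 0
  have h0' : G.nbr 0 (G.nbr i.succ x) = x := by rw [hm, inv]
  have hd : G.nbr 0 (G.nbr d x) = G.nbr e x := by
    have : G.nbr 0 (G.nbr d x) ∈ G.bubble x := huniv ▸ Set.mem_univ _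
    rw [G.mem_bubble_iff h] at this
    rcases this with h1 | h1 | h1 | h1
    · have h2 : G.nbr d x = G.nbr i.succ x := by
        have := congrArg (G.nbr 0) h1
        rwa [inv, ← hm] at this
      rw [← h.swap.mul G, G.nbr_inj] at h2
      exact absurd h2 (G.nbr_ne _ _)
    · rw [hm, G.nbr_inj] at h1
      exact absurd h1 (G.nbr_ne _ _)
    · exact absurd h1 (G.nbr_ne _ _)
    · exact h1
  have he : G.nbr 0 (G.nbr e x) = G.nbr d x := by rw [← hd, inv]
  obtain ⟨f, hf, -⟩ := hG.exists_isIso_of_base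
    (p := fun z : Unit × Fin 4 => (z.1, z.2 ^^^ i.succ)) (doubleTadpole_involutive i)
    (doubleTadpole_ne i) (fun _ => x) (by
      have H : ∀ i d e : Fin 4, Triple i d e → 0 ^^^ i = i ∧ i ^^^ i = 0 ∧ d ^^^ i = e ∧
        e ^^^ i = d ∧ d ≠ 0 ∧ e ≠ 0 := by decide
      obtain ⟨x1, x2, x3, x4, x5, x6⟩ := H _ _ _ h
      rintro ⟨⟩ m
      rcases h.cases m with rfl | rfl | rfl | rfl
      · simp only [x1, corner_zero, corner_of_ne _ hm0, hm]
      · simp only [x2, corner_zero, corner_of_ne _ hm0, h0']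
      · simp only [x3, corner_of_ne _ x5, corner_of_ne _ x6, hd]
      · simp only [x4, corner_of_ne _ x5, corner_of_ne _ x6, he]) (by simp [hB])
  exact Isomorphic.symm ⟨f, hf⟩

/-! ### Graphs of degree zero and one half -/

theorem exists_smaller_summands {V : Type u} [Finite V] {G : FeynmanGraph V} (hG : G.Connected)
    (h2 : ¬ G.IsTwoPI) : ∃ (V₁ V₂ : Type u) (H : FeynmanGraph V₁) (K : FeynmanGraph V₂)
      (x : V₁) (y : V₂), Finite V₁ ∧ Finite V₂ ∧ H.Connected ∧ K.Connected ∧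
        Nat.card V₁ < Nat.card V ∧ Nat.card V₂ < Nat.card V ∧ H.excess + K.excess = G.excess ∧
        G.Isomorphic (H.conn x K y) := by
  obtain ⟨S, H, K, x, y, hH, hK, h⟩ := hG.exists_conn_of_not_isTwoPI h2
  obtain ⟨e, -⟩ := id h
  have hc := Nat.card_congr e
  rw [Nat.card_sum] at hc
  have := hH.1
  have := hK.1
  have h3 := Nat.card_pos (α := S)
  have h4 := Nat.card_pos (α := (Sᶜ : Set V))
  refine ⟨_, _, H, K, x, y, inferInstance, inferInstance, hH, hK, by omega, by omega, ?_, h⟩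
  rw [h.excess_eq, hH.excess_conn hK]

/-- The other 2PI graphs of small degree, without dipole or with a dipole that is not part of the
melon, have excess exactly 2. -/
theorem Connected.isomorphic_melon_of_excess_le {V : Type u} [Finite V] {G : FeynmanGraph V}
    (hG : G.Connected) (h2 : G.IsTwoPI) (hV : 1 < G.numBubbles) (hex : G.excess ≤ 1) :
    G.Isomorphic melon := by
  by_cases hd : G.IsDipoleFree
  · have := (hG.isomorphic_octahedron_of_isDipoleFree h2 hV (by omega) hd).1
    omega
  · simp only [IsDipoleFree, not_forall, not_not] at hd
    obtain ⟨i, x, hd⟩ := hd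
    rcases hG.exists_switch_of_dipole h2 hV (by omega) hd with h | ⟨h, -⟩
    · exact h
    · omega

theorem Connected.numBubbles_cases {V : Type u} [Finite V] {G : FeynmanGraph V}
    (hG : G.Connected) : (∃ i, G.Isomorphic (doubleTadpole i)) ∨ 1 < G.numBubbles := by
  have := hG.1
  have := G.numBubbles_pos
  by_cases h : G.numBubbles = 1
  · exact Or.inl (hG.isomorphic_doubleTadpole h)
  · right; omega

/-- The graphs of degree zero are the melonic ones. -/
theorem Connected.isMelonicDecoration_melon {V : Type u} [Finite V] {G : FeynmanGraph V}
    (hG : G.Connected) (hex : G.excess = 0) : IsMelonicDecoration melon G := by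
  induction hn : Nat.card V using Nat.strong_induction_on generalizing V with
  | _ n ih =>
    rcases hG.numBubbles_cases with ⟨i, h⟩ | hV
    · have := h.excess_eq
      rw [doubleTadpole_excess] at this
      omega
    by_cases h2 : G.IsTwoPI
    · exact .core _ (hG.isomorphic_melon_of_excess_le h2 hV (by omega))
    · obtain ⟨V₁, V₂, H, K, x, y, f₁, f₂, hH, hK, c₁, c₂, hs, h⟩ := exists_smaller_summands hG h2
      have h3 := H.excess_nonneg
      have h4 := K.excess_nonneg
      exact ((ih _ (hn ▸ c₂) hK (by omega) rfl).conn (ih _ (hn ▸ c₁) hH (by omega) rfl) x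
        y).of_isomorphic h

/-- The graphs of degree one half. -/
theorem Connected.isMelonicDecoration_doubleTadpole {V : Type u} [Finite V] {G : FeynmanGraph V}
    (hG : G.Connected) (hex : G.excess = 1) : ∃ i, IsMelonicDecoration (doubleTadpole i) G := by
  induction hn : Nat.card V using Nat.strong_induction_on generalizing V with
  | _ n ih =>
    rcases hG.numBubbles_cases with ⟨i, h⟩ | hV
    · exact ⟨i, .core _ h⟩
    by_cases h2 : G.IsTwoPI
    · have := (hG.isomorphic_melon_of_excess_le h2 hV (by omega)).excess_eq
      rw [melon_excess] at this
      omega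
    · obtain ⟨V₁, V₂, H, K, x, y, f₁, f₂, hH, hK, c₁, c₂, hs, h⟩ := exists_smaller_summands hG h2
      have h3 := H.excess_nonneg
      have h4 := K.excess_nonneg
      -- An excess of 1 splits only as `0 + 1` or `1 + 0`, and the summand of excess 0 is a melonic
      -- decoration of the other.
      by_cases h5 : H.excess = 0
      · obtain ⟨i, hi⟩ := ih _ (hn ▸ c₂) hK (by omega) rfl
        exact ⟨i, ((hH.isMelonicDecoration_melon h5).conn_left hi y x).of_isomorphic h⟩
      · obtain ⟨i, hi⟩ := ih _ (hn ▸ c₁) hH (by omega) rfl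
        exact ⟨i, ((hK.isMelonicDecoration_melon (by omega)).conn hi x y).of_isomorphic h⟩

end FeynmanGraph

namespace FeynmanGraph

open Equiv Equiv.Perm

/-! ### Chains of dipoles -/

theorem Connected.corner_bijective {V : Type u} {B : Type v} [Finite V] {G : FeynmanGraph V}
    (hG : G.Connected) (b : B → V) [Nonempty B] [Finite B]
    (h : ∀ a m, ∃ a' m', G.nbr 0 (G.corner m (b a)) = G.corner m' (b a'))
    (hcard : Nat.card B ≤ G.numBubbles) :
    Function.Bijective fun z : B × Fin 4 => G.corner z.2 (b z.1) := by
  have hsurj : Function.Surjective fun z : B × Fin 4 => G.corner z.2 (b z.1) := by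
    obtain ⟨a⟩ := ‹Nonempty B›
    have : Set.range (fun z : B × Fin 4 => G.corner z.2 (b z.1)) = Set.univ := by
      refine hG.eq_univ (x := b a) ?_ ⟨(a, 0), rfl⟩
      rintro c _ ⟨⟨a, m⟩, rfl⟩
      by_cases hc : c = 0
      · subst hc
        obtain ⟨a', m', h'⟩ := h a m
        exact ⟨(a', m'), h'.symm⟩
      · exact ⟨(a, m ^^^ c), (nbr_corner _ hc _ _).symm⟩
    exact Set.range_eq_univ.1 this
  have hc : Nat.card (B × Fin 4) = Nat.card V := by
    refine le_antisymm ?_ (Nat.card_le_card_of_surjective _ hsurj)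
    rw [Nat.card_prod, Nat.card_fin, ← G.four_mul_numBubbles]
    omega
  exact (Nat.bijective_iff_surjective_and_card _).2 ⟨hsurj, hc⟩

/-- The sequence `a, f 0, f 1, …`. -/
def seqCons {α : Type u} (a : α) (f : ℕ → α) : ℕ → α
  | 0 => a
  | t + 1 => f t

@[simp]
theorem seqCons_zero {α : Type u} (a : α) (f : ℕ → α) : seqCons a f 0 = a := rfl

@[simp]
theorem seqCons_succ {α : Type u} (a : α) (f : ℕ → α) (t : ℕ) : seqCons a f (t + 1) = f t := rfl

theorem seqCons_const {α : Type u} (a : α) : seqCons a (fun _ => a) = fun _ => a := by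
  funext t; cases t <;> rfl

/-- The graph is a chain of `m + 1` dipoles of colours `j 0, …, j m`, whose two left legs are joined
together, as well as its two right legs. The corner `0` of each bubble is given by `D`, and `l`, `r`
are the top left and top right legs. -/
structure IsChain {W : Type u} (K : FeynmanGraph W) (m : ℕ) (j : ℕ → Fin 4) (D : ℕ → Bool → W)
    (l r : W) : Prop where
  connected : K.Connected
  numBubbles_eq : K.numBubbles = 2 * (m + 1)
  color_ne : ∀ t, j t ≠ 0
  inner : ∀ t ≤ m, ∀ s k, k ≠ 0 → k ≠ j t → K.nbr 0 (K.nbr k (D t s)) = K.nbr k (D t !s)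
  link : ∀ t < m, ∀ s, K.nbr 0 (K.nbr (j t) (D t s)) = D (t + 1) s
  left : K.nbr 0 (D 0 false) = D 0 true
  right : K.nbr 0 (K.nbr (j m) (D m false)) = K.nbr (j m) (D m true)
  left_eq : D 0 false = l
  right_eq : K.nbr (j m) (D m false) = r

namespace IsChain

variable {W : Type u} {K : FeynmanGraph W} {m : ℕ} {j : ℕ → Fin 4} {D : ℕ → Bool → W} {l r : W}

theorem left' (h : IsChain K m j D l r) (s : Bool) : K.nbr 0 (D 0 s) = D 0 !s := by
  cases s
  · exact h.left
  · rw [← h.left, K.nbr_nbr]; rfl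

theorem right' (h : IsChain K m j D l r) (s : Bool) :
    K.nbr 0 (K.nbr (j m) (D m s)) = K.nbr (j m) (D m !s) := by
  cases s
  · exact h.right
  · rw [← h.right, K.nbr_nbr]; rfl

theorem link' (h : IsChain K m j D l r) {t : ℕ} (ht : t < m) (s : Bool) :
    K.nbr 0 (D (t + 1) s) = K.nbr (j t) (D t s) := by
  rw [← h.link t ht, K.nbr_nbr]

theorem nbr_left (h : IsChain K m j D l r) : K.nbr 0 l = D 0 true := by
  rw [← h.left_eq, h.left]

theorem nbr_right (h : IsChain K m j D l r) : K.nbr 0 r = K.nbr (j m) (D m true) := by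
  rw [← h.right_eq, h.right]

theorem corner_bijective [Finite W] (h : IsChain K m j D l r) : Function.Bijective
    fun z : (Fin (m + 1) × Bool) × Fin 4 => K.corner z.2 (D z.1.1 z.1.2) := by
  refine h.connected.corner_bijective (fun a : Fin (m + 1) × Bool => D a.1 a.2) ?_
    (by rw [h.numBubbles_eq]; simp; omega)
  rintro ⟨⟨t, ht⟩, s⟩ k
  by_cases k0 : k = 0
  · subst k0
    rcases t with _ | t
    · exact ⟨(⟨0, ht⟩, !s), 0, h.left' s⟩
    · exact ⟨(⟨t, by omega⟩, s), j t, by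
        rw [corner_of_ne _ (h.color_ne t)]; exact h.link' (by omega) s⟩
  rw [corner_of_ne _ k0]
  by_cases kj : k = j t
  · subst kj
    by_cases htm : t = m
    · subst htm
      exact ⟨(⟨t, ht⟩, !s), j t, by rw [corner_of_ne _ k0]; exact h.right' s⟩
    · exact ⟨(⟨t + 1, by omega⟩, s), 0, h.link t (by omega) s⟩
  · exact ⟨(⟨t, ht⟩, !s), k, by rw [corner_of_ne _ k0]; exact h.inner t (by omega) s k k0 kj⟩

theorem corner_inj [Finite W] (h : IsChain K m j D l r) {t t' : ℕ} (ht : t ≤ m) (ht' : t' ≤ m)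
    {s s' : Bool} {k k' : Fin 4} (he : K.corner k (D t s) = K.corner k' (D t' s')) :
    t = t' ∧ s = s' ∧ k = k' := by
  have := h.corner_bijective.1 (a₁ := ((⟨t, by omega⟩, s), k)) (a₂ := ((⟨t', by omega⟩, s'), k')) he
  simp only [Prod.mk.injEq, Fin.mk.injEq] at this
  exact ⟨this.1.1, this.1.2, this.2⟩

theorem ne_left [Finite W] (h : IsChain K m j D l r) {t : ℕ} (ht : t ≤ m) (s : Bool) {k : Fin 4}
    (hk : k ≠ 0 ∨ t ≠ 0) : K.corner k (D t s) ≠ l ∧ K.corner k (D t s) ≠ K.nbr 0 l := by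
  rw [h.nbr_left, ← h.left_eq]
  constructor
  · intro he
    have := h.corner_inj ht (Nat.zero_le m) (k' := 0) he
    tauto
  · intro he
    have := h.corner_inj ht (Nat.zero_le m) (k' := 0) he
    tauto

theorem ne_right [Finite W] (h : IsChain K m j D l r) {t : ℕ} (ht : t ≤ m) (s : Bool) {k : Fin 4}
    (hk : k ≠ j t ∨ t ≠ m) : K.corner k (D t s) ≠ r ∧ K.corner k (D t s) ≠ K.nbr 0 r := by
  rw [h.nbr_right, ← h.right_eq]
  constructor
  · intro he
    have := h.corner_inj ht le_rfl (k' := j m) (by rw [he, corner_of_ne _ (h.color_ne m)])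
    rcases hk with hk | hk
    · rw [this.1] at hk; tauto
    · tauto
  · intro he
    have := h.corner_inj ht le_rfl (k' := j m) (by rw [he, corner_of_ne _ (h.color_ne m)])
    rcases hk with hk | hk
    · rw [this.1] at hk; tauto
    · tauto

theorem right_ne [Finite W] (h : IsChain K m j D l r) : r ≠ l ∧ r ≠ K.nbr 0 l := by
  have := h.ne_left le_rfl false (Or.inl (h.color_ne m))
  rwa [corner_of_ne _ (h.color_ne m), h.right_eq] at this

/-- A melon is a chain with one dipole. -/
theorem melon (j : ℕ → Fin 4) (hj : ∀ t, j t ≠ 0) :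
    IsChain melon 0 j (fun _ s => (s, 0)) (false, 0) (false, j 0) where
  connected := melon_connected
  numBubbles_eq := by
    have := FeynmanGraph.melon.four_mul_numBubbles
    simp only [Nat.card_eq_fintype_card, Fintype.card_prod, Fintype.card_bool,
      Fintype.card_fin] at this
    omega
  color_ne := hj
  inner t _ s k hk _ := by simp [melon_nbr hk]
  link t ht := absurd ht (by omega)
  left := rfl
  right := by simp [melon_nbr (hj 0)]
  left_eq := rfl
  right_eq := by
    rw [melon_nbr (hj 0)]
    have : ∀ c : Fin 4, 0 ^^^ c = c := by decide
    rw [this]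

/-- Attaching a dipole on the left of a chain. -/
theorem cons [Finite W] (h : IsChain K m j D l r) {c : Fin 4} (hc : c ≠ 0) :
    IsChain (FeynmanGraph.melon.conn (false, c) K l) (m + 1) (seqCons c j)
      (seqCons (fun s => Sum.inl (s, 0)) fun t s => Sum.inr (D t s))
      (Sum.inl (false, 0)) (Sum.inr r) where
  connected := melon_connected.conn h.connected _ _
  numBubbles_eq := by
    have := FeynmanGraph.melon.four_mul_numBubbles
    simp only [Nat.card_eq_fintype_card, Fintype.card_prod, Fintype.card_bool,
      Fintype.card_fin] at this
    have h1 : (FeynmanGraph.melon.conn (false, c) K l).numBubbles = _ :=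
      FeynmanGraph.melon.numBubbles_sum K
    rw [h1, h.numBubbles_eq]
    omega
  color_ne t := by
    rcases t with _ | t
    · exact hc
    · exact h.color_ne t
  inner t ht s k hk hkj := by
    classical
    have h0 : ∀ c : Fin 4, 0 ^^^ c = c := by decide
    rcases t with _ | t
    · simp only [seqCons_zero] at hkj ⊢
      rw [conn_nbr_inl _ _ _ _ hk, conn_nbr_inl _ _ _ _ hk, melon_nbr hk, melon_nbr hk, h0,
        conn_nbr_zero_inl]
      simp [hkj]
    · simp only [seqCons_succ] at hkj ⊢
      have hn := h.ne_left (t := t) (by omega) s (Or.inl hk)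
      rw [corner_of_ne _ hk] at hn
      rw [conn_nbr_inr _ _ _ _ hk, conn_nbr_inr _ _ _ _ hk, conn_nbr_zero_inr, if_neg hn.1,
        if_neg hn.2, h.inner t (by omega) s k hk hkj]
  link t ht s := by
    classical
    have h0 : ∀ c : Fin 4, 0 ^^^ c = c := by decide
    rcases t with _ | t
    · simp only [seqCons_zero, seqCons_succ]
      rw [conn_nbr_inl _ _ _ _ hc, melon_nbr hc, h0, conn_nbr_zero_inl]
      cases s
      · simp [h.left_eq]
      · simp [h.nbr_left]
    · simp only [seqCons_succ]
      have hn := h.ne_left (t := t) (by omega) s (Or.inl (h.color_ne t))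
      rw [corner_of_ne _ (h.color_ne t)] at hn
      rw [conn_nbr_inr _ _ _ _ (h.color_ne t), conn_nbr_zero_inr, if_neg hn.1, if_neg hn.2,
        h.link t (by omega)]
  left := by
    classical
    simp only [seqCons_zero]
    rw [conn_nbr_zero_inl]
    simp [hc.symm]
  right := by
    classical
    simp only [seqCons_succ]
    rw [conn_nbr_inr _ _ _ _ (h.color_ne m), conn_nbr_inr _ _ _ _ (h.color_ne m), conn_nbr_zero_inr,
      h.right_eq, if_neg h.right_ne.1, if_neg h.right_ne.2, h.nbr_right]
  left_eq := rfl
  right_eq := by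
    simp only [seqCons_succ]
    rw [conn_nbr_inr _ _ _ _ (h.color_ne m), h.right_eq]

/-- Exchanging the top and bottom lines. -/
theorem flip (h : IsChain K m j D l r) :
    IsChain K m j (fun t s => D t !s) (K.nbr 0 l) (K.nbr 0 r) where
  connected := h.connected
  numBubbles_eq := h.numBubbles_eq
  color_ne := h.color_ne
  inner t ht _ := h.inner t ht _
  link t ht _ := h.link t ht _
  left := h.left' true
  right := h.right' true
  left_eq := h.nbr_left.symm
  right_eq := h.nbr_right.symm

/-- Reading a chain of dipoles of the same colour from right to left. -/
theorem reverse {c : Fin 4} (h : IsChain K m (fun _ => c) D l r) :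
    IsChain K m (fun _ => c) (fun t s => K.nbr c (D (m - t) s)) r l where
  connected := h.connected
  numBubbles_eq := h.numBubbles_eq
  color_ne := h.color_ne
  inner t ht s k hk hkc := by
    -- Seen from the new base corner `nbr c (D _ _)`, the corner `k` is the old corner `e` of the
    -- third colour.
    obtain ⟨e, he⟩ := exists_triple (h.color_ne 0) hk hkc.symm
    have h1 := h.inner (m - t) (by omega) s e he.2.2.1 he.2.2.2.2.1.symm
    rw [← he.rotate.swap.mul K, ← he.rotate.swap.mul K] at h1
    exact h1
  link t ht s := by
    simp only [K.nbr_nbr]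
    have := h.link' (t := m - (t + 1)) (by omega) s
    rwa [show m - (t + 1) + 1 = m - t by omega] at this
  left := by simpa using h.right' false
  right := by simp only [K.nbr_nbr, Nat.sub_self]; exact h.left
  left_eq := by simpa using h.right_eq
  right_eq := by simp only [K.nbr_nbr, Nat.sub_self]; exact h.left_eq

end IsChain

end FeynmanGraph

namespace FeynmanGraph

open Equiv Equiv.Perm

/-! ### Closing the chains -/

theorem corner_switch {V : Type u} (G : FeynmanGraph V) (x y : V) (k : Fin 4) (z : V) :
    (G.switch x y).corner k z = G.corner k z := by
  by_cases hk : k = 0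
  · subst hk; rfl
  · rw [corner_of_ne _ hk, corner_of_ne _ hk, switch_nbr _ _ _ hk]

theorem corner_conn_inl {V : Type u} {W : Type v} (G : FeynmanGraph V) (x : V) (H : FeynmanGraph W)
    (y : W) (k : Fin 4) (z : V) :
    (G.conn x H y).corner k (Sum.inl z) = Sum.inl (G.corner k z) := by
  by_cases hk : k = 0
  · subst hk; rfl
  · rw [corner_of_ne _ hk, corner_of_ne _ hk, conn_nbr_inl _ _ _ _ hk]

theorem corner_conn_inr {V : Type u} {W : Type v} (G : FeynmanGraph V) (x : V) (H : FeynmanGraph W)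
    (y : W) (k : Fin 4) (z : W) :
    (G.conn x H y).corner k (Sum.inr z) = Sum.inr (H.corner k z) := by
  by_cases hk : k = 0
  · subst hk; rfl
  · rw [corner_of_ne _ hk, corner_of_ne _ hk, conn_nbr_inr _ _ _ _ hk]

theorem corner_doubleTadpole (i : Fin 3) (k : Fin 4) :
    (doubleTadpole i).corner k ((), 0) = ((), k) := by
  revert i k; decide

theorem doubleTadpole_nbr_zero (i : Fin 3) (k : Fin 4) :
    (doubleTadpole i).nbr 0 ((), k) = ((), k ^^^ i.succ) := rfl

/-- Joining the two ends of a chain of dipoles of the same colour. -/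
theorem IsChain.isomorphic_dipoleRing {W : Type u} [Finite W] {K : FeynmanGraph W} {m : ℕ}
    {i : Fin 3} {D : ℕ → Bool → W} {l r : W} (h : IsChain K m (fun _ => i.succ) D l r) :
    (K.switch l r).Isomorphic (dipoleRing (m + 1) i) := by
  have i0 : i.succ ≠ 0 := Fin.succ_ne_zero i
  have hrl := h.right_ne.1
  have key : ∀ (t : ZMod (m + 1)) s, (K.switch l r).nbr 0 (K.nbr i.succ (D t.val s)) =
      D (t + 1).val s := by
    intro t s
    have ht : t.val < m + 1 := ZMod.val_lt t
    -- At the last dipole the cyclic index returns to 0, and the link is one of the two edges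
    -- created by the switch.
    by_cases htm : t.val = m
    · have : t = -1 := ZMod.val_injective _ (by rw [htm, ZMod.val_neg_one])
      rw [htm, this, neg_add_cancel, ZMod.val_zero]
      cases s
      · rw [h.right_eq, h.left_eq, switch_nbr_right _ hrl]
      · rw [← h.nbr_right, ← h.nbr_left, switch_nbr_right' _ hrl]
    · have hv : (t + 1).val = t.val + 1 := by
        rw [ZMod.val_add, ZMod.val_one_eq_one_mod, Nat.add_mod_mod, Nat.mod_eq_of_lt (by omega)]
      rw [hv, ← h.link t.val (by omega)]
      have h1 := h.ne_left (t := t.val) (by omega) s (Or.inl i0)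
      have h2 := h.ne_right (t := t.val) (by omega) s (k := i.succ) (Or.inr htm)
      rw [corner_of_ne _ i0] at h1 h2
      exact switch_nbr_of_ne _ h1.1 h1.2 h2.1 h2.2
  have key' : ∀ (t : ZMod (m + 1)) s, (K.switch l r).nbr 0 (D t.val s) =
      K.nbr i.succ (D (t - 1).val s) := by
    intro t s
    have := key (t - 1) s
    rw [sub_add_cancel] at this
    rw [← this, nbr_nbr]
  obtain ⟨e, he, -⟩ := (K.switch l r).exists_isIso_of_base (B := ZMod (m + 1) × Bool)
    (p := dipoleRingProp (m + 1) i) (fun x => (dipoleRing (m + 1) i).nbr_nbr 0 x)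
    (fun x => (dipoleRing (m + 1) i).nbr_ne 0 x) (fun a => D a.1.val a.2) (by
      rintro ⟨t, s⟩ k
      simp only [corner_switch]
      by_cases k0 : k = 0
      · subst k0
        simp only [dipoleRingProp, if_true, corner_zero, corner_of_ne _ i0]
        exact key' t s
      by_cases ki : k = i.succ
      · subst ki
        simp only [dipoleRingProp, if_true, i0, if_false, corner_zero, corner_of_ne _ i0]
        exact key t s
      · simp only [dipoleRingProp, k0, ki, if_false, corner_of_ne _ k0]
        have ht : t.val < m + 1 := ZMod.val_lt t
        have h1 := h.ne_left (t := t.val) (by omega) s (Or.inl k0)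
        have h2 := h.ne_right (t := t.val) (by omega) s (k := k) (Or.inl ki)
        rw [corner_of_ne _ k0] at h1 h2
        rw [switch_nbr_of_ne _ h1.1 h1.2 h2.1 h2.2, h.inner _ (by omega) s k k0 ki])
    (fun x => by
      obtain ⟨⟨⟨t, s⟩, k⟩, hx⟩ := h.corner_bijective.2 x
      exact ⟨((t : ZMod (m + 1)), s), k, by rw [corner_switch]; exact hx⟩)
    (by
      have : (K.switch l r).numBubbles = K.numBubbles := rfl
      rw [this, h.numBubbles_eq]; simp; omega)
  exact Isomorphic.symm ⟨e, he⟩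

/-- The bubbles of a chain. -/
def chainBubbleEquiv (m : ℕ) : ChainBubble m ≃ (Fin m × Bool) ⊕ Bool where
  toFun
    | .left => Sum.inr false
    | .dipole l s => Sum.inl (l, s)
    | .right => Sum.inr true
  invFun
    | Sum.inl (l, s) => .dipole l s
    | Sum.inr false => .left
    | Sum.inr true => .right
  left_inv := by rintro (_ | _ | _) <;> rfl
  right_inv := by rintro (⟨_, _⟩ | _ | _) <;> rfl

instance (m : ℕ) : Finite (ChainBubble m) := Finite.of_equiv _ (chainBubbleEquiv m).symm

instance (m : ℕ) : Nonempty (ChainBubble m) := ⟨.left⟩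

theorem card_chainBubble (m : ℕ) : Nat.card (ChainBubble m) = 2 * m + 2 := by
  rw [Nat.card_congr (chainBubbleEquiv m)]
  simp; omega

theorem numBubbles_doubleTadpole (i : Fin 3) : (doubleTadpole i).numBubbles = 1 := by
  have := (doubleTadpole i).four_mul_numBubbles
  simp only [Nat.card_eq_fintype_card, Fintype.card_prod, Fintype.card_unit, Fintype.card_fin] at this
  omega

theorem chainLeftEnd_zero {m : ℕ} (i : Fin 3) (j : Fin m → Fin 3) (s : Bool) :
    chainLeftEnd i j 0 s = (.left, if s then i.succ else 0) := rfl

theorem chainLeftEnd_succ {m : ℕ} (i : Fin 3) (j : Fin m → Fin 3) (t : Fin m) (s : Bool) :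
    chainLeftEnd i j t.succ s = (.dipole t s, (j t).succ) := rfl

theorem chainRightEnd_last {m : ℕ} (i : Fin 3) (s : Bool) :
    chainRightEnd i (Fin.last m) s = (.right, if s then i.succ else 0) := by simp [chainRightEnd]

theorem chainRightEnd_castSucc {m : ℕ} (i : Fin 3) (t : Fin m) (s : Bool) :
    chainRightEnd i t.castSucc s = (.dipole t s, 0) := by simp [chainRightEnd]

/-- Two tadpoles joined directly. -/
theorem doubleTadpole_conn_isomorphic (i i' : Fin 3) (j : Fin 0 → Fin 3) :
    ((doubleTadpole i).conn ((), 0) (doubleTadpole i') ((), 0)).Isomorphic (tadpoleChain i i' j) := by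
  classical
  have h0 : ∀ k : Fin 4, 0 ^^^ k = k := by decide
  have i0 : ∀ i : Fin 3, i.succ ≠ 0 := Fin.succ_ne_zero
  have hr : ∀ s, chainRightEnd (m := 0) i' 0 s = (.right, if s then i'.succ else 0) :=
    chainRightEnd_last i'
  have hc : ((doubleTadpole i).conn ((), 0) (doubleTadpole i') ((), 0)).Connected :=
    (doubleTadpole_connected i).conn (doubleTadpole_connected i') _ _
  obtain ⟨e, he, -⟩ := hc.exists_isIso_of_base (p := tadpoleChainProp i i' j)
    (tadpoleChainProp_involutive i i' j) (tadpoleChainProp_ne i i' j)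
    (fun a => match a with
      | .left => Sum.inl ((), 0)
      | .dipole _ _ => Sum.inl ((), 0)
      | .right => Sum.inr ((), 0)) (by
      rintro (_ | ⟨l, s⟩ | _) k
      · simp only [corner_conn_inl, corner_doubleTadpole, conn_nbr_zero_inl, doubleTadpole_nbr_zero, h0]
        by_cases k0 : k = 0
        · subst k0
          simp [tadpoleChainProp, hr]
        by_cases k1 : k = i.succ
        · subst k1
          simp [tadpoleChainProp, hr, corner_conn_inr, corner_doubleTadpole]
        · simp [tadpoleChainProp, k0, k1, corner_conn_inl, corner_doubleTadpole]
      · exact l.elim0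
      · simp only [corner_conn_inr, corner_doubleTadpole, conn_nbr_zero_inr, doubleTadpole_nbr_zero, h0]
        by_cases k0 : k = 0
        · subst k0
          simp [tadpoleChainProp, chainLeftEnd_zero]
        by_cases k1 : k = i'.succ
        · subst k1
          simp [tadpoleChainProp, chainLeftEnd_zero, corner_conn_inl, corner_doubleTadpole]
        · simp [tadpoleChainProp, k0, k1, corner_conn_inr, corner_doubleTadpole]) (by
      rw [card_chainBubble]
      have h1 : ((doubleTadpole i).conn ((), 0) (doubleTadpole i') ((), 0)).numBubbles = _ :=
        (doubleTadpole i).numBubbles_sum (doubleTadpole i')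
      rw [h1, numBubbles_doubleTadpole, numBubbles_doubleTadpole])
  exact Isomorphic.symm ⟨e, he⟩

/-- Closing a chain by two tadpoles. -/
theorem IsChain.isomorphic_tadpoleChain {W : Type u} [Finite W] {K : FeynmanGraph W} {m : ℕ}
    {j : ℕ → Fin 3} {D : ℕ → Bool → W} {l r : W} (h : IsChain K m (fun t => (j t).succ) D l r)
    (i i' : Fin 3) :
    (((doubleTadpole i).conn ((), 0) K l).conn (Sum.inr r) (doubleTadpole i') ((), 0)).Isomorphic
      (tadpoleChain i i' fun t : Fin (m + 1) => j t) := by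
  classical
  have h0 : ∀ k : Fin 4, 0 ^^^ k = k := by decide
  have i0 : ∀ i : Fin 3, i.succ ≠ 0 := Fin.succ_ne_zero
  have hc := ((doubleTadpole_connected i).conn h.connected ((), 0) l).conn
    (doubleTadpole_connected i') (Sum.inr r) ((), 0)
  have hrl := h.right_ne
  have hr0 : ((doubleTadpole i).conn ((), 0) K l).nbr 0 (Sum.inr r) = Sum.inr (K.nbr 0 r) := by
    rw [conn_nbr_zero_inr, if_neg hrl.1, if_neg hrl.2]
  have hR0 : ∀ s, chainRightEnd (m := m + 1) i' 0 s = (.dipole 0 s, 0) :=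
    chainRightEnd_castSucc i' 0
  have hL1 : ∀ s, chainLeftEnd i (fun t : Fin (m + 1) => j t) (Fin.last (m + 1)) s =
      (.dipole (Fin.last m) s, (j m).succ) :=
    fun s => by rw [← Fin.succ_last, chainLeftEnd_succ]; simp
  -- Away from its four outer legs the chain keeps its propagators.
  have eL : ∀ w, w ≠ r → w ≠ K.nbr 0 r → w ≠ l → w ≠ K.nbr 0 l →
      (((doubleTadpole i).conn ((), 0) K l).conn (Sum.inr r) (doubleTadpole i') ((), 0)).nbr 0
        (Sum.inl (Sum.inr w)) = Sum.inl (Sum.inr (K.nbr 0 w)) := by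
    intro w h1 h2 h3 h4
    rw [conn_nbr_zero_inl, hr0, conn_nbr_zero_inr]
    simp [h1, h2, h3, h4]
  obtain ⟨e, he, -⟩ := hc.exists_isIso_of_base
    (p := tadpoleChainProp i i' fun t : Fin (m + 1) => j t)
    (tadpoleChainProp_involutive i i' _) (tadpoleChainProp_ne i i' _)
    (fun a => match a with
      | .left => Sum.inl (Sum.inl ((), 0))
      | .dipole t s => Sum.inl (Sum.inr (D t s))
      | .right => Sum.inr ((), 0)) (by
      rintro (_ | ⟨t, s⟩ | _) k
      · simp only [corner_conn_inl, corner_doubleTadpole]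
        rw [conn_nbr_zero_inl, hr0, conn_nbr_zero_inl, doubleTadpole_nbr_zero, doubleTadpole_nbr_zero, h0]
        by_cases k0 : k = 0
        · subst k0
          simp [tadpoleChainProp, hR0, h.left_eq]
        by_cases k1 : k = i.succ
        · subst k1
          simp [tadpoleChainProp, hR0, h.nbr_left, h0]
        · simp [tadpoleChainProp, k0, k1, corner_conn_inl, corner_doubleTadpole, h0,
            doubleTadpole_nbr_zero]
      · have ht : (t : ℕ) ≤ m := by omega
        simp only [corner_conn_inl, corner_conn_inr]
        by_cases k0 : k = 0
        · subst k0
          have hn := h.ne_right ht s (k := 0) (Or.inl (h.color_ne _).symm)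
          rw [corner_zero] at hn ⊢
          simp only [tadpoleChainProp, if_true]
          obtain ⟨t, htm⟩ := t
          rcases t with _ | t
          · have : (⟨0, htm⟩ : Fin (m + 1)).castSucc = 0 := rfl
            rw [this, chainLeftEnd_zero, conn_nbr_zero_inl, hr0, conn_nbr_zero_inr]
            simp only at hn
            cases s
            · rw [h.left_eq] at hn
              simp [hn, h.left_eq]
            · rw [← h.nbr_left] at hn
              simp [hn, ← h.nbr_left, corner_conn_inl, corner_doubleTadpole, K.nbr_ne,
                doubleTadpole_nbr_zero, h0]
          · have e1 : (⟨t + 1, htm⟩ : Fin (m + 1)).castSucc =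
              (⟨t, by omega⟩ : Fin (m + 1)).succ := rfl
            have hn' := h.ne_left ht s (k := 0) (Or.inr (Nat.succ_ne_zero t))
            rw [corner_zero] at hn'
            rw [e1, chainLeftEnd_succ, eL _ hn.1 hn.2 hn'.1 hn'.2]
            simp only [corner_conn_inl, corner_conn_inr]
            simp only [corner_of_ne _ (i0 _)]
            rw [h.link' (by omega : t < m)]
        by_cases k1 : k = (j t).succ
        · subst k1
          have hn := h.ne_left ht s (Or.inl k0)
          rw [corner_of_ne _ k0] at hn ⊢
          simp only [tadpoleChainProp, i0, if_false, if_true]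
          by_cases htm : (t : ℕ) = m
          · obtain rfl : t = Fin.last m := Fin.ext htm
            rw [Fin.succ_last, chainRightEnd_last, conn_nbr_zero_inl, hr0]
            simp only [Fin.val_last] at hn ⊢
            cases s
            · simp [h.right_eq]
            · simp [← h.nbr_right, corner_conn_inr, corner_doubleTadpole, K.nbr_ne,
                doubleTadpole_nbr_zero, h0]
          · have hn' := h.ne_right ht s (k := (j t).succ) (Or.inr htm)
            rw [corner_of_ne _ k0] at hn'
            have e1 : t.succ = (⟨t + 1, by omega⟩ : Fin (m + 1)).castSucc := rfl
            rw [e1, chainRightEnd_castSucc, eL _ hn'.1 hn'.2 hn.1 hn.2]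
            simp only [corner_zero]
            rw [h.link t (by omega)]
        · have hn := h.ne_left ht s (Or.inl k0)
          have hn' := h.ne_right ht s (k := k) (Or.inl k1)
          rw [eL _ hn'.1 hn'.2 hn.1 hn.2, corner_of_ne _ k0, h.inner t ht s k k0 k1]
          simp [tadpoleChainProp, k0, k1, corner_of_ne, conn_nbr_inl, conn_nbr_inr]
      · simp only [corner_conn_inr, corner_doubleTadpole]
        rw [conn_nbr_zero_inr, hr0, doubleTadpole_nbr_zero, doubleTadpole_nbr_zero, h0]
        by_cases k0 : k = 0
        · subst k0
          simp [tadpoleChainProp, hL1, corner_of_ne, conn_nbr_inl, conn_nbr_inr, h.right_eq]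
        by_cases k1 : k = i'.succ
        · subst k1
          simp [tadpoleChainProp, hL1, corner_of_ne, conn_nbr_inl, conn_nbr_inr, h.nbr_right]
        · simp [tadpoleChainProp, k0, k1, corner_conn_inr, corner_doubleTadpole]) (by
      rw [card_chainBubble]
      have h1 : (((doubleTadpole i).conn ((), 0) K l).conn (Sum.inr r) (doubleTadpole i')
        ((), 0)).numBubbles = _ :=
        numBubbles_sum ((doubleTadpole i).conn ((), 0) K l) (doubleTadpole i')
      have h2 : ((doubleTadpole i).conn ((), 0) K l).numBubbles = _ :=
        (doubleTadpole i).numBubbles_sum K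
      rw [h1, h2, numBubbles_doubleTadpole, numBubbles_doubleTadpole, h.numBubbles_eq]
      omega)
  exact Isomorphic.symm ⟨e, he⟩

end FeynmanGraph

namespace FeynmanGraph

open Equiv Equiv.Perm

/-! ### Connected sums of two graphs of degree one half -/

/-- The translations of the graph with one bubble. -/
def tadpoleShift (k : Fin 4) : Unit × Fin 4 ≃ Unit × Fin 4 where
  toFun q := (q.1, q.2 ^^^ k)
  invFun q := (q.1, q.2 ^^^ k)
  left_inv := by revert k; decide
  right_inv := by revert k; decide

theorem isIso_tadpoleShift (i : Fin 3) (k : Fin 4) :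
    (doubleTadpole i).IsIso (doubleTadpole i) (tadpoleShift k) := by
  unfold IsIso
  revert i k
  decide

theorem tadpoleShift_self (p : Unit × Fin 4) : tadpoleShift p.2 p = ((), 0) := by
  revert p; decide

/-- The graph is a chain of dipoles, with a tadpole on its right and its left legs joined by the
propagator at `y`. -/
def IsRootedChain {W : Type} (i : Fin 3) (R : FeynmanGraph W) (y : W) : Prop :=
  (∃ e, R.IsIso (doubleTadpole i) e ∧ e y = ((), 0)) ∨
    ∃ (U : Type) (_ : Finite U) (K : FeynmanGraph U) (m : ℕ) (j : ℕ → Fin 3) (D : ℕ → Bool → U)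
      (l r : U) (e : _), IsChain K m (fun t => (j t).succ) D l r ∧
      R.IsIso (K.conn r (doubleTadpole i) ((), 0)) e ∧ e y = Sum.inl l

/-- A melon opened at corner `c` is a dipole of colour `c` whose left legs are still joined; their
propagator becomes the new root. -/
theorem IsRootedChain.cons {W : Type} {i : Fin 3} {R : FeynmanGraph W} {y : W}
    (h : IsRootedChain i R y) (c : Fin 3) :
    IsRootedChain i (melon.conn (false, c.succ) R y) (Sum.inl (false, 0)) := by
  right
  rcases h with ⟨e, he, hy⟩ | ⟨U, _, K, m, j, D, l, r, e, hK, he, hy⟩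
  · refine ⟨_, inferInstance, melon, 0, fun _ => c, _, _, _, Equiv.sumCongr (Equiv.refl _) e,
      IsChain.melon _ (fun _ => Fin.succ_ne_zero c), ?_, ?_⟩
    · have := (isIso_refl melon).conn he (false, c.succ) y
      rwa [hy] at this
    · rfl
  · have h1 := (isIso_refl melon).conn he (false, c.succ) y
    rw [hy] at h1
    have h2 := isIso_conn_assoc melon (false, c.succ) K hK.right_ne.1 (doubleTadpole i) ((), 0)
    have h3 := hK.cons (Fin.succ_ne_zero c)
    have e1 : seqCons c.succ (fun t => (j t).succ) = fun t => (seqCons c j t).succ := by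
      funext t; cases t <;> rfl
    rw [e1] at h3
    exact ⟨_, inferInstance, _, m + 1, seqCons c j, _, _, _, _, h3, h1.trans h2.symm, rfl⟩

theorem IsRootedChain.exists_isomorphic {W : Type} {i' : Fin 3} {R : FeynmanGraph W} {y : W}
    (h : IsRootedChain i' R y) (i : Fin 3) : ∃ (m : ℕ) (j : Fin m → Fin 3),
      ((doubleTadpole i).conn ((), 0) R y).Isomorphic (tadpoleChain i i' j) := by
  rcases h with ⟨e, he, hy⟩ | ⟨U, _, K, m, j, D, l, r, e, hK, he, hy⟩
  · refine ⟨0, Fin.elim0, Isomorphic.trans ?_ (doubleTadpole_conn_isomorphic i i' _)⟩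
    have := (isIso_refl (doubleTadpole i)).conn he ((), 0) y
    rw [hy] at this
    exact ⟨_, this⟩
  · refine ⟨m + 1, fun t => j t, Isomorphic.trans ?_ (hK.isomorphic_tadpoleChain i i')⟩
    have h1 := (isIso_refl (doubleTadpole i)).conn he ((), 0) y
    rw [hy] at h1
    have h2 := isIso_conn_assoc (doubleTadpole i) ((), 0) K hK.right_ne.1 (doubleTadpole i') ((), 0)
    exact ⟨_, h1.trans h2.symm⟩

/-- The graph is a decorated chain of dipoles with two tadpoles. -/
def IsDecoratedTadpoleChain {V : Type u} (i i' : Fin 3) (G : FeynmanGraph V) : Prop :=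
  ∃ (m : ℕ) (j : Fin m → Fin 3), IsMelonicDecoration (tadpoleChain i i' j) G

theorem IsDecoratedTadpoleChain.of_isomorphic {V V' : Type u} {i i' : Fin 3} {G : FeynmanGraph V}
    {G' : FeynmanGraph V'} (h : IsDecoratedTadpoleChain i i' G) (h' : G'.Isomorphic G) :
    IsDecoratedTadpoleChain i i' G' :=
  let ⟨m, j, h⟩ := h; ⟨m, j, h.of_isomorphic h'⟩

theorem IsDecoratedTadpoleChain.conn_melon {V : Type u} {i i' : Fin 3} {G : FeynmanGraph V}
    (h : IsDecoratedTadpoleChain i i' G) (x : V) (p : Bool × Fin 4) :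
    IsDecoratedTadpoleChain i i' (G.conn x melon p) :=
  let ⟨m, j, h⟩ := h; ⟨m, j, h.conn_melon x p⟩

theorem exists_conn_melon_nbr_zero {V : Type u} (A : FeynmanGraph V) (z : V) (b : Bool) :
    ∃ x, (A.conn z melon (false, 0)).nbr 0 (Sum.inr (b, 0)) = Sum.inl x := by
  classical
  cases b
  · exact ⟨z, by rw [conn_nbr_zero_inr, if_pos rfl]⟩
  · exact ⟨A.nbr 0 z, by rw [conn_nbr_zero_inr, if_neg (by simp), if_pos (by simp)]⟩

/-- The last melon of `A` is removed. If the connected sum opens one of its three inner propagators,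
the melon becomes one more dipole of the chain; otherwise it stays a decoration. Once `A` is the
bare bubble, it closes the chain on the left. -/
theorem IsMelonicDecoration.conn_isRootedChain {V : Type u} {i i' : Fin 3} {A : FeynmanGraph V}
    (hA : IsMelonicDecoration (doubleTadpole i) A) {W : Type} {R : FeynmanGraph W} {y : W}
    (hR : IsRootedChain i' R y) (x : V) : IsDecoratedTadpoleChain i i' (A.conn x R y) := by
  classical
  induction hA generalizing W with
  | core A h =>
    obtain ⟨e, he⟩ := h
    obtain ⟨m, j, h⟩ := hR.exists_isomorphic i
    refine ⟨m, j, .core _ (Isomorphic.trans ?_ h)⟩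
    have := (IsIso.trans he (isIso_tadpoleShift i (e x).2)).conn R.isIso_refl x y
    simp only [Equiv.trans_apply, tadpoleShift_self] at this
    exact ⟨_, this⟩
  | @insert V V' A z A' _ h ih =>
    rw [melonInsert_eq_conn] at h
    obtain ⟨e, he⟩ := h
    refine IsDecoratedTadpoleChain.of_isomorphic ?_ ⟨_, IsIso.conn he R.isIso_refl x y⟩
    show IsDecoratedTadpoleChain i i' ((A.conn z melon (false, 0)).conn (e x) R y)
    generalize e x = t
    have outer : ∀ x' : V, ∀ y', (y' = y ∨ y' = R.nbr 0 y) →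
        IsDecoratedTadpoleChain i i' ((A.conn z melon (false, 0)).conn (Sum.inl x') R y') := by
      intro x' y' hy
      obtain ⟨z', m, hm, hne⟩ : ∃ z' m, A.conn z melon (false, 0) = A.conn z' melon m ∧ x' ≠ z' := by
        by_cases hzt : x' = z
        · refine ⟨A.nbr 0 z, _, (conn_nbr_nbr _ _ _ _).symm, ?_⟩
          rw [hzt]; exact (A.nbr_ne 0 z).symm
        · exact ⟨z, _, rfl, hzt⟩
      rw [hm]
      have h1 := (isIso_conn_comm A z' melon m).conn R.isIso_refl (Sum.inl x') y'
      have h2 := isIso_conn_assoc melon m A hne R y'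
      have h3 := isIso_conn_comm melon m (A.conn x' R y') (Sum.inl z')
      refine IsDecoratedTadpoleChain.of_isomorphic (IsDecoratedTadpoleChain.conn_melon ?_ _ _)
        ⟨_, (h1.trans h2).trans h3⟩
      rcases hy with rfl | rfl
      · exact ih hR x'
      · have := ih hR (A.nbr 0 x')
        rwa [← conn_nbr_nbr, A.nbr_nbr] at this
    rcases t with t | ⟨b, k⟩
    · exact outer t y (Or.inl rfl)
    · by_cases hk : k = 0
      -- The corner `0` of an inserted bubble is joined to a vertex of `A`, and the connected sum
      -- can be read from that end.
      · subst hk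
        obtain ⟨x', hx'⟩ := exists_conn_melon_nbr_zero A z b
        rw [← conn_nbr_nbr (A.conn z melon (false, 0)), hx']
        exact outer x' _ (Or.inr rfl)
      obtain ⟨c, rfl⟩ := Fin.exists_succ_eq.2 hk
      have inner : ∀ z, IsDecoratedTadpoleChain i i'
          ((A.conn z melon (false, 0)).conn (Sum.inr (false, c.succ)) R y) := by
        intro z
        refine (ih (hR.cons c) z).of_isomorphic ⟨_, isIso_conn_assoc A z melon ?_ R y⟩
        simp [hk]
      cases b
      · exact inner z
      -- The second bubble reduces to the first by the translation exchanging them, with the melon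
      -- inserted from the other end.
      · refine (inner (A.nbr 0 z)).of_isomorphic ?_
        have h1 := (A.isIso_refl.conn (isIso_melonShift (true, 0)) z (false, 0)).conn R.isIso_refl
          (Sum.inr (true, c.succ)) y
        rw [melonShift_zero] at h1
        have h2 := A.conn_nbr_nbr z melon (true, 0)
        simp only [Equiv.refl_apply] at h1
        rw [← h2] at h1
        have h3 : ∀ c : Fin 3, melonShift (true, 0) (true, c.succ) = (false, c.succ) := by decide
        simp only [Equiv.sumCongr_apply, Sum.map_inr, h3] at h1
        exact ⟨_, h1⟩

/-- By `conn_induction` all melons of `B` are moved to `A` or become decorations of the sum. What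
remains on the right is a bare tadpole, the rooted chain without dipoles. -/
theorem IsMelonicDecoration.isDecoratedTadpoleChain_conn {V V' : Type u} {i i' : Fin 3}
    {A : FeynmanGraph V} {B : FeynmanGraph V'} (hA : IsMelonicDecoration (doubleTadpole i) A)
    (hB : IsMelonicDecoration (doubleTadpole i') B) (x : V) (y : V') :
    IsDecoratedTadpoleChain i i' (A.conn x B y) := by
  refine hB.conn_induction (P := IsMelonicDecoration (doubleTadpole i))
    (Q := IsDecoratedTadpoleChain i i')
    (fun _ x p hG => hG.conn_melon x p) (fun _ x p hG => hG.conn_melon x p)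
    (fun _ _ h hG => hG.of_isomorphic h) ?_ hA x y
  rintro V V' G H x y hG ⟨e, he⟩
  have h1 : IsRootedChain i' (doubleTadpole i') ((), 0) := Or.inl ⟨_, isIso_refl _, rfl⟩
  refine (hG.conn_isRootedChain h1 x).of_isomorphic ?_
  have := G.isIso_refl.conn (IsIso.trans he (isIso_tadpoleShift i' (e y).2)) x y
  simp only [Equiv.trans_apply, tadpoleShift_self] at this
  exact ⟨_, this⟩

end FeynmanGraph

namespace FeynmanGraph

open Equiv Equiv.Perm

/-! ### Decorated rings of dipoles -/

/-- Switches commute if their ends are different. -/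
theorem switch_comm_of_ne {V : Type u} (G : FeynmanGraph V) {x y z t : V} (hxy : y ≠ x)
    (hxy' : y ≠ G.nbr 0 x) (hzx : z ≠ x) (hzy : z ≠ y)
    (htx : t ≠ x) (hty : t ≠ y) (hzy' : z ≠ G.nbr 0 y)
    (htx' : t ≠ G.nbr 0 x) (hty' : t ≠ G.nbr 0 y) :
    (G.switch x y).switch z t = (G.switch z t).switch x y := by
  by_cases h : z = G.nbr 0 x
  · subst h
    have h1 := G.switch_switch_comm (x := x) (y := G.nbr 0 t) (z := y)
      (fun h => htx' (by rw [← h, G.nbr_nbr])) (fun h => htx ((G.nbr_inj 0).1 h)) hxy hxy'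
      (fun h => hty' (by rw [h, G.nbr_nbr])) (by rw [G.nbr_nbr]; exact hty.symm)
    rw [G.nbr_nbr] at h1
    have h2 := G.switch_nbr_nbr x (G.nbr 0 t)
    rw [G.nbr_nbr] at h2
    rw [h2, h1]
  · exact G.switch_comm hzx hzy htx hty h hzy' htx' hty'

/-- Exchange of the last two summands. -/
def sumRightComm (U V W : Type*) : (U ⊕ V) ⊕ W ≃ (U ⊕ W) ⊕ V where
  toFun := Sum.elim (Sum.elim (fun a => Sum.inl (Sum.inl a)) Sum.inr) fun a => Sum.inl (Sum.inr a)
  invFun := Sum.elim (Sum.elim (fun a => Sum.inl (Sum.inl a)) Sum.inr) fun a => Sum.inl (Sum.inr a)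
  left_inv := by rintro ((_ | _) | _) <;> rfl
  right_inv := by rintro ((_ | _) | _) <;> rfl

theorem isIso_sumRightComm {U V W : Type*} (A : FeynmanGraph U) (M : FeynmanGraph V)
    (K : FeynmanGraph W) : ((A.sum M).sum K).IsIso ((A.sum K).sum M) (sumRightComm U V W) := by
  rintro c ((_ | _) | _) <;> rfl

/-- Two successive insertions, and a switch between the first graph and the last one. -/
theorem isIso_switch_conn_conn {U V W : Type*} (A : FeynmanGraph U) (M : FeynmanGraph V)
    (K : FeynmanGraph W) {x y z : U} (hzx : z ≠ x) (hzy : z ≠ y) (m : V) {l r : W}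
    (hrl : r ≠ K.nbr 0 l) :
    (((A.conn z M m).conn (Sum.inl x) K l).switch (Sum.inl (Sum.inl y)) (Sum.inr r)).IsIso
      (((A.conn x K l).switch (Sum.inl y) (Sum.inr r)).conn (Sum.inl z) M m)
      (sumRightComm U V W) := by
  classical
  have h1 := (((isIso_sumRightComm A M K).switch (Sum.inl (Sum.inl z)) (Sum.inl (Sum.inr m))).switch
    (Sum.inl (Sum.inl x)) (Sum.inr l)).switch (Sum.inl (Sum.inl y)) (Sum.inr r)
  have h2 : (A.conn z M m).conn (Sum.inl x) K l = (((A.sum M).sum K).switch (Sum.inl (Sum.inl z))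
    (Sum.inl (Sum.inr m))).switch (Sum.inl (Sum.inl x)) (Sum.inr l) := by
    rw [conn, conn, switch_sum]
  have h3 : ((A.conn x K l).switch (Sum.inl y) (Sum.inr r)).conn (Sum.inl z) M m =
      ((((A.sum K).sum M).switch (Sum.inl (Sum.inl x)) (Sum.inl (Sum.inr l))).switch
        (Sum.inl (Sum.inl y)) (Sum.inl (Sum.inr r))).switch (Sum.inl (Sum.inl z)) (Sum.inr m) := by
    rw [conn, conn, switch_sum, switch_sum]
  rw [h2, h3]
  convert h1 using 1
  show _ = ((((A.sum K).sum M).switch (Sum.inl (Sum.inl z)) (Sum.inr m)).switch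
    (Sum.inl (Sum.inl x)) (Sum.inl (Sum.inr l))).switch (Sum.inl (Sum.inl y)) (Sum.inl (Sum.inr r))
  rw [switch_comm_of_ne ((A.sum K).sum M) (x := Sum.inl (Sum.inl z)) (y := Sum.inr m)]
  · have e1 : (((A.sum K).sum M).switch (Sum.inl (Sum.inl x)) (Sum.inl (Sum.inr l))).nbr 0
        (Sum.inr m) = Sum.inr (M.nbr 0 m) := by
      rw [switch_nbr_of_ne] <;> simp [sum_nbr_inl, sum_nbr_inr]
    have e2 : (((A.sum K).sum M).switch (Sum.inl (Sum.inl x)) (Sum.inl (Sum.inr l))).nbr 0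
        (Sum.inl (Sum.inl z)) = Sum.inl (if z = A.nbr 0 x then Sum.inr (K.nbr 0 l) else
          Sum.inl (A.nbr 0 z)) := by
      rw [switch_nbr_zero _ (by simp)]
      simp [sum_nbr_inl, sum_nbr_inr, hzx, apply_ite]
    rw [switch_comm_of_ne _ (x := Sum.inl (Sum.inl z)) (y := Sum.inr m)]
    all_goals first | rw [e1] | rw [e2] | skip
    all_goals try simp [hzy.symm]
    split_ifs <;> simp [hrl]
  all_goals simp [sum_nbr_inl, sum_nbr_inr, hzx.symm]

/-- The same graph in another universe. -/
def ulift {V : Type u} (G : FeynmanGraph V) : FeynmanGraph (ULift.{v} V) where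
  nbr c x := ⟨G.nbr c x.down⟩
  nbr_nbr c x := by simp [G.nbr_nbr]
  nbr_ne c x h := G.nbr_ne c x.down (congrArg ULift.down h)
  tetrahedral x := by simp [G.tetrahedral]

theorem isIso_ulift {V : Type u} (G : FeynmanGraph V) :
    G.IsIso (ulift.{u, v} G) Equiv.ulift.symm := fun _ _ => rfl

/-- Decorations stay within one universe, so the small graph is lifted to that of `A` before the
connected sum. -/
theorem IsMelonicDecoration.conn_core {V : Type u} {A : FeynmanGraph V}
    (hA : IsMelonicDecoration melon A) {W : Type} {G : FeynmanGraph W} {U : Type v}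
    {C : FeynmanGraph U} (h : G.Isomorphic C) (x : V) (t : W) :
    IsMelonicDecoration C (A.conn x G t) := by
  have h1 : IsMelonicDecoration C (ulift.{0, u} G) :=
    .core _ (Isomorphic.trans (Isomorphic.symm ⟨_, G.isIso_ulift⟩) h)
  exact (hA.conn_left h1 (Equiv.ulift.symm t) x).of_isomorphic
    ⟨_, A.isIso_refl.conn G.isIso_ulift x t⟩

/-- Closing any chain of dipoles of colour `i` at the ends `x` and `y` gives a decorated ring. -/
def ClosesRing {V : Type u} (i : Fin 3) (A : FeynmanGraph V) (x y : V) : Prop :=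
  ∀ (W : Type) [Finite W] (K : FeynmanGraph W) (m : ℕ) (D : ℕ → Bool → W) (l r : W),
    IsChain K m (fun _ => i.succ) D l r →
    ∃ n, IsMelonicDecoration (dipoleRing (n + 1) i) ((A.conn x K l).switch (Sum.inl y) (Sum.inr r))

theorem ClosesRing.of_isIso {V V' : Type u} {i : Fin 3} {A : FeynmanGraph V} {A' : FeynmanGraph V'}
    {e : V ≃ V'} (he : A.IsIso A' e) {x y : V} (h : ClosesRing i A' (e x) (e y)) :
    ClosesRing i A x y := by
  intro W _ K m D l r hK
  obtain ⟨n, hn⟩ := h W K m D l r hK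
  exact ⟨n, hn.of_isomorphic ⟨_, (he.conn K.isIso_refl x l).switch (Sum.inl y) (Sum.inr r)⟩⟩

/-- Closing at the other ends of the two propagators exchanges the top and bottom lines of the
chain. -/
theorem ClosesRing.flip {V : Type u} {i : Fin 3} {A : FeynmanGraph V} {x y : V} (hyx : y ≠ x)
    (hyx' : y ≠ A.nbr 0 x) (h : ClosesRing i A (A.nbr 0 x) (A.nbr 0 y)) : ClosesRing i A x y := by
  classical
  intro W _ K m D l r hK
  obtain ⟨n, hn⟩ := h W K m _ _ _ hK.flip
  refine ⟨n, ?_⟩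
  rw [conn_nbr_nbr] at hn
  have h1 := (A.conn x K l).switch_nbr_nbr (Sum.inl y) (Sum.inr r)
  rw [conn_nbr_zero_inl, if_neg hyx, if_neg hyx', conn_nbr_zero_inr, if_neg hK.right_ne.1,
    if_neg hK.right_ne.2] at h1
  rwa [← h1]

/-- The two switches which attach the ends of the chain commute, and a chain of a single colour can
be read from right to left. -/
theorem ClosesRing.symm {V : Type u} {i : Fin 3} {A : FeynmanGraph V} {x y : V} (hyx : y ≠ x)
    (hyx' : y ≠ A.nbr 0 x) (h : ClosesRing i A y x) : ClosesRing i A x y := by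
  intro W _ K m D l r hK
  obtain ⟨n, hn⟩ := h W K m _ _ _ hK.reverse
  refine ⟨n, ?_⟩
  have h1 : (A.conn x K l).switch (Sum.inl y) (Sum.inr r) =
      (A.conn y K r).switch (Sum.inl x) (Sum.inr l) := by
    rw [conn, conn, switch_comm] <;>
      simp [sum_nbr_inl, sum_nbr_inr, hyx, hyx', hK.right_ne]
  rwa [h1]

/-- A ring inserted on a propagator. -/
theorem IsMelonicDecoration.closesRing_nbr {V : Type u} {A : FeynmanGraph V}
    (hA : IsMelonicDecoration melon A) (i : Fin 3) (x : V) : ClosesRing i A x (A.nbr 0 x) := by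
  classical
  intro W _ K m D l r hK
  have hrl := hK.right_ne
  refine ⟨m, ?_⟩
  -- When both ends lie on the same propagator, the chain may first be closed to a ring, which is
  -- then inserted there.
  have h1 : (A.conn x K l).switch (Sum.inl (A.nbr 0 x)) (Sum.inr r) =
      A.conn x (K.switch l r) l := by
    have e1 := (A.sum K).switch_switch_comm (x := Sum.inr l) (y := Sum.inr r) (z := Sum.inl x)
      (by simp [hrl]) (by simp [sum_nbr_inr, hrl]) (by simp) (by simp [sum_nbr_inr]) (by simp)
      (by simp [sum_nbr_inr])
    have e2 := (A.conn x K l).switch_nbr_nbr (Sum.inl (A.nbr 0 x)) (Sum.inr r)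
    rw [conn_nbr_zero_inl, if_neg (A.nbr_ne 0 x), if_pos rfl, conn_nbr_zero_inr, if_neg hrl.1,
      if_neg hrl.2] at e2
    rw [← e2, FeynmanGraph.conn, FeynmanGraph.conn, sum_switch, switch_symm _ (Sum.inl x),
      switch_symm _ (Sum.inl x), e1]
    rfl
  rw [h1]
  exact hA.conn_core hK.isomorphic_dipoleRing x l

/-- A dipole closes a chain of dipoles into a ring. -/
theorem IsChain.isomorphic_dipoleRing_conn {W : Type u} [Finite W] {K : FeynmanGraph W} {m : ℕ}
    {i : Fin 3} {D : ℕ → Bool → W} {l r : W} (h : IsChain K m (fun _ => i.succ) D l r) (b : Bool)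
    (k : Fin 4) : ((FeynmanGraph.melon.conn (b, k) K l).switch
      (Sum.inl (b, k ^^^ i.succ)) (Sum.inr r)).Isomorphic
      (dipoleRing (m + 2) i) := by
  have h1 := h.cons (Fin.succ_ne_zero i)
  rw [seqCons_const] at h1
  refine Isomorphic.trans ?_ h1.isomorphic_dipoleRing
  have h2 := ((isIso_melonShift (b, k ^^^ i.succ)).conn K.isIso_refl (b, k) l).switch
    (Sum.inl (b, k ^^^ i.succ)) (Sum.inr r)
  have e1 : ∀ (b : Bool) (k : Fin 4) (i : Fin 3), melonShift (b, k ^^^ i.succ) (b, k) =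
    (false, i.succ) ∧ melonShift (b, k ^^^ i.succ) (b, k ^^^ i.succ) = (false, 0) := by decide
  simp only [Equiv.sumCongr_apply, Sum.map_inl, Sum.map_inr, (e1 b k i).1, (e1 b k i).2] at h2
  exact ⟨_, h2⟩

/-- Insertion of a melon on a propagator. -/
theorem ClosesRing.conn_melon {V : Type u} {i : Fin 3} {A : FeynmanGraph V} {x y z : V}
    (h : ClosesRing i A x y) (hzx : z ≠ x) (hzy : z ≠ y) (m : Bool × Fin 4) :
    ClosesRing i (A.conn z melon m) (Sum.inl x) (Sum.inl y) := by
  intro W _ K k D l r hK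
  obtain ⟨n, hn⟩ := h W K k D l r hK
  exact ⟨n, (hn.conn_melon (Sum.inl z) m).of_isomorphic
    ⟨_, isIso_switch_conn_conn A melon K hzx hzy m hK.right_ne.2⟩⟩

/-- Insertion of a melon on the propagator which is replaced by a ring. -/
theorem ClosesRing.conn_melon_nbr {V : Type u} {i : Fin 3} {A : FeynmanGraph V} {x : V}
    (h : ClosesRing i A x (A.nbr 0 x)) (m : Bool × Fin 4) :
    ClosesRing i (A.conn x melon m) (Sum.inl x) (Sum.inl (A.nbr 0 x)) := by
  classical
  intro W _ K k D l r hK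
  obtain ⟨n, hn⟩ := h W K k D l r hK
  refine ⟨n, (hn.conn_melon (Sum.inr (K.nbr 0 l)) m).of_isomorphic ⟨sumRightComm _ _ _, ?_⟩⟩
  have h1 := (((isIso_sumRightComm A melon K).switch (Sum.inl (Sum.inl x))
    (Sum.inl (Sum.inr m))).switch (Sum.inl (Sum.inl x)) (Sum.inr l)).switch
    (Sum.inl (Sum.inl (A.nbr 0 x))) (Sum.inr r)
  have h2 : (A.conn x melon m).conn (Sum.inl x) K l = (((A.sum melon).sum K).switch
      (Sum.inl (Sum.inl x)) (Sum.inl (Sum.inr m))).switch (Sum.inl (Sum.inl x)) (Sum.inr l) := by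
    rw [conn, conn, switch_sum]
  have h3 : ((A.conn x K l).switch (Sum.inl (A.nbr 0 x)) (Sum.inr r)).conn
      (Sum.inr (K.nbr 0 l)) melon m =
      ((((A.sum K).sum melon).switch (Sum.inl (Sum.inl x)) (Sum.inl (Sum.inr l))).switch
        (Sum.inl (Sum.inl (A.nbr 0 x))) (Sum.inl (Sum.inr r))).switch
        (Sum.inl (Sum.inr (K.nbr 0 l))) (Sum.inr m) := by
    rw [conn, conn, switch_sum, switch_sum]
  rw [h2, h3]
  change IsIso _ _ _
  convert h1 using 1
  show _ = ((((A.sum K).sum melon).switch (Sum.inl (Sum.inl x)) (Sum.inr m)).switch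
    (Sum.inl (Sum.inl x)) (Sum.inl (Sum.inr l))).switch (Sum.inl (Sum.inl (A.nbr 0 x)))
      (Sum.inl (Sum.inr r))
  have e0 := ((A.sum K).sum melon).switch_switch_comm (x := Sum.inl (Sum.inl x)) (y := Sum.inr m)
    (z := Sum.inl (Sum.inr l)) (by simp) (by simp [sum_nbr_inl]) (by simp) (by simp [sum_nbr_inl])
    (by simp) (by simp [sum_nbr_inr])
  simp only [sum_nbr_inl, sum_nbr_inr] at e0
  have e1 : (((A.sum K).sum melon).switch (Sum.inl (Sum.inl x)) (Sum.inl (Sum.inr l))).nbr 0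
      (Sum.inl (Sum.inl (A.nbr 0 x))) = Sum.inl (Sum.inr (K.nbr 0 l)) := by
    rw [switch_nbr_zero _ (by simp)]
    simp [sum_nbr_inl, sum_nbr_inr, A.nbr_ne]
  have e2 : (((A.sum K).sum melon).switch (Sum.inl (Sum.inl x)) (Sum.inl (Sum.inr l))).nbr 0
      (Sum.inr (melon.nbr 0 m)) = Sum.inr m := by
    rw [switch_nbr_of_ne] <;> simp [sum_nbr_inl, sum_nbr_inr, melon.nbr_nbr]
  rw [e0, switch_switch_comm]
  · rw [e1, e2]
  all_goals first | rw [e1] | rw [e2] | skip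
  all_goals simp [hK.right_ne]

/-- Insertion of a melon whose dipole becomes part of the chain. -/
theorem ClosesRing.conn_melon_inner {V : Type u} {i : Fin 3} {A : FeynmanGraph V} {z y : V}
    (h : ClosesRing i A z y) :
    ClosesRing i (A.conn z melon (false, 0)) (Sum.inr (false, i.succ)) (Sum.inl y) := by
  intro W _ K k D l r hK
  have h1 := hK.cons (Fin.succ_ne_zero i)
  rw [seqCons_const] at h1
  obtain ⟨n, hn⟩ := h _ _ _ _ _ _ h1
  refine ⟨n, hn.of_isomorphic ⟨_, (isIso_conn_assoc A z melon (y := (false, 0))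
    (z := (false, i.succ)) ?_ K l).switch (Sum.inl (Sum.inl y)) (Sum.inr r)⟩⟩
  simp

/-- Insertion of a melon on a ring. -/
theorem IsMelonicDecoration.closesRing_inner {V : Type u} {A : FeynmanGraph V}
    (hA : IsMelonicDecoration melon A) (i : Fin 3) (z : V) (b : Bool) {k : Fin 4} (hk : k ≠ 0)
    (hki : k ≠ i.succ) :
    ClosesRing i (A.conn z melon (false, 0)) (Sum.inr (b, k)) (Sum.inr (b, k ^^^ i.succ)) := by
  intro W _ K m D l r hK
  -- The `m + 1` dipoles of the chain and the one in the melon form a ring of `m + 2` dipoles, which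
  -- is then inserted at `z`.
  refine ⟨m + 1, (hA.conn_core (hK.isomorphic_dipoleRing_conn b k) z
    (Sum.inl ((false, 0) : Bool × Fin 4))).of_isomorphic ⟨Equiv.sumAssoc _ _ _, ?_⟩⟩
  have h1 := (isIso_conn_assoc A z melon (y := (false, 0)) (z := (b, k)) (by simp [hk]) K l).switch
    (Sum.inl (Sum.inr (b, k ^^^ i.succ))) (Sum.inr r)
  change IsIso _ _ _
  convert h1 using 1
  have hki' := (by decide : ∀ (k : Fin 4) (i : Fin 3), k ≠ i.succ → k ^^^ i.succ ≠ 0) k i hki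
  show _ = (A.conn z (melon.conn (b, k) K l) (Sum.inl (false, 0))).switch
    (Sum.inr (Sum.inl (b, k ^^^ i.succ))) (Sum.inr (Sum.inr r))
  generalize hM : melon.conn (b, k) K l = M
  have e1 : ∀ t, M.nbr 0 t = Sum.inl (false, 0) → t = Sum.inl (true, 0) := by
    intro t ht
    rw [← M.nbr_nbr 0 t, ht, ← hM, conn_nbr_zero_inl]
    simp [hk.symm]
  have e2 : Sum.inl (false, 0) ≠ M.nbr 0 (Sum.inl (b, k ^^^ i.succ)) := fun h => by
    simpa [hki'] using e1 _ h.symm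
  have e3 : Sum.inl (false, 0) ≠ M.nbr 0 (Sum.inr r) := fun h => by simpa using e1 _ h.symm
  unfold FeynmanGraph.conn
  rw [sum_switch, switch_comm] <;> simp [sum_nbr_inr, hki'.symm, e2, e3]

/-- Insertion of a melon on a graph all whose faces of colour `i` can be closed by chains. -/
theorem IsMelonicDecoration.closesRing_conn_melon {V : Type u} [Finite V] {A : FeynmanGraph V}
    (hA : IsMelonicDecoration melon A) (i : Fin 3)
    (ih : ∀ x y, y ≠ x → (A.facePerm i.succ).SameCycle x (A.nbr 0 y) → ClosesRing i A x y) (z : V)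
    {X Y : V ⊕ (Bool × Fin 4)} (hne : Y ≠ X)
    (h : ((A.conn z melon (false, 0)).facePerm i.succ).SameCycle X
      ((A.conn z melon (false, 0)).nbr 0 Y)) :
    ClosesRing i (A.conn z melon (false, 0)) X Y := by
  classical
  have hc : i.succ ≠ 0 := Fin.succ_ne_zero i
  set B := A.conn z melon (false, 0) with hB
  have inv := A.nbr_nbr 0
  have Binv := B.nbr_nbr 0
  have hBm : IsMelonicDecoration melon B := hA.conn_melon z (false, 0)
  have hB' : A.conn (A.nbr 0 z) melon (true, 0) = B := A.conn_nbr_nbr z melon (false, 0)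
  -- The positions of the two ends relative to the new melon are treated case by case; exchanging
  -- the two lines and reversing the chain are the symmetries that reduce their number.
  let P : V ⊕ (Bool × Fin 4) → V ⊕ (Bool × Fin 4) → Prop := fun X Y =>
    Y ≠ X → (B.facePerm i.succ).SameCycle X (B.nbr 0 Y) → ClosesRing i B X Y
  have flip : ∀ {X Y}, P (B.nbr 0 X) (B.nbr 0 Y) → P X Y := by
    intro X Y hP hne h
    by_cases hXY : Y = B.nbr 0 X
    · subst hXY
      exact hBm.closesRing_nbr i X
    · refine ClosesRing.flip hne hXY (hP (fun h => hne ((B.nbr_inj 0).1 h)) ?_)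
      rw [Binv]
      exact (B.sameCycle_nbr_zero_comm.1 h).symm
  have symm : ∀ {X Y}, P Y X → P X Y := by
    intro X Y hP hne h
    by_cases hXY : Y = B.nbr 0 X
    · subst hXY
      exact hBm.closesRing_nbr i X
    · exact ClosesRing.symm hne hXY (hP hne.symm (B.sameCycle_nbr_zero_comm.1 h))
  have proj : ∀ y, A.melonProj z i.succ (B.nbr 0 (Sum.inl y)) = some (A.nbr 0 y) := by
    intro y
    rw [hB, conn_nbr_zero_inl]
    split_ifs with e1 e2
    · simp [melonProj, e1]
    · simp [melonProj, e2, inv]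
    · rfl
  have claim1 : ∀ x y, P (Sum.inl x) (Sum.inl y) := by
    intro x y hne h
    have hne' : y ≠ x := fun e => hne (by rw [e])
    obtain ⟨y', e1, e2⟩ := A.sameCycle_melonProj z hc h (x' := x) rfl
    rw [proj, Option.some.injEq] at e1
    subst e1
    have h1 := ih x y hne' e2
    by_cases e3 : z ≠ x ∧ z ≠ y
    · exact h1.conn_melon e3.1 e3.2 _
    by_cases e4 : A.nbr 0 z ≠ x ∧ A.nbr 0 z ≠ y
    · rw [← hB']
      exact h1.conn_melon e4.1 e4.2 _
    -- The melon can be described from either end of its propagator. If both descriptions meet `x`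
    -- or `y`, then `x` and `y` are the two ends of that very propagator.
    have hy : y = A.nbr 0 x := by
      have := A.nbr_ne 0 z
      grind
    subst hy
    rcases (by grind : z = x ∨ z = A.nbr 0 x) with e | e
    · subst e
      exact h1.conn_melon_nbr _
    · have : A.nbr 0 z = x := by rw [e, inv]
      rw [← hB', this]
      exact h1.conn_melon_nbr _
  -- The end in the melon lies on a face that continues into `A`: the melon becomes a dipole of
  -- colour `i` of the chain, which is then closed in `A` itself.
  have claim2 : ∀ b y, P (Sum.inr (b, i.succ)) (Sum.inl y) := by
    intro b y hne h
    obtain ⟨y', e1, e2⟩ := A.sameCycle_melonProj z hc h (x' := if b then A.nbr 0 z else z)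
      (by simp [melonProj])
    rw [proj, Option.some.injEq] at e1
    subst e1
    have hne' : y ≠ if b then A.nbr 0 z else z := by
      intro e
      rw [← e] at e2
      exact A.not_sameCycle_nbr_zero _ _ e2
    have h1 := ih _ y hne' e2
    cases b
    · exact h1.conn_melon_inner
    · rw [← hB']
      refine ClosesRing.of_isIso (A.isIso_refl.conn (isIso_melonShift (true, 0)) (A.nbr 0 z)
        (true, 0)) ?_
      have e3 : ∀ i : Fin 3, melonShift (true, 0) (true, 0) = (false, 0) ∧
        melonShift (true, 0) (true, i.succ) = (false, i.succ) := by decide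
      simp only [Equiv.sumCongr_apply, Sum.map_inl, Sum.map_inr, (e3 i).1, (e3 i).2,
        Equiv.refl_apply]
      exact h1.conn_melon_inner
  have hB0 : ∀ b, B.nbr 0 (Sum.inr (b, 0)) = Sum.inl (if b then A.nbr 0 z else z) := by
    intro b
    rw [hB, conn_nbr_zero_inr]
    cases b <;> simp
  have hBk : ∀ b k, k ≠ 0 → B.nbr 0 (Sum.inr (b, k)) = Sum.inr (!b, k) := by
    intro b k hk
    rw [hB, conn_nbr_zero_inr]
    simp [hk]
  have claim3 : ∀ x b, P (Sum.inl x) (Sum.inr (b, 0)) := by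
    intro x b hne h
    by_cases hx : x = z ∨ x = A.nbr 0 z
    · obtain ⟨y', e1, e2⟩ := A.sameCycle_melonProj z hc h (x' := x) rfl
      rw [hB0, melonProj, Option.some.injEq] at e1
      have hxb : x = if b then A.nbr 0 z else z := by
        rcases hx with rfl | rfl <;> cases b <;>
          simp only [if_true, Bool.false_eq_true, if_false] at e1 ⊢
        · subst e1
          exact absurd e2 (A.not_sameCycle_nbr_zero _ _)
        · subst e1
          exact absurd e2.symm (A.not_sameCycle_nbr_zero _ _)
      have : Sum.inr (b, 0) = B.nbr 0 (Sum.inl x) := by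
        rw [hxb, ← hB0, Binv]
      rw [this]
      exact hBm.closesRing_nbr i _
    · rw [not_or] at hx
      refine flip ?_ hne h
      rw [hB0, hB, conn_nbr_zero_inl, if_neg hx.1, if_neg hx.2]
      exact claim1 _ _
  have claim4 : ∀ x Y, P (Sum.inl x) Y := by
    rintro x (y | ⟨b, k⟩)
    · exact claim1 x y
    by_cases hk : k = 0
    · subst hk
      exact claim3 x b
    by_cases hki : k = i.succ
    · subst hki
      exact symm (claim2 b x)
    -- The remaining corners lie on faces contained in the melon, so they share no face with a
    -- vertex of `A`.
    intro hne h
    obtain ⟨y', e1, e2⟩ := A.sameCycle_melonProj z hc h (x' := x) rfl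
    rw [hBk _ _ hk] at e1
    simp [melonProj, hk, hki] at e1
  have claim5 : ∀ b Y, P (Sum.inr (b, 0)) Y := by
    intro b Y
    apply flip
    rw [hB0]
    exact claim4 _ _
  have claim6 : ∀ X Y, P X Y := by
    rintro (x | ⟨b, k⟩) Y
    · exact claim4 x Y
    by_cases hk : k = 0
    · subst hk
      exact claim5 b Y
    rcases Y with y | ⟨b', k'⟩
    · exact symm (claim4 y _)
    by_cases hk' : k' = 0
    · subst hk'
      exact symm (claim5 _ _)
    intro hne h
    rw [hBk _ _ hk'] at h
    have key : b' = (!b) ∧ k' = k → ClosesRing i B (Sum.inr (b, k)) (Sum.inr (b', k')) := by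
      rintro ⟨rfl, rfl⟩
      rw [← hBk _ _ hk]
      exact hBm.closesRing_nbr i _
    by_cases hki : k = i.succ
    · obtain ⟨y', e1, e2⟩ := A.sameCycle_melonProj z hc h (x' := if b then A.nbr 0 z else z)
        (by simp [melonProj, hki])
      have : k' = i.succ := by
        by_contra hki'
        simp [melonProj, hk', hki'] at e1
      apply key
      subst hki this
      refine ⟨?_, rfl⟩
      by_contra hb
      exact hne (by cases b <;> cases b' <;> simp_all)
    · have hkc := (by decide : ∀ (k : Fin 4) (i : Fin 3), k ≠ i.succ → k ^^^ i.succ ≠ 0 ∧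
        k ^^^ i.succ ^^^ i.succ = k) k i hki
      -- The inner face has length two: the other end is on the same propagator or on the parallel
      -- one, where the melon closes the chain to a ring.
      have := h.mem_of_closed (S := {Sum.inr (b, k), Sum.inr (!b, k ^^^ i.succ)}) (by
        rintro _ (rfl | rfl)
        · rw [facePerm_apply, hBk _ _ hk, hB, conn_nbr_inr _ _ _ _ hc, melon_nbr hc]
          simp
        · rw [facePerm_apply, hBk _ _ hkc.1, hB, conn_nbr_inr _ _ _ _ hc,
            melon_nbr hc, hkc.2]
          simp) (by simp)
      rcases this with e | e
      · apply key
        simp only [Sum.inr.injEq, Prod.mk.injEq] at e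
        exact ⟨by rw [← e.1, Bool.not_not], e.2⟩
      · simp only [Set.mem_singleton_iff, Sum.inr.injEq, Prod.mk.injEq, Bool.not_inj_iff] at e
        rw [e.1, e.2]
        exact hA.closesRing_inner i z b hk hki
  exact claim6 X Y hne h

theorem IsIso.sameCycle {V : Type u} {W : Type v} [Finite V] {G : FeynmanGraph V}
    {H : FeynmanGraph W} {e : V ≃ W} (he : G.IsIso H e) {c : Fin 4} {x y : V}
    (h : (G.facePerm c).SameCycle x y) : (H.facePerm c).SameCycle (e x) (e y) := by
  refine h.mem_of_closed (S := {y | (H.facePerm c).SameCycle (e x) (e y)}) ?_ (.refl _ _)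
  intro z hz
  have : e (G.facePerm c z) = H.facePerm c (e z) := by
    rw [facePerm_apply, he, he, facePerm_apply]
  show (H.facePerm c).SameCycle _ _
  rw [this]
  exact sameCycle_apply_right.2 hz

/-- A face of colour `i` of the melon has two propagators. If both ends are on one of them, a ring
is inserted there; if they are on different ones, the melon itself is the dipole that closes the
chain. -/
theorem IsIso.closesRing_melon {V : Type u} [Finite V] {A : FeynmanGraph V} {e : V ≃ Bool × Fin 4}
    (he : A.IsIso melon e) (i : Fin 3) {x y : V}
    (h : (A.facePerm i.succ).SameCycle x (A.nbr 0 y)) : ClosesRing i A x y := by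
  have h := he.sameCycle h
  rw [he] at h
  obtain ⟨⟨b, k⟩, hx⟩ : ∃ p, e x = p := ⟨_, rfl⟩
  have hk := (by decide : ∀ (k : Fin 4) (i : Fin 3), k ^^^ i.succ ^^^ i.succ = k) k i
  have := h.mem_of_closed (S := {(b, k), (!b, k ^^^ i.succ)}) (by
    rintro _ (rfl | rfl)
    · rw [facePerm_apply, melon_nbr_zero, melon_nbr (Fin.succ_ne_zero i)]
      simp
    · rw [facePerm_apply, melon_nbr_zero, melon_nbr (Fin.succ_ne_zero i), hk]
      simp) (by simp [hx])
  rcases this with h1 | h1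
  · have : y = A.nbr 0 x := by
      apply e.injective
      rw [he, hx, ← h1, melon.nbr_nbr]
    rw [this]
    exact IsMelonicDecoration.closesRing_nbr (.core _ ⟨e, he⟩) i _
  · have hy : e y = (b, k ^^^ i.succ) := by
      rw [← melon.nbr_nbr 0 (e y), h1, melon_nbr_zero, Bool.not_not]
    intro W _ K m D l r hK
    have h2 := (he.conn K.isIso_refl x l).switch (Sum.inl y) (Sum.inr r)
    simp only [Equiv.sumCongr_apply, Sum.map_inl, Sum.map_inr, hx, hy, Equiv.refl_apply] at h2
    exact ⟨_, .core _ (Isomorphic.trans ⟨_, h2⟩ (hK.isomorphic_dipoleRing_conn b k))⟩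

/-- A chain of dipoles of colour `i` closed by two propagators of a face of colour `i` of a melonic
graph is a decorated ring. -/
theorem IsMelonicDecoration.closesRing {V : Type u} {A : FeynmanGraph V}
    (hA : IsMelonicDecoration melon A) [hV : Finite V] (i : Fin 3) {x y : V} (hne : y ≠ x)
    (h : (A.facePerm i.succ).SameCycle x (A.nbr 0 y)) : ClosesRing i A x y := by
  revert hV i x y
  induction hA with
  | core G e =>
    intro hV i x y hne h
    obtain ⟨e, he⟩ := e
    exact IsIso.closesRing_melon (e := e) he i h
  | @insert V V' G z G' hG e ih =>
    intro hV i x y hne h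
    rw [melonInsert_eq_conn] at e
    obtain ⟨e, he⟩ := e
    have : Finite (V ⊕ (Bool × Fin 4)) := Finite.of_equiv _ e
    have : Finite V := Finite.of_injective (Sum.inl : V → V ⊕ (Bool × Fin 4)) Sum.inl_injective
    refine ClosesRing.of_isIso (e := e) he (hG.closesRing_conn_melon i (fun x y => ih i) z
      (fun h => hne (e.injective h)) ?_)
    rw [← he]
    exact IsIso.sameCycle he h

end FeynmanGraph

namespace FeynmanGraph

open Equiv Equiv.Perm

/-! ### The degree of the three families -/

/-- Decorations do not change the degree. -/
theorem IsMelonicDecoration.connected_excess {W : Type v} [Finite W] {C : FeynmanGraph W}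
    (hC : C.Connected) {V : Type u} {G : FeynmanGraph V} (h : IsMelonicDecoration C G) :
    Finite V ∧ G.Connected ∧ G.excess = C.excess := by
  induction h with
  | core G h =>
    have : Finite _ := Finite.of_equiv _ h.choose.symm
    exact ⟨this, h.symm.connected hC, h.excess_eq⟩
  | insert G x G' _ h ih =>
    obtain ⟨hV, hG, hex⟩ := ih
    rw [melonInsert_eq_conn] at h
    have : Finite _ := Finite.of_equiv _ h.choose.symm
    refine ⟨this, h.symm.connected (hG.conn melon_connected _ _), ?_⟩
    rw [h.excess_eq, hG.excess_conn melon_connected, melon_excess, hex, add_zero]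

/-- Chains of dipoles of arbitrary colours exist, and they are melonic. -/
theorem exists_isChain (m : ℕ) (j : ℕ → Fin 4) (hj : ∀ t, j t ≠ 0) :
    ∃ (W : Type) (_ : Finite W) (K : FeynmanGraph W) (D : ℕ → Bool → W) (l r : W),
      IsChain K m j D l r ∧ K.excess = 0 := by
  induction m generalizing j with
  | zero => exact ⟨_, inferInstance, melon, _, _, _, .melon j hj, melon_excess⟩
  | succ m ih =>
    obtain ⟨W, _, K, D, l, r, hK, hex⟩ := ih (fun t => j (t + 1)) fun t => hj _
    have h1 := hK.cons (hj 0)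
    have h2 : seqCons (j 0) (fun t => j (t + 1)) = j := by
      funext t
      cases t <;> rfl
    rw [h2] at h1
    refine ⟨_, inferInstance, _, _, _, _, h1, ?_⟩
    rw [melon_connected.excess_conn hK.connected, melon_excess, hex, add_zero]

/-- The graph is a connected sum of two one-bubble graphs, of excess 1 each, and, if there are
dipoles, of a chain of excess 0. -/
theorem tadpoleChain_connected_excess {m : ℕ} (i i' : Fin 3) (j : Fin m → Fin 3) :
    (tadpoleChain i i' j).Connected ∧ (tadpoleChain i i' j).excess = 2 := by
  have hi := doubleTadpole_connected i
  have hi' := doubleTadpole_connected i'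
  rcases m with _ | m
  · have h := doubleTadpole_conn_isomorphic i i' j
    refine ⟨h.connected (hi.conn hi' _ _), ?_⟩
    rw [← h.excess_eq, hi.excess_conn hi', doubleTadpole_excess, doubleTadpole_excess]
    rfl
  · let j' : ℕ → Fin 3 := fun t => if ht : t < m + 1 then j ⟨t, ht⟩ else 0
    obtain ⟨W, _, K, D, l, r, hK, hex⟩ := exists_isChain m (fun t => (j' t).succ)
      fun t => Fin.succ_ne_zero _
    have h := hK.isomorphic_tadpoleChain i i'
    have hj : (fun t : Fin (m + 1) => j' t) = j := by
      funext t
      simp only [j', dif_pos t.2]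
    rw [hj] at h
    have h1 := hi.conn hK.connected ((), 0) l
    refine ⟨h.connected (h1.conn hi' _ _), ?_⟩
    rw [← h.excess_eq, h1.excess_conn hi', hi.excess_conn hK.connected, doubleTadpole_excess,
      doubleTadpole_excess, hex]
    rfl

theorem dipoleRing_connected (m : ℕ) (i : Fin 3) : (dipoleRing (m + 1) i).Connected := by
  refine ofPropagator_connected _ _ (0, false) ?_
  rintro T hT ⟨⟨l, s⟩, h⟩
  have i0 : i.succ ≠ 0 := Fin.succ_ne_zero i
  have h1 : ∀ l s, (l, s) ∈ T → (l + 1, s) ∈ T := fun l s h => by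
    simpa [dipoleRingProp] using hT _ h i.succ
  have h2 : ∀ l s, (l, s) ∈ T → (l, !s) ∈ T := fun l s h => by
    have := (by decide : ∀ i : Fin 3, (i + 1).succ ≠ i.succ) i
    simpa [dipoleRingProp, this] using hT _ h (i + 1).succ
  have h3 : ∀ (n : ℕ) l s, (l, s) ∈ T → (l + n, s) ∈ T := by
    intro n
    induction n with
    | zero => simp
    | succ n ih =>
      intro l s h
      have := h1 _ _ (ih l s h)
      push_cast
      rwa [← add_assoc]
  have h4 := h3 (-l).val l s h
  rw [ZMod.natCast_zmod_val, add_neg_cancel] at h4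
  cases s
  · exact h4
  · exact h2 _ _ h4

/-- The ring is a chain of excess 0 with its ends switched. The top line runs along one face of
colour `i`, which splits, while for each of the other two colours the ends are on different faces,
which merge. The net loss of one face raises the excess by 2. -/
theorem dipoleRing_excess (m : ℕ) (i : Fin 3) : (dipoleRing (m + 2) i).excess = 2 := by
  have i0 : i.succ ≠ 0 := Fin.succ_ne_zero i
  obtain ⟨W, _, K, D, l, r, h, hex⟩ := exists_isChain (m + 1) (fun _ => i.succ) fun _ => i0
  have hiso := h.isomorphic_dipoleRing
  have hcon : (K.switch l r).Connected := hiso.symm.connected (dipoleRing_connected (m + 1) i)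
  have hB : (K.switch l r).numBubbles = K.numBubbles := by
    have h1 := K.four_mul_numBubbles
    have h2 := (K.switch l r).four_mul_numBubbles
    omega
  have T : ∀ i : Fin 3, Triple i.succ (i + 1).succ (i + 2).succ := by decide
  have e1 : (K.switch l r).numCycles 0 i.succ = K.numCycles 0 i.succ + 1 := by
    refine K.numCycles_switch_of_sameCycle i0 h.right_ne.2 ?_
    have key : ∀ t ≤ m + 1, (K.facePerm i.succ).SameCycle l (D t false) := by
      intro t ht
      induction t with
      | zero => rw [h.left_eq]
      | succ t ih =>
        rw [← h.link t (by omega)]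
        exact (ih (by omega)).trans (K.sameCycle_step _ _)
    rw [← h.right_eq]
    exact (key _ le_rfl).trans (K.sameCycle_step _ _)
  have e2 : ∀ k, k ≠ 0 → k ≠ i.succ →
      (K.switch l r).numCycles 0 k + 1 = K.numCycles 0 k := by
    intro k k0 ki
    refine K.numCycles_switch_of_not k0 fun hf => ?_
    -- The face of another colour through the left leg stays inside the first dipole, so it does not
    -- reach the last one.
    have key : ∀ y, (K.facePerm k).SameCycle l y → y = D 0 false ∨ y = K.nbr k (D 0 true) := by
      intro y hy
      refine hy.mem_of_closed (S := {D 0 false, K.nbr k (D 0 true)}) ?_ (by simp [h.left_eq])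
      rintro _ (rfl | rfl)
      · rw [facePerm_apply, h.left]
        simp
      · rw [facePerm_apply, h.inner 0 (by omega) true k k0 ki, K.nbr_nbr]
        simp
    have key2 : ∀ s, ¬ (K.nbr i.succ (D (m + 1) s) = D 0 false ∨
        K.nbr i.succ (D (m + 1) s) = K.nbr k (D 0 true)) := by
      intro s hs
      have h1 : ∀ {s' k'}, K.corner i.succ (D (m + 1) s) = K.corner k' (D 0 s') → False := by
        intro s' k' e
        have := h.corner_inj le_rfl (Nat.zero_le _) e
        simp at this
      rcases hs with hs | hs
      · exact h1 (s' := false) (k' := 0) (by rw [corner_of_ne _ i0, corner_zero, hs])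
      · exact h1 (s' := true) (k' := k) (by rw [corner_of_ne _ i0, corner_of_ne _ k0, hs])
    rcases hf with hf | hf
    · rw [← h.right_eq] at hf
      exact key2 _ (key _ hf)
    · rw [h.nbr_right] at hf
      exact key2 _ (key _ hf)
  have hi12 : ∀ i : Fin 3, (i + 1).succ ≠ i.succ ∧ (i + 2).succ ≠ i.succ := by decide
  have e3 := e2 (i + 1).succ (Fin.succ_ne_zero _) (hi12 i).1
  have e4 := e2 (i + 2).succ (Fin.succ_ne_zero _) (hi12 i).2
  have hE := K.excess_eq (T i)
  rw [← hiso.excess_eq, (K.switch l r).excess_eq (T i), hB, hcon.numComp_eq]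
  rw [h.connected.numComp_eq] at hE
  omega

theorem octahedron_connected (i : Fin 3) : (octahedron i).Connected := by
  refine ofPropagator_connected _ _ (0, false) ?_
  rintro T hT ⟨⟨a, s⟩, h⟩
  have h1 : ∀ a s, (a, s) ∈ T → (a + 1, false) ∈ T := fun a s h => by
    simpa [octahedronProp] using hT _ h 0
  have h2 := h1 _ _ h
  have h3 := h1 _ _ h2
  have h4 := h1 _ _ h3
  have h5 : ∀ a : Fin 3, a + 1 = 0 ∨ a + 1 + 1 = 0 ∨ a + 1 + 1 + 1 = 0 := by decide
  rcases h5 a with e | e | e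
  · rwa [e] at h2
  · rwa [e] at h3
  · rwa [e] at h4

theorem octahedron_isDipoleFree (i : Fin 3) : (octahedron i).IsDipoleFree := by
  have : ∀ i : Fin 3, ∀ c : Fin 4, c ≠ 0 → ∀ x, (octahedron i).nbr 0 ((octahedron i).nbr c x) ≠
    (octahedron i).nbr c ((octahedron i).nbr 0 x) := by decide
  exact fun c x h => this i c h.1 x h.2.2

/-- The octahedron has no small edge cut. -/
theorem octahedron_cut (i : Fin 3) (f : Fin 3 × Bool → Bool)
    (hf : (Finset.univ.filter fun z : (Fin 3 × Bool) × Fin 4 =>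
      f z.1 = true ∧ f (octahedronProp i z).1 = false).card ≤ 2) (b b' : Fin 3 × Bool) :
    f b = f b' := by
  -- A set of bubbles is encoded by six Booleans, which makes this a check of 64 sets for each
  -- colour.
  have key : ∀ (i : Fin 3) (t₀ t₁ t₂ t₃ t₄ t₅ : Bool),
      let g : Fin 3 × Bool → Bool := fun p => if p.1 = 0 then cond p.2 t₀ t₁ else
        if p.1 = 1 then cond p.2 t₂ t₃ else cond p.2 t₄ t₅
      (Finset.univ.filter fun z : (Fin 3 × Bool) × Fin 4 =>
        g z.1 = true ∧ g (octahedronProp i z).1 = false).card ≤ 2 → ∀ b b', g b = g b' := by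
    decide
  have hg : f = fun p => if p.1 = 0 then cond p.2 (f (0, true)) (f (0, false)) else
      if p.1 = 1 then cond p.2 (f (1, true)) (f (1, false)) else
        cond p.2 (f (2, true)) (f (2, false)) := by
    funext ⟨a, s⟩
    fin_cases a <;> cases s <;> rfl
  have := key i (f (0, true)) (f (0, false)) (f (1, true)) (f (1, false)) (f (2, true)) (f (2, false))
  rw [← hg] at this
  exact this hf b b'

/-- What can be reached without the two removed propagators is a union of bubbles, and only one end
of each removed propagator can leave it. So its boundary has at most two edges and `octahedron_cut`
applies. -/
theorem octahedron_isTwoPI (i : Fin 3) : (octahedron i).IsTwoPI := by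
  classical
  rintro x y ⟨-, -, hn⟩
  refine hn fun a b => ?_
  set R : (Fin 3 × Bool) × Fin 4 → (Fin 3 × Bool) × Fin 4 → Prop := fun s t =>
    ∃ c, (octahedron i).nbr c s = t ∧
      ¬ (c = 0 ∧ (s = x ∨ s = (octahedron i).nbr 0 x ∨ s = y ∨ s = (octahedron i).nbr 0 y)) with hR
  have hinv : ∀ z, octahedronProp i (octahedronProp i z) = z := (octahedron i).nbr_nbr 0
  have hk : ∀ z c, c ≠ 0 → Relation.ReflTransGen R a z →
      Relation.ReflTransGen R a (z.1, z.2 ^^^ c) := fun z c hc hz =>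
    hz.tail ⟨c, by simp [octahedron, ofPropagator, hc], fun h => hc h.1⟩
  have hc : ∀ z, Relation.ReflTransGen R a z ↔ Relation.ReflTransGen R a (z.1, 0) := by
    rintro ⟨β, k⟩
    by_cases hk0 : k = 0
    · rw [hk0]
    have h1 := hk (β, k) k hk0
    have h2 := hk (β, 0) k hk0
    simp only [(by decide : ∀ k : Fin 4, k ^^^ k = 0) k, (by decide : ∀ k : Fin 4, 0 ^^^ k = k) k]
      at h1 h2
    exact ⟨h1, h2⟩
  let f : Fin 3 × Bool → Bool := fun β => decide (Relation.ReflTransGen R a (β, 0))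
  have hf : ∀ z : (Fin 3 × Bool) × Fin 4, f z.1 = true ↔ Relation.ReflTransGen R a z := by
    intro z
    rw [hc]
    simp [f]
  let p : (Fin 3 × Bool) × Fin 4 → (Fin 3 × Bool) × Fin 4 := fun z =>
    if f z.1 = true then z else octahedronProp i z
  have hcut := octahedron_cut i f (by
    refine (Finset.card_le_card (t := {p x, p y}) ?_).trans Finset.card_le_two
    intro z hz
    simp only [Finset.mem_filter, Finset.mem_univ, true_and] at hz
    have h1 : z = x ∨ z = octahedronProp i x ∨ z = y ∨ z = octahedronProp i y := by
      by_contra hcon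
      have h2 : f (octahedronProp i z).1 = true :=
        (hf _).2 (((hf z).1 hz.1).tail ⟨0, rfl, fun h => hcon h.2⟩)
      rw [hz.2] at h2
      simp at h2
    have h3 : ∀ w, z = w ∨ z = octahedronProp i w → z = p w := by
      rintro w (rfl | rfl)
      · simp only [p, if_pos hz.1]
      · rw [hinv] at hz
        simp [p, hz.2]
    rw [Finset.mem_insert, Finset.mem_singleton]
    rcases h1 with h | h | h | h
    · exact Or.inl (h3 x (Or.inl h))
    · exact Or.inl (h3 x (Or.inr h))
    · exact Or.inr (h3 y (Or.inl h))
    · exact Or.inr (h3 y (Or.inr h))) a.1 b.1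
  rw [← hf, ← hcut, hf]

theorem octahedron_numBubbles (i : Fin 3) : (octahedron i).numBubbles = 6 := by
  have := (octahedron i).four_mul_numBubbles
  simp only [Nat.card_eq_fintype_card, Fintype.card_prod, Fintype.card_bool, Fintype.card_fin]
    at this
  omega

/-- The face lengths 4, 3, 3 only give the upper bound; that the value is not smaller follows from
the classification of dipole-free 2PI graphs. -/
theorem octahedron_excess (i : Fin 3) : (octahedron i).excess = 2 := by
  have hG := octahedron_connected i
  have hB := octahedron_numBubbles i
  refine (hG.isomorphic_octahedron_of_isDipoleFree (octahedron_isTwoPI i) (by omega) ?_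
    (octahedron_isDipoleFree i)).1
  have T : ∀ i : Fin 3, Triple i.succ (i + 1).succ (i + 2).succ := by decide
  have hE := (octahedron i).excess_eq (T i)
  rw [hG.numComp_eq] at hE
  have h1 := (octahedron i).card_le_mul_numCycles (c := i.succ) (L := 4) (by norm_num) (by
    clear hG hB hE
    revert i
    show ∀ i : Fin 3, ∀ x, (fun z => (octahedron i).nbr i.succ ((octahedron i).nbr 0 z))^[4] x = x
    decide)
  have h2 := (octahedron i).card_le_mul_numCycles (c := (i + 1).succ) (L := 3) (by norm_num) (by
    clear hG hB hE h1
    revert i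
    show ∀ i : Fin 3, ∀ x,
      (fun z => (octahedron i).nbr (i + 1).succ ((octahedron i).nbr 0 z))^[3] x = x
    decide)
  have h3 := (octahedron i).card_le_mul_numCycles (c := (i + 2).succ) (L := 3) (by norm_num) (by
    clear hG hB hE h1 h2
    revert i
    show ∀ i : Fin 3, ∀ x,
      (fun z => (octahedron i).nbr (i + 2).succ ((octahedron i).nbr 0 z))^[3] x = x
    decide)
  simp only [Nat.card_eq_fintype_card, Fintype.card_prod, Fintype.card_bool, Fintype.card_fin]
    at h1 h2 h3
  omega

/-! ### Graphs of degree one -/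

theorem Isomorphic.isTwoPI {V : Type u} {W : Type v} {G : FeynmanGraph V} {H : FeynmanGraph W}
    (h : G.Isomorphic H) (hH : H.IsTwoPI) : G.IsTwoPI := by
  obtain ⟨e, he⟩ := h
  rintro x y ⟨h1, h2, h3⟩
  refine hH (e x) (e y) ⟨fun h => h1 (e.injective h), fun h => h2 (e.injective (by rw [h, he])),
    fun hall => h3 fun a b => ?_⟩
  have h4 := (hall (e a) (e b)).lift (p := fun s t => ∃ c, G.nbr c s = t ∧
        ¬ (c = 0 ∧ (s = x ∨ s = G.nbr 0 x ∨ s = y ∨ s = G.nbr 0 y))) e.symm (by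
    rintro s _ ⟨c, rfl, hc⟩
    obtain ⟨s, rfl⟩ := e.surjective s
    refine ⟨c, by rw [← he, e.symm_apply_apply, e.symm_apply_apply], ?_⟩
    rw [← he, ← he] at hc
    simpa using hc)
  simpa [Function.onFun] using h4

theorem Isomorphic.isDipoleFree {V : Type u} {W : Type v} {G : FeynmanGraph V}
    {H : FeynmanGraph W} (h : G.Isomorphic H) (hH : H.IsDipoleFree) : G.IsDipoleFree := by
  obtain ⟨e, he⟩ := h
  rintro i x ⟨h1, h2, h3⟩
  refine hH i (e x) ⟨h1, fun c hc h => h2 c hc (e.injective (by rw [he, h, he])), ?_⟩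
  rw [← he, ← he, h3, he, he]

/-- The corners at which the ring with one dipole is read as two tadpoles. -/
def dipoleRingOneBase (i : Fin 3) : ChainBubble 0 → (ZMod 1 × Bool) × Fin 4
  | .left => ((0, false), (i + 1).succ)
  | .dipole l _ => l.elim0
  | .right => ((0, true), (i + 1).succ)

/-- The ring with one dipole. -/
theorem dipoleRing_one_isomorphic (i : Fin 3) (j : Fin 0 → Fin 3) :
    (dipoleRing 1 i).Isomorphic (tadpoleChain i i j) := by
  have hn : (dipoleRing 1 i).numBubbles = 2 := by
    have := (dipoleRing 1 i).four_mul_numBubbles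
    simp only [Nat.card_eq_fintype_card, Fintype.card_prod, Fintype.card_bool, Fintype.card_fin,
      ZMod.card] at this
    omega
  have key : ∀ (i : Fin 3) (m : Fin 4) (b : ChainBubble 0), b = .left ∨ b = .right →
      (dipoleRing 1 i).nbr 0 ((dipoleRing 1 i).corner m (dipoleRingOneBase i b)) =
        (dipoleRing 1 i).corner (tadpoleChainProp i i Fin.elim0 (b, m)).2
          (dipoleRingOneBase i (tadpoleChainProp i i Fin.elim0 (b, m)).1) := by
    rintro i m b (rfl | rfl)
    · revert i m; decide
    · revert i m; decide
  obtain ⟨e, he, -⟩ := (dipoleRing_connected 0 i).exists_isIso_of_base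
    (tadpoleChainProp_involutive i i j) (tadpoleChainProp_ne i i j) (dipoleRingOneBase i) (by
      obtain rfl : j = Fin.elim0 := Subsingleton.elim _ _
      rintro (_ | ⟨l, _⟩ | _) m
      · exact key i m _ (Or.inl rfl)
      · exact l.elim0
      · exact key i m _ (Or.inr rfl)) (by rw [card_chainBubble, hn])
  exact Isomorphic.symm ⟨e, he⟩

/-- A decoration of one of the three families of graphs of degree one. -/
def IsDegreeOneDecoration {V : Type u} (G : FeynmanGraph V) : Prop :=
  (∃ i : Fin 3, IsMelonicDecoration (octahedron i) G) ∨
    (∃ (m : ℕ) (i i' : Fin 3) (j : Fin m → Fin 3), IsMelonicDecoration (tadpoleChain i i' j) G) ∨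
    ∃ (m : ℕ) (i : Fin 3), 2 ≤ m ∧ IsMelonicDecoration (dipoleRing m i) G

theorem IsDegreeOneDecoration.imp {V W : Type u} {G : FeynmanGraph V} {H : FeynmanGraph W}
    (hG : G.IsDegreeOneDecoration)
    (h : ∀ {U : Type} {C : FeynmanGraph U}, IsMelonicDecoration C G → IsMelonicDecoration C H) :
    H.IsDegreeOneDecoration := by
  rcases hG with ⟨i, hi⟩ | ⟨m, i, i', j, hi⟩ | ⟨m, i, hm, hi⟩
  · exact Or.inl ⟨i, h hi⟩
  · exact Or.inr (Or.inl ⟨m, i, i', j, h hi⟩)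
  · exact Or.inr (Or.inr ⟨m, i, hm, h hi⟩)

theorem IsDegreeOneDecoration.connected_excess {V : Type u} {G : FeynmanGraph V}
    (h : G.IsDegreeOneDecoration) : G.Connected ∧ G.excess = 2 := by
  rcases h with ⟨i, hi⟩ | ⟨m, i, i', j, hi⟩ | ⟨m, i, hm, hi⟩
  · have := hi.connected_excess (octahedron_connected i)
    rw [octahedron_excess] at this
    exact this.2
  · obtain ⟨h1, h2⟩ := tadpoleChain_connected_excess i i' j
    have := hi.connected_excess h1
    rw [h2] at this
    exact this.2
  · obtain ⟨m, rfl⟩ := Nat.exists_eq_add_of_le' hm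
    have := hi.connected_excess (dipoleRing_connected (m + 1) i)
    rw [dipoleRing_excess] at this
    exact this.2

/-- Classification of the graphs of degree one. -/
theorem Connected.isDegreeOneDecoration {V : Type u} [Finite V] {G : FeynmanGraph V}
    (hG : G.Connected) (hex : G.excess = 2) : G.IsDegreeOneDecoration := by
  induction hn : Nat.card V using Nat.strong_induction_on generalizing V with
  | _ n ih =>
    rcases hG.numBubbles_cases with ⟨i, h⟩ | hV
    · have := h.excess_eq
      rw [doubleTadpole_excess] at this
      omega
    by_cases h2 : G.IsTwoPI
    · by_cases hd : G.IsDipoleFree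
      · obtain ⟨i, hi⟩ := (hG.isomorphic_octahedron_of_isDipoleFree h2 hV hex.le hd).2
        exact Or.inl ⟨i, .core _ hi⟩
      simp only [IsDipoleFree, not_forall, not_not] at hd
      obtain ⟨c, x, hd⟩ := hd
      rcases hG.exists_switch_of_dipole h2 hV hex.le hd with h | ⟨-, S, A, w, u, hA, hA0, hne, hs, h⟩
      · have := h.excess_eq
        rw [melon_excess] at this
        omega
      obtain ⟨i, rfl⟩ := Fin.exists_succ_eq.2 hd.1
      -- The dipole is itself a chain with one dipole, closed on the melonic graph `A`.
      obtain ⟨k, hk⟩ := (hA.isMelonicDecoration_melon hA0).closesRing i hne hs _ _ _ _ _ _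
        (IsChain.melon (fun _ => i.succ) fun _ => Fin.succ_ne_zero i)
      have hk := hk.of_isomorphic h
      -- A ring with a single dipole is not in the third family: it is the graph of two tadpoles of
      -- the same colour joined directly.
      rcases k with _ | k
      · exact Or.inr (Or.inl ⟨0, i, i, Fin.elim0, hk.core_isomorphic (dipoleRing_one_isomorphic i _)⟩)
      · exact Or.inr (Or.inr ⟨k + 2, i, by omega, hk⟩)
    · obtain ⟨V₁, V₂, H, K, x, y, f₁, f₂, hH, hK, c₁, c₂, hs, h⟩ := exists_smaller_summands hG h2
      have h3 := H.excess_nonneg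
      have h4 := K.excess_nonneg
      -- The excess 2 splits as `0 + 2`, `2 + 0` or `1 + 1`.
      by_cases h5 : H.excess = 0
      · exact (ih _ (hn ▸ c₂) hK (by omega) rfl).imp fun hi =>
          ((hH.isMelonicDecoration_melon h5).conn_left hi y x).of_isomorphic h
      by_cases h6 : K.excess = 0
      · exact (ih _ (hn ▸ c₁) hH (by omega) rfl).imp fun hi =>
          ((hK.isMelonicDecoration_melon h6).conn hi x y).of_isomorphic h
      obtain ⟨i, hi⟩ := hH.isMelonicDecoration_doubleTadpole (by omega)
      obtain ⟨i', hi'⟩ := hK.isMelonicDecoration_doubleTadpole (by omega)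
      obtain ⟨m, j, hj⟩ := (hi.isDecoratedTadpoleChain_conn hi' x y).of_isomorphic h
      exact Or.inr (Or.inl ⟨m, i, i', j, hj⟩)

theorem Connected.degree_eq_one_iff {V : Type u} [Finite V] {G : FeynmanGraph V}
    (hG : G.Connected) : G.degree = 1 ↔ G.excess = 2 := by
  have h := hG.two_mul_degree
  constructor
  · intro h1
    rw [h1] at h
    have : ((2 : ℤ) : ℚ) = G.excess := by rw [← h]; norm_num
    exact_mod_cast this.symm
  · intro h1
    rw [h1] at h
    push_cast at h
    linarith

end FeynmanGraph

/-! ### The classification in degree one. -/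

theorem theorem6p2 {V : Type*} [Finite V] (G : FeynmanGraph V) :
    (G.Connected ∧ G.degree = 1 ↔
      (∃ i : Fin 3, FeynmanGraph.IsMelonicDecoration (FeynmanGraph.octahedron i) G) ∨
      (∃ (m : ℕ) (i i' : Fin 3) (j : Fin m → Fin 3),
        FeynmanGraph.IsMelonicDecoration (FeynmanGraph.tadpoleChain i i' j) G) ∨
      (∃ (m : ℕ) (i : Fin 3), 2 ≤ m ∧
        FeynmanGraph.IsMelonicDecoration (FeynmanGraph.dipoleRing m i) G)) ∧
    (G.Connected ∧ G.degree = 1 ∧ G.IsTwoPI ∧ G.IsDipoleFree ↔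
      ∃ i : Fin 3, G.Isomorphic (FeynmanGraph.octahedron i)) := by
  constructor
  · change _ ↔ G.IsDegreeOneDecoration
    constructor
    · rintro ⟨hG, h⟩
      exact hG.isDegreeOneDecoration (hG.degree_eq_one_iff.1 h)
    · intro h
      obtain ⟨hG, hex⟩ := h.connected_excess
      exact ⟨hG, hG.degree_eq_one_iff.2 hex⟩
  · constructor
    · rintro ⟨hG, h, h2, hd⟩
      have hex := hG.degree_eq_one_iff.1 h
      -- Graphs with one bubble have degree one half and are excluded.
      rcases hG.numBubbles_cases with ⟨i, h⟩ | hV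
      · have := h.excess_eq
        rw [FeynmanGraph.doubleTadpole_excess] at this
        omega
      · exact (hG.isomorphic_octahedron_of_isDipoleFree h2 hV hex.le hd).2
    · rintro ⟨i, h⟩
      have hG := FeynmanGraph.Isomorphic.connected (FeynmanGraph.Isomorphic.symm h)
        (FeynmanGraph.octahedron_connected i)
      refine ⟨hG, hG.degree_eq_one_iff.2 ?_, h.isTwoPI (FeynmanGraph.octahedron_isTwoPI i),
        h.isDipoleFree (FeynmanGraph.octahedron_isDipoleFree i)⟩
      rw [h.excess_eq, FeynmanGraph.octahedron_excess]
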